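/- Let $X$ be a compact (Hausdorff) smooth $n$-dimensional manifold with corners, $\pi:W\to X$ a smooth real vector bundle of rank $m$, and $r\ge 0$ an integer. A body $R\subseteq X$ is a compact $n$-dimensional submanifold with corners ($R=X$ is allowed; the other bodies are called sub-bodies). $C^r(W|_R)$ denotes the space of $C^r$-sections of $W$ over $R$ with the $C^r$-norm of a precompact atlas: finitely many vector bundle charts $(U_i,\varphi_i,\Phi_i)$ and compact sets $K_i\subset U_i\cap R$ whose interiors relative to $R$ cover $R$, with $\|w\|^r=\sup\{|\partial_I w_i^\alpha(\varphi_i(x))| : i,\ \alpha\le m,\ |I|\le r,\ x\in K_i\}$. A force on $R$ is a continuous linear functional $F\in C^r(W|_R)^*$. Let $J^rW$ be the $r$-jet bundle and $\hat J^rW$ the iterated (non-holonomic) jet bundle, $\hat J^0W=W$, $\hat J^{r+1}W=J^1(\hat J^{r}W)$, with the jet extensions $j^r$ and $\hat\jmath^{\,r}=j^1\circ\hat\jmath^{\,r-1}$ of $C^r$-sections. Let $E$ be $J^rW$ or $\hat J^rW$, of rank $N$. A vector-valued Radon measure $\varsigma$ acting on sections of $E$ is a family that assigns to every vector bundle chart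 $a=(U_a,\varphi_a,\Phi_a)$ of $W$ an $N$-tuple $(\varsigma_{a,c})_{c}$ of real (signed, locally finite) Radon measures on $\varphi_a(U_a)$, one for each local component of $E$, such that $\sum_c\int\chi_a^c\,d\varsigma_{a,c}=\sum_c\int\chi_b^c\,d\varsigma_{b,c}$ for all charts $a,b$ and every continuous section $\chi$ of $E$ supported in $U_a\cap U_b$. It is called a hyper-stress measure for $E=J^rW$ and a non-holonomic stress measure for $E=\hat J^rW$. For a body $R$ and a continuous section $\chi$ of $E$ over $R$, put $$\int_R\chi\cdot d\varsigma:=\sum_{a}\sum_c\int_{\varphi_a(U_a\cap R)}u_a\,\chi_a^c\,d\varsigma_{a,c},$$ where $(u_a)$ is a partition of unity subordinate to a finite vector bundle atlas. Then: 1. For all hyper-stress measures $\varsigma$ and non-holonomic stress measures $\hat\varsigma$, all the integrals above exist and their sum does not depend on the atlas and the partition of unity. For every body $R$, $F_R(w)=\int_R j^rw\cdot d\varsigma$, respectively $F_R(w)=\int_R\hat\jmath^{\,r}w\cdot d\hat\varsigma$, $w\in C^r(W|_R)$, is a force on $R$; thus each stress measure induces a force system $R\mapsto F_R$. 2. For every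 force $F\in C^r(W)^*$ there are a hyper-stress measure $\varsigma$ and a non-holonomic stress measure $\hat\varsigma$ such that $$F(w)=\int_X j^rw\cdot d\varsigma=\int_X\hat\jmath^{\,r}w\cdot d\hat\varsigma\qquad\text{for all } w\in C^r(W),$$ and such that both induce the same force system, $F_R(w)=\int_R j^rw\cdot d\varsigma=\int_R\hat\jmath^{\,r}w\cdot d\hat\varsigma$ for every body $R$ and every $w\in C^r(W|_R)$. 3. If $r\ge1$, $n\ge1$, $m\ge1$ and $X\ne\emptyset$, the representing measures are not unique: for every hyper-stress measure representing $F$ there is a different one representing $F$, and likewise for non-holonomic stress measures. -/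

import Mathlib

open scoped Manifold ContDiff Topology
open Bundle MeasureTheory Set

universe u

noncomputable section

namespace GlobalStress

/-- The model with corners of `n`-dimensional manifolds with corners: the closed quadrant
`{y ∈ ℝⁿ | 0 ≤ yⁱ for all i}` in `ℝⁿ`. -/
abbrev quadrant (n : ℕ) :
    ModelWithCorners ℝ (EuclideanSpace ℝ (Fin n)) (EuclideanQuadrant n) :=
  modelWithCornersEuclideanQuadrant n

section Bodies

/-- A (sub-)body of the `n`-dimensional manifold with corners `X`: a compact subset which is an
`n`-dimensional submanifold with corners. Near the image of each of its points under a chart `φ`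
of `X`, it is mapped by a local diffeomorphism `ψ` of `ℝⁿ` to the closed quadrant. -/
structure Body (n : ℕ) (X : Type u) [TopologicalSpace X]
    [ChartedSpace (EuclideanQuadrant n) X] where
  carrier : Set X
  isCompact : IsCompact carrier
  locally_quadrant : ∀ x ∈ carrier,
    ∃ φ ∈ IsManifold.maximalAtlas (quadrant n) ∞ X, x ∈ φ.source ∧
      ∃ ψ : OpenPartialHomeomorph (EuclideanSpace ℝ (Fin n)) (EuclideanSpace ℝ (Fin n)),
        ContDiffOn ℝ ∞ ψ ψ.source ∧ ContDiffOn ℝ ∞ ψ.symm ψ.target ∧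
        φ.extend (quadrant n) x ∈ ψ.source ∧
        ∀ y ∈ ψ.source,
          (y ∈ φ.extend (quadrant n) '' (φ.source ∩ carrier) ↔ ∀ i, 0 ≤ ψ y i)

variable {n : ℕ} {X : Type u} [TopologicalSpace X] [ChartedSpace (EuclideanQuadrant n) X]

/-- The whole compact manifold with corners, as a body. -/
def Body.whole (n : ℕ) (X : Type u) [TopologicalSpace X] [ChartedSpace (EuclideanQuadrant n) X]
    [CompactSpace X] [IsManifold (quadrant n) ∞ X] : Body n X where
  carrier := univ
  isCompact := isCompact_univ
  locally_quadrant := by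
    intro x _
    refine ⟨chartAt (EuclideanQuadrant n) x, IsManifold.chart_mem_maximalAtlas x,
      mem_chart_source _ x, ?_⟩
    obtain ⟨V, hV, hVe⟩ := isOpen_induced_iff.1 (chartAt (EuclideanQuadrant n) x).open_target
    refine ⟨OpenPartialHomeomorph.ofSet V hV, contDiffOn_id, contDiffOn_id, ?_, ?_⟩
    · have : chartAt (EuclideanQuadrant n) x x ∈ (chartAt (EuclideanQuadrant n) x).target :=
        mem_chart_target _ x
      rw [← hVe] at this
      exact this
    · intro y hy
      constructor
      · rintro ⟨z, -, rfl⟩ i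
        exact (chartAt (EuclideanQuadrant n) x z).2 i
      · intro h
        have h1 : (⟨y, h⟩ : EuclideanQuadrant n) ∈ (chartAt (EuclideanQuadrant n) x).target := by
          rw [← hVe]; exact hy
        refine ⟨(chartAt (EuclideanQuadrant n) x).symm ⟨y, h⟩,
          ⟨(chartAt (EuclideanQuadrant n) x).map_target h1, mem_univ _⟩, ?_⟩
        change ((chartAt (EuclideanQuadrant n) x)
          ((chartAt (EuclideanQuadrant n) x).symm ⟨y, h⟩)).1 = y
        rw [(chartAt (EuclideanQuadrant n) x).right_inv h1]

end Bodies

section Charts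

variable (n m : ℕ) {X : Type u} [TopologicalSpace X] [ChartedSpace (EuclideanQuadrant n) X]
  (W : X → Type u) [∀ x, AddCommGroup (W x)] [∀ x, Module ℝ (W x)]
  [TopologicalSpace (TotalSpace (EuclideanSpace ℝ (Fin m)) W)] [∀ x, TopologicalSpace (W x)]
  [FiberBundle (EuclideanSpace ℝ (Fin m)) W]

/-- A smooth vector bundle chart `(U, φ, Φ)` of `W → X`: a chart `φ` of the maximal smooth atlas
of `X` together with a fibrewise linear smooth trivialization of `W`. -/
structure VBChart where
  chart : OpenPartialHomeomorph X (EuclideanQuadrant n)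
  chart_mem : chart ∈ IsManifold.maximalAtlas (quadrant n) ∞ X
  triv : Trivialization (EuclideanSpace ℝ (Fin m))
    (TotalSpace.proj : TotalSpace (EuclideanSpace ℝ (Fin m)) W → X)
  isLinear : triv.IsLinear ℝ
  contMDiffOn_triv :
    ContMDiffOn ((quadrant n).prod 𝓘(ℝ, EuclideanSpace ℝ (Fin m)))
      ((quadrant n).prod 𝓘(ℝ, EuclideanSpace ℝ (Fin m))) ∞ triv triv.source
  contMDiffOn_triv_symm :
    ContMDiffOn ((quadrant n).prod 𝓘(ℝ, EuclideanSpace ℝ (Fin m)))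
      ((quadrant n).prod 𝓘(ℝ, EuclideanSpace ℝ (Fin m))) ∞ triv.toOpenPartialHomeomorph.symm
      triv.target

namespace VBChart

variable {n m} {W}

/-- The domain `U ⊆ X` of the vector bundle chart. -/
def dom (a : VBChart n m W) : Set X := a.chart.source ∩ a.triv.baseSet

/-- The coordinate map `φ : X → ℝⁿ` (meaningful on `U`). -/
def ext (a : VBChart n m W) : X → EuclideanSpace ℝ (Fin n) := a.chart.extend (quadrant n)

/-- The inverse coordinate map `φ⁻¹` (meaningful on `φ(U)`). -/
def inv (a : VBChart n m W) : EuclideanSpace ℝ (Fin n) → X := (a.chart.extend (quadrant n)).symm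

/-- The set `φ(U ∩ R) ⊆ ℝⁿ`. -/
def img (a : VBChart n m W) (R : Set X) : Set (EuclideanSpace ℝ (Fin n)) :=
  a.ext '' (a.dom ∩ R)

theorem inv_ext (a : VBChart n m W) {x : X} (hx : x ∈ a.dom) : a.inv (a.ext x) = x :=
  a.chart.extend_left_inv hx.1

theorem isOpen_dom (a : VBChart n m W) : IsOpen a.dom :=
  a.chart.open_source.inter a.triv.open_baseSet

variable (n m W) in
/-- A vector bundle chart around a given point. -/
def atPoint [IsManifold (quadrant n) ∞ X] [VectorBundle ℝ (EuclideanSpace ℝ (Fin m)) W]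
    [ContMDiffVectorBundle ∞ (EuclideanSpace ℝ (Fin m)) W (quadrant n)] (x : X) :
    VBChart n m W where
  chart := chartAt (EuclideanQuadrant n) x
  chart_mem := IsManifold.chart_mem_maximalAtlas x
  triv := trivializationAt (EuclideanSpace ℝ (Fin m)) W x
  isLinear := inferInstance
  contMDiffOn_triv := Trivialization.contMDiffOn _
  contMDiffOn_triv_symm := Trivialization.contMDiffOn_symm _

theorem mem_dom_atPoint [IsManifold (quadrant n) ∞ X]
    [VectorBundle ℝ (EuclideanSpace ℝ (Fin m)) W]
    [ContMDiffVectorBundle ∞ (EuclideanSpace ℝ (Fin m)) W (quadrant n)] (x : X) :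
    x ∈ (atPoint n m W x).dom :=
  ⟨mem_chart_source _ x, FiberBundle.mem_baseSet_trivializationAt' x⟩

/-- The chart image of a body has unique derivatives. -/
theorem uniqueDiffOn_img (a : VBChart n m W) (R : Body n X) : 
    UniqueDiffOn ℝ (a.img R.carrier) := by
  rintro _ ⟨x, ⟨hxd, hxR⟩, rfl⟩
  obtain ⟨φ, hφ, hxφ, ψ, hψ, hψs, hxψ, hiff⟩ := R.locally_quadrant x hxR
  have hI : ∀ z, φ.extend (quadrant n) z ∈ range (quadrant n) := fun z => ⟨φ z, rfl⟩
  have hIa : ∀ z, a.ext z ∈ range (quadrant n) := fun z => ⟨a.chart z, rfl⟩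
  -- a neighbourhood of `x` adapted to both charts
  obtain ⟨U, hUo, hxU, hUsub⟩ : ∃ U : Set X, IsOpen U ∧ x ∈ U ∧
      ∀ z ∈ U, z ∈ a.dom ∧ z ∈ φ.source ∧ φ.extend (quadrant n) z ∈ ψ.source := by
    have h1 : ∀ᶠ z in 𝓝 x, φ.extend (quadrant n) z ∈ ψ.source :=
      (φ.continuousAt_extend hxφ).eventually (ψ.open_source.mem_nhds hxψ)
    have h2 : ∀ᶠ z in 𝓝 x, z ∈ a.dom := a.isOpen_dom.mem_nhds hxd
    have h3 : ∀ᶠ z in 𝓝 x, z ∈ φ.source := φ.open_source.mem_nhds hxφ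
    obtain ⟨U, hU, hUo, hxU⟩ := eventually_nhds_iff.1 (h2.and (h3.and h1))
    exact ⟨U, hUo, hxU, hU⟩
  set g : EuclideanSpace ℝ (Fin n) → EuclideanSpace ℝ (Fin n) :=
    fun z => a.ext ((φ.extend (quadrant n)).symm (ψ.symm z)) with hg
  set h : EuclideanSpace ℝ (Fin n) → EuclideanSpace ℝ (Fin n) :=
    fun y => ψ (φ.extend (quadrant n) (a.inv y)) with hh
  set Q : Set (EuclideanSpace ℝ (Fin n)) := {z | ∀ i, 0 ≤ z i} with hQ
  set z0 := ψ (φ.extend (quadrant n) x) with hz0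
  set Q' : Set (EuclideanSpace ℝ (Fin n)) :=
    (fun z => ψ (φ.extend (quadrant n) z)) '' (U ∩ R.carrier) with hQ'
  have hgz : ∀ z ∈ U, g (ψ (φ.extend (quadrant n) z)) = a.ext z := by
    intro z hz
    simp only [hg]
    rw [ψ.left_inv (hUsub z hz).2.2, φ.extend_left_inv (hUsub z hz).2.1]
  have hhz : ∀ z ∈ U, h (a.ext z) = ψ (φ.extend (quadrant n) z) := by
    intro z hz
    simp only [hh]
    rw [a.inv_ext (hUsub z hz).1]
  have hz0Q' : z0 ∈ Q' := ⟨x, ⟨hxU, hxR⟩, rfl⟩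
  have hQ'Q : Q' ⊆ Q := by
    rintro _ ⟨z, ⟨hzU, hzR⟩, rfl⟩
    exact (hiff _ (hUsub z hzU).2.2).1 ⟨z, ⟨(hUsub z hzU).2.1, hzR⟩, rfl⟩
  have hz0t : z0 ∈ ψ.target := ψ.map_source hxψ
  have hsymz0 : ψ.symm z0 = φ.extend (quadrant n) x := ψ.left_inv hxψ
  have hQ'n : Q' ∈ 𝓝[Q] z0 := by
    have h1 : ∀ᶠ z in 𝓝 z0, z ∈ ψ.target := ψ.open_target.mem_nhds hz0t
    have h2 : ∀ᶠ z in 𝓝 z0, (φ.extend (quadrant n)).symm (ψ.symm z) ∈ U := by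
      have hc : ContinuousAt (fun z => (φ.extend (quadrant n)).symm (ψ.symm z)) z0 := by
        refine ContinuousAt.comp (g := (φ.extend (quadrant n)).symm) ?_
          (ψ.continuousAt_symm hz0t)
        rw [hsymz0]
        exact φ.continuousAt_extend_symm hxφ
      refine hc.eventually (hUo.mem_nhds ?_)
      simp only []
      rw [hsymz0, φ.extend_left_inv hxφ]
      exact hxU
    filter_upwards [mem_nhdsWithin_of_mem_nhds h1, mem_nhdsWithin_of_mem_nhds h2,
      self_mem_nhdsWithin] with z hz1 hz2 hz3
    have hz4 : ψ.symm z ∈ ψ.source := ψ.map_target hz1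
    obtain ⟨w, ⟨hwφ, hwR⟩, hw⟩ := (hiff _ hz4).2 (by rw [ψ.right_inv hz1]; exact hz3)
    have hz2' := hz2
    rw [← hw, φ.extend_left_inv hwφ] at hz2'
    exact ⟨w, ⟨hz2', hwR⟩, by simp only [hw]; exact ψ.right_inv hz1⟩
  have hQu : UniqueDiffOn ℝ Q := by
    refine uniqueDiffOn_convex EuclideanQuadrant.convex ?_
    rw [interior_euclideanQuadrant]
    exact ⟨WithLp.toLp 2 fun _ => 1, by simp⟩
  have hQ'u : UniqueDiffWithinAt ℝ Q' z0 := by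
    refine (uniqueDiffWithinAt_congr ?_).1 (hQu z0 (hQ'Q hz0Q'))
    exact le_antisymm (nhdsWithin_le_of_mem hQ'n) (nhdsWithin_mono _ hQ'Q)
  have hgS : g '' Q' ⊆ a.img R.carrier := by
    rintro _ ⟨_, ⟨z, ⟨hzU, hzR⟩, rfl⟩, rfl⟩
    exact ⟨z, ⟨(hUsub z hzU).1, hzR⟩, (hgz z hzU).symm⟩
  -- differentiability of the two mutually inverse maps
  have hgd : DifferentiableWithinAt ℝ g Q' z0 := by
    have h1 : DifferentiableWithinAt ℝ ((quadrant n).extendCoordChange φ a.chart)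
        (range (quadrant n)) (φ.extend (quadrant n) x) :=
      ((quadrant n).contDiffWithinAt_extendCoordChange' hφ a.chart_mem hxφ
        hxd.1).differentiableWithinAt (by simp)
    have h2 : DifferentiableWithinAt ℝ ψ.symm Q' z0 :=
      ((hψs z0 hz0t).contDiffAt (ψ.open_target.mem_nhds hz0t)).differentiableAt
        (by simp) |>.differentiableWithinAt
    rw [← hsymz0] at h1
    refine h1.comp z0 h2 ?_
    rintro _ ⟨z, ⟨hzU, hzR⟩, rfl⟩
    change ψ.symm (ψ _) ∈ _
    rw [ψ.left_inv (hUsub z hzU).2.2]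
    exact hI z
  have hgz0 : g z0 = a.ext x := hgz x hxU
  have hhd : DifferentiableWithinAt ℝ h (g '' Q') (g z0) := by
    rw [hgz0]
    have h1 : DifferentiableWithinAt ℝ ((quadrant n).extendCoordChange a.chart φ)
        (range (quadrant n)) (a.ext x) :=
      ((quadrant n).contDiffWithinAt_extendCoordChange' a.chart_mem hφ hxd.1
        hxφ).differentiableWithinAt (by simp)
    have h2 : DifferentiableAt ℝ ψ (((quadrant n).extendCoordChange a.chart φ) (a.ext x)) := by
      have h3 : ((quadrant n).extendCoordChange a.chart φ) (a.ext x)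
          = φ.extend (quadrant n) x := by
        change φ.extend (quadrant n) (a.inv (a.ext x)) = _
        rw [a.inv_ext hxd]
      rw [h3]
      exact ((hψ _ hxψ).contDiffAt (ψ.open_source.mem_nhds hxψ)).differentiableAt (by simp)
    refine h2.comp_differentiableWithinAt (a.ext x) (h1.mono ?_)
    rintro _ ⟨_, ⟨z, ⟨hzU, hzR⟩, rfl⟩, rfl⟩
    rw [hgz z hzU]
    exact hIa z
  have hcomp : HasFDerivWithinAt (h ∘ g)
      ((fderivWithin ℝ h (g '' Q') (g z0)).comp (fderivWithin ℝ g Q' z0)) Q' z0 :=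
    hhd.hasFDerivWithinAt.comp z0 hgd.hasFDerivWithinAt (mapsTo_image g Q')
  have hid : HasFDerivWithinAt (h ∘ g) (ContinuousLinearMap.id ℝ _) Q' z0 := by
    refine (hasFDerivWithinAt_id z0 Q').congr ?_ ?_
    · rintro _ ⟨z, ⟨hzU, hzR⟩, rfl⟩
      simp only [Function.comp, id, hgz z hzU, hhz z hzU]
    · simp only [Function.comp, id, hgz0]
      exact hhz x hxU
  have heq := hQ'u.eq hcomp hid
  have hinj : Function.Injective (fderivWithin ℝ g Q' z0) := by
    intro v w hvw
    have h1 := congrArg (fun L => L v) heq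
    have h2 := congrArg (fun L => L w) heq
    simp only [ContinuousLinearMap.comp_apply, ContinuousLinearMap.id_apply] at h1 h2
    rw [← h1, ← h2, hvw]
  have hsurj : Function.Surjective (fderivWithin ℝ g Q' z0) :=
    (LinearMap.injective_iff_surjective
      (f := (fderivWithin ℝ g Q' z0 : EuclideanSpace ℝ (Fin n) →ₗ[ℝ] _))).1 hinj
  have := hgd.hasFDerivWithinAt.uniqueDiffWithinAt hQ'u hsurj.denseRange
  rw [hgz0] at this
  exact this.mono hgS

end VBChart

end Charts

section Derivatives

variable {n k : ℕ} {S : Set (EuclideanSpace ℝ (Fin n))} {y : EuclideanSpace ℝ (Fin n)}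

/-- The partial derivative `∂_I f = ∂ᵏf / ∂y^{i₁} ⋯ ∂y^{iₖ}`, `I = i₁ ⋯ iₖ`, of a function `f`
defined on `S ⊆ ℝⁿ`. -/
def partialWithin (S : Set (EuclideanSpace ℝ (Fin n))) (I : Fin k → Fin n)
    (f : EuclideanSpace ℝ (Fin n) → ℝ) (y : EuclideanSpace ℝ (Fin n)) : ℝ :=
  iteratedFDerivWithin ℝ k f S y fun l => EuclideanSpace.single (I l) 1

theorem partialWithin_add {I : Fin k → Fin n} {f g : EuclideanSpace ℝ (Fin n) → ℝ}
    (hS : UniqueDiffOn ℝ S) (hy : y ∈ S) (hf : ContDiffWithinAt ℝ k f S y)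
    (hg : ContDiffWithinAt ℝ k g S y) :
    partialWithin S I (f + g) y = partialWithin S I f y + partialWithin S I g y := by
  simp only [partialWithin, iteratedFDerivWithin_add_apply hf hg hS hy]
  rfl

theorem partialWithin_smul {I : Fin k → Fin n} {f : EuclideanSpace ℝ (Fin n) → ℝ} (c : ℝ)
    (hS : UniqueDiffOn ℝ S) (hy : y ∈ S) (hf : ContDiffWithinAt ℝ k f S y) :
    partialWithin S I (c • f) y = c • partialWithin S I f y := by
  simp only [partialWithin, iteratedFDerivWithin_const_smul_apply hf hS hy]
  rfl

theorem contDiffOn_partialWithin {I : Fin k → Fin n} {f : EuclideanSpace ℝ (Fin n) → ℝ} {j l : ℕ}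
    (hS : UniqueDiffOn ℝ S) (hf : ContDiffOn ℝ l f S) (h : j + k ≤ l) :
    ContDiffOn ℝ j (partialWithin S I f) S := fun y hy =>
  ((hf y hy).iteratedFDerivWithin_right (m := j) hS (by exact_mod_cast h) hy).continuousLinearMap_comp
    (ContinuousMultilinearMap.apply ℝ (fun _ : Fin k => EuclideanSpace ℝ (Fin n)) ℝ
      fun l => EuclideanSpace.single (I l) 1)

end Derivatives

section Bundles

variable (n m : ℕ) {X : Type u} [TopologicalSpace X] [ChartedSpace (EuclideanQuadrant n) X]
  (W : X → Type u) [∀ x, AddCommGroup (W x)] [∀ x, Module ℝ (W x)]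
  [TopologicalSpace (TotalSpace (EuclideanSpace ℝ (Fin m)) W)] [∀ x, TopologicalSpace (W x)]
  [FiberBundle (EuclideanSpace ℝ (Fin m)) W]

/-- A family of vector spaces over `X` with linear fibre coordinates, indexed by `ι`, over the
domain of each vector bundle chart of `W`. It serves as a common frame for `W` itself, its jet
bundles and its iterated jet bundles. -/
structure CoordBundle (ι : Type) where
  Fib : X → Type u
  [addCommGroup : ∀ x, AddCommGroup (Fib x)]
  [module : ∀ x, Module ℝ (Fib x)]
  coord : VBChart n m W → ∀ x, Fib x →ₗ[ℝ] (ι → ℝ)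

attribute [instance] CoordBundle.addCommGroup CoordBundle.module

/-- The bundle `W`, with the fibre coordinates `v ↦ (v^α)`, `α = 1, …, m`, of its charts. -/
def baseBundle : CoordBundle n m W (Fin m) where
  Fib := W
  coord a x :=
    haveI := a.isLinear
    (EuclideanSpace.equiv (Fin m) ℝ).toLinearMap ∘ₗ a.triv.linearMapAt ℝ x

variable {n m W} {ι : Type}

namespace CoordBundle

/-- The local representative `φ(U) → ℝ^ι` of a section. -/
def rep (E : CoordBundle n m W ι) (a : VBChart n m W) (s : ∀ x, E.Fib x)
    (y : EuclideanSpace ℝ (Fin n)) (c : ι) : ℝ :=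
  E.coord a (a.inv y) (s (a.inv y)) c

/-- The space `C^k(E|_R)` of sections over the body `R` all of whose local representatives are of
class `C^k`. A section over `R` is encoded by its extension by zero to `X`. -/
def Sec (E : CoordBundle n m W ι) (R : Body n X) (k : ℕ) : Submodule ℝ (∀ x, E.Fib x) where
  carrier := {s | (∀ x ∉ R.carrier, s x = 0) ∧
    ∀ (a : VBChart n m W) (c : ι), ContDiffOn ℝ k (fun y => E.rep a s y c) (a.img R.carrier)}
  zero_mem' := by
    refine ⟨fun _ _ => rfl, fun a c => ?_⟩
    have : (fun y => E.rep a 0 y c) = fun _ => 0 := by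
      funext y; simp [rep]
    rw [this]
    exact contDiffOn_const
  add_mem' := by
    rintro s t ⟨hs, hs'⟩ ⟨ht, ht'⟩
    refine ⟨fun x hx => by simp [hs x hx, ht x hx], fun a c => ?_⟩
    have : (fun y => E.rep a (s + t) y c) = fun y => E.rep a s y c + E.rep a t y c := by
      funext y; simp [rep]
    rw [this]
    exact (hs' a c).add (ht' a c)
  smul_mem' := by
    rintro z s ⟨hs, hs'⟩
    refine ⟨fun x hx => by simp [hs x hx], fun a c => ?_⟩
    have : (fun y => E.rep a (z • s) y c) = fun y => z * E.rep a s y c := by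
      funext y; simp [rep]
    rw [this]
    exact contDiffOn_const.mul (hs' a c)

theorem Sec.mono (E : CoordBundle n m W ι) (R : Body n X) {k l : ℕ} (h : k ≤ l) :
    E.Sec R l ≤ E.Sec R k := fun _ hs =>
  ⟨hs.1, fun a c => (hs.2 a c).of_le (by exact_mod_cast h)⟩

end CoordBundle

end Bundles

section Jets

/-- Non-decreasing multi-indices `I = i₁ ⋯ iₖ`, `i₁ ≤ ⋯ ≤ iₖ`, with `0 ≤ k ≤ r`. -/
abbrev JetIdx (n r : ℕ) : Type := Σ k : Fin (r + 1), {I : Fin k → Fin n // Monotone I}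

instance (n r : ℕ) : Fintype (JetIdx n r) :=
  haveI (k : Fin (r + 1)) : Fintype {I : Fin k → Fin n // Monotone I} := Fintype.ofFinite _
  inferInstance

variable {n m : ℕ} {X : Type u} [TopologicalSpace X] [ChartedSpace (EuclideanQuadrant n) X]
  {W : X → Type u} [∀ x, AddCommGroup (W x)] [∀ x, Module ℝ (W x)]
  [TopologicalSpace (TotalSpace (EuclideanSpace ℝ (Fin m)) W)] [∀ x, TopologicalSpace (W x)]
  [FiberBundle (EuclideanSpace ℝ (Fin m)) W] {ι : Type}

namespace CoordBundle

/-- The local coordinates `s ↦ (∂_I s_a^c (φ_a(x)))_{I, c}`, `|I| ≤ r`, of the `r`-jet at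
`x ∈ U_a ∩ R` of `C^r`-sections over `R`. -/
def jetCoord (E : CoordBundle n m W ι) (R : Body n X) (r : ℕ) (a : VBChart n m W) (x : X)
    (hx : x ∈ a.dom ∩ R.carrier) : E.Sec R r →ₗ[ℝ] (JetIdx n r × ι → ℝ) where
  toFun s p := partialWithin (a.img R.carrier) p.1.2.1 (fun y => E.rep a s.1 y p.2) (a.ext x)
  map_add' s t := by
    funext p
    have hk : ((p.1.1 : ℕ) : ℕ∞ω) ≤ (r : ℕ∞ω) := by exact_mod_cast Nat.lt_succ_iff.1 p.1.1.2
    have hy : a.ext x ∈ a.img R.carrier := ⟨x, hx, rfl⟩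
    have : (fun y => E.rep a (s + t).1 y p.2)
        = (fun y => E.rep a s.1 y p.2) + fun y => E.rep a t.1 y p.2 := by
      funext y; simp [rep]
    rw [this, partialWithin_add (a.uniqueDiffOn_img R) hy ((s.2.2 a p.2 _ hy).of_le hk)
      ((t.2.2 a p.2 _ hy).of_le hk)]
    rfl
  map_smul' z s := by
    funext p
    have hk : ((p.1.1 : ℕ) : ℕ∞ω) ≤ (r : ℕ∞ω) := by exact_mod_cast Nat.lt_succ_iff.1 p.1.1.2
    have hy : a.ext x ∈ a.img R.carrier := ⟨x, hx, rfl⟩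
    have : (fun y => E.rep a (z • s).1 y p.2) = z • fun y => E.rep a s.1 y p.2 := by
      funext y; simp [rep]
    rw [this, partialWithin_smul z (a.uniqueDiffOn_img R) hy ((s.2.2 a p.2 _ hy).of_le hk)]
    rfl

/-- The `C^r`-sections over `R` whose `r`-jet at `x` vanishes. -/
def vanishing (E : CoordBundle n m W ι) (R : Body n X) (r : ℕ) (x : X) :
    Submodule ℝ (E.Sec R r) :=
  ⨅ (a : VBChart n m W) (hx : x ∈ a.dom ∩ R.carrier), LinearMap.ker (E.jetCoord R r a x hx)

theorem vanishing_le (E : CoordBundle n m W ι) (R : Body n X) (r : ℕ) (a : VBChart n m W) (x : X)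
    (hx : x ∈ a.dom ∩ R.carrier) :
    E.vanishing R r x ≤ LinearMap.ker (E.jetCoord R r a x hx) :=
  (iInf_le _ a).trans (iInf_le _ hx)

open Classical in
/-- The `r`-jet bundle `J^r(E|_R)` over the body `R`: the fibre at `x ∈ R` consists of the
equivalence classes of `C^r`-sections having the same partial derivatives of orders `≤ r` at `x`,
and the fibre coordinates are these partial derivatives. (By means of cut-off functions every jet
of a local section is the jet of a section defined on the compact set `R`.) -/
def jetBundle (E : CoordBundle n m W ι) (R : Body n X) (r : ℕ) :
    CoordBundle n m W (JetIdx n r × ι) where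
  Fib x := E.Sec R r ⧸ E.vanishing R r x
  coord a x :=
    if hx : x ∈ a.dom ∩ R.carrier then
      (E.vanishing R r x).liftQ (E.jetCoord R r a x hx) (E.vanishing_le R r a x hx)
    else 0

/-- The jet extension mapping `j^r : C^l(E|_R) → C^k(J^r(E|_R))`, `k + r ≤ l`. -/
def jetExt (E : CoordBundle n m W ι) (R : Body n X) (r : ℕ) {k l : ℕ} (h : k + r ≤ l)
    (s : E.Sec R l) : (E.jetBundle R r).Sec R k :=
  ⟨fun x => Submodule.Quotient.mk ⟨s.1, Sec.mono E R (le_of_add_le_right h) s.2⟩, by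
    refine ⟨fun x hx => ?_, fun a p => ?_⟩
    · refine (Submodule.Quotient.mk_eq_zero _).2 ?_
      simp only [vanishing, Submodule.mem_iInf]
      exact fun a hx' => absurd hx'.2 hx
    · have hp : k + (p.1.1 : ℕ) ≤ l :=
        (Nat.add_le_add_left (Nat.lt_succ_iff.1 p.1.1.2) k).trans h
      refine (contDiffOn_partialWithin (I := p.1.2.1) (a.uniqueDiffOn_img R) (s.2.2 a p.2)
        hp).congr ?_
      rintro _ ⟨x, hx, rfl⟩
      simp only [rep, jetBundle]
      rw [a.inv_ext hx.1, dif_pos hx]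
      rfl⟩

end CoordBundle

/-- The coordinates of the iterated jets: at each generation the coordinates of the previous one
and their first derivatives. -/
def IterIdx (n m : ℕ) : ℕ → Type
  | 0 => Fin m
  | r + 1 => JetIdx n 1 × IterIdx n m r

instance IterIdx.fintype (n m : ℕ) : ∀ r, Fintype (IterIdx n m r)
  | 0 => inferInstanceAs (Fintype (Fin m))
  | r + 1 =>
    haveI := IterIdx.fintype n m r
    inferInstanceAs (Fintype (JetIdx n 1 × IterIdx n m r))

variable (m W)

/-- The `r`-jet bundle `J^r(W|_R)`. -/
def jetB (R : Body n X) (r : ℕ) : CoordBundle n m W (JetIdx n r × Fin m) :=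
  (baseBundle n m W).jetBundle R r

/-- The iterated (non-holonomic) jet bundle `Ĵ^r(W|_R)`, where `Ĵ⁰W = W` and
`Ĵ^{r+1}W = J¹(Ĵ^rW)`. -/
def iterJetB (R : Body n X) : ∀ r : ℕ, CoordBundle n m W (IterIdx n m r)
  | 0 => baseBundle n m W
  | r + 1 => (iterJetB R r).jetBundle R 1

/-- The space `C^r(W|_R)` of `C^r`-sections of `W` over the body `R`. -/
abbrev CrSec (R : Body n X) (r : ℕ) : Submodule ℝ (∀ x, W x) := (baseBundle n m W).Sec R r

variable {m W}

/-- The sections of class `C^k` over `R` are those that are `C^k` on `R` as maps from `X` to the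
total space of `W`. -/
theorem mem_crSec_iff [IsManifold (quadrant n) ∞ X] [VectorBundle ℝ (EuclideanSpace ℝ (Fin m)) W]
    [ContMDiffVectorBundle ∞ (EuclideanSpace ℝ (Fin m)) W (quadrant n)]
    (R : Body n X) (k : ℕ) (s : ∀ x, W x) :
    s ∈ CrSec m W R k ↔ (∀ x ∉ R.carrier, s x = 0) ∧
      ContMDiffOn (quadrant n) ((quadrant n).prod 𝓘(ℝ, EuclideanSpace ℝ (Fin m))) k
        (fun x => TotalSpace.mk' (EuclideanSpace ℝ (Fin m)) x (s x)) R.carrier := by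
  have hle : ((k : ℕ) : ℕ∞ω) ≤ ∞ := by exact_mod_cast le_top
  have key : ∀ a : VBChart n m W,
      ContMDiffOn (quadrant n) 𝓘(ℝ, EuclideanSpace ℝ (Fin m)) k
        (fun x => (a.triv ⟨x, s x⟩).2) (a.dom ∩ R.carrier) ↔
      ∀ c, ContDiffOn ℝ k (fun y => (baseBundle n m W).rep a s y c) (a.img R.carrier) := by
    intro a
    rw [contMDiffOn_iff_of_mem_maximalAtlas'
      (IsManifold.maximalAtlas_subset_of_le hle a.chart_mem)
      (IsManifold.chart_mem_maximalAtlas (0 : EuclideanSpace ℝ (Fin m)))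
      (fun x hx => hx.1.1) (fun x _ => mem_univ _)]
    change ContDiffOn ℝ k (fun y => (a.triv ⟨a.inv y, s (a.inv y)⟩).2) (a.img R.carrier) ↔ _
    rw [contDiffOn_euclidean]
    refine forall_congr' fun c => contDiffOn_congr ?_
    rintro _ ⟨x, hx, rfl⟩
    have := a.isLinear
    change _ = (a.triv.linearMapAt ℝ (a.inv (a.ext x)) (s (a.inv (a.ext x)))) c
    have hb : a.inv (a.ext x) ∈ a.triv.baseSet := by rw [a.inv_ext hx.1]; exact hx.1.2
    rw [a.triv.coe_linearMapAt_of_mem hb]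
  refine and_congr_right fun _ => ⟨fun h x hx => ?_, fun h a => (key a).1 ?_⟩
  · have hxd := VBChart.mem_dom_atPoint (n := n) (m := m) (W := W) x
    have h1 := (key (VBChart.atPoint n m W x)).2 (h _) x ⟨hxd, hx⟩
    refine (Trivialization.contMDiffWithinAt_section
      (e := trivializationAt (EuclideanSpace ℝ (Fin m)) W x) _ hxd.2).2
      (h1.mono_of_mem_nhdsWithin ?_)
    exact Filter.inter_mem (mem_nhdsWithin_of_mem_nhds ((VBChart.isOpen_dom _).mem_nhds hxd))
      self_mem_nhdsWithin
  · have h1 := (a.contMDiffOn_triv.of_le hle).comp (h.mono (inter_subset_right (s := a.dom)))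
      (fun x hx => a.triv.mem_source.2 hx.1.2)
    exact contMDiff_snd.comp_contMDiffOn h1

/-- The jet extension `j^r : C^r(W|_R) → C⁰(J^r(W|_R))`. -/
def jet (R : Body n X) (r : ℕ) (w : CrSec m W R r) : (jetB m W R r).Sec R 0 :=
  (baseBundle n m W).jetExt R r (by simp) w

/-- The iterated jet extension `ĵ^r : C^l(W|_R) → C^k(Ĵ^r(W|_R))`, `k + r ≤ l`, where
`ĵ^{r+1} = j¹ ∘ ĵ^r`. -/
def iterJetAux (R : Body n X) : ∀ (r : ℕ) {k l : ℕ} (_ : k + r ≤ l) (_ : CrSec m W R l),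
    (iterJetB m W R r).Sec R k
  | 0, _, _, h, w => ⟨w.1, CoordBundle.Sec.mono (baseBundle n m W) R h w.2⟩
  | r + 1, k, _, h, w =>
    (iterJetB m W R r).jetExt R 1 (le_refl (k + 1))
      (iterJetAux R r (k := k + 1) (by omega) w)

/-- The iterated jet extension `ĵ^r : C^r(W|_R) → C⁰(Ĵ^r(W|_R))`. -/
def iterJet (R : Body n X) (r : ℕ) (w : CrSec m W R r) : (iterJetB m W R r).Sec R 0 :=
  iterJetAux R r (by simp) w

end Jets

section Forces

variable (m : ℕ) {n : ℕ} {X : Type u} [TopologicalSpace X] [ChartedSpace (EuclideanQuadrant n) X]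
  (W : X → Type u) [∀ x, AddCommGroup (W x)] [∀ x, Module ℝ (W x)]
  [TopologicalSpace (TotalSpace (EuclideanSpace ℝ (Fin m)) W)] [∀ x, TopologicalSpace (W x)]
  [FiberBundle (EuclideanSpace ℝ (Fin m)) W]

/-- A precompact atlas on the body `R`: finitely many compact sets `K_i ⊆ R`, each inside the
domain of a vector bundle chart, whose interiors relative to `R` cover `R`. -/
structure PrecompactAtlas (R : Body n X) where
  A : ℕ
  chart : Fin A → VBChart n m W
  K : Fin A → Set X
  isCompact : ∀ i, IsCompact (K i)
  subset : ∀ i, K i ⊆ (chart i).dom ∩ R.carrier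
  cover : ∀ x ∈ R.carrier, ∃ i, K i ∈ 𝓝[R.carrier] x

variable {m W}

/-- The `C^r`-norm of a section `w` over `R` with respect to a precompact atlas: the supremum of
`|∂_I w_i^α(φ_i(x))|` over all `i`, `α`, `|I| ≤ r` and `x ∈ K_i`. -/
def PrecompactAtlas.crNorm {R : Body n X} (𝔎 : PrecompactAtlas m W R) (r : ℕ)
    (w : CrSec m W R r) : ℝ :=
  sSup {t : ℝ | ∃ (i : Fin 𝔎.A) (α : Fin m) (k : ℕ) (I : Fin k → Fin n) (x : X),
    k ≤ r ∧ x ∈ 𝔎.K i ∧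
      t = |partialWithin ((𝔎.chart i).img R.carrier) I
        (fun y => (baseBundle n m W).rep (𝔎.chart i) w.1 y α) ((𝔎.chart i).ext x)|}

variable (m W)

/-- A force on the body `R`: an element of `C^r(W|_R)^*`, i.e. a linear functional which is
continuous for the `C^r`-norm of a precompact atlas (all of these norms are equivalent). -/
structure Force (R : Body n X) (r : ℕ) where
  toLin : CrSec m W R r →ₗ[ℝ] ℝ
  bounded : ∃ (𝔎 : PrecompactAtlas m W R) (C : ℝ), ∀ w, |toLin w| ≤ C * 𝔎.crNorm r w

end Forces

section Measures

/-- A real (signed) Radon measure on `Y`, given by its Jordan decomposition into two mutually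
singular positive Radon measures. Its total variation need not be finite. -/
structure RealRadonMeasure (Y : Type*) [TopologicalSpace Y] [MeasurableSpace Y] where
  pos : Measure Y
  neg : Measure Y
  regular_pos : pos.Regular
  regular_neg : neg.Regular
  mutuallySingular : pos ⟂ₘ neg

namespace RealRadonMeasure

variable {Y : Type*} [TopologicalSpace Y] [MeasurableSpace Y]

/-- Integrability on `A` with respect to a real Radon measure. -/
def IntegrableOn (μ : RealRadonMeasure Y) (A : Set Y) (f : Y → ℝ) : Prop :=
  MeasureTheory.IntegrableOn f A μ.pos ∧ MeasureTheory.IntegrableOn f A μ.neg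

/-- The integral `∫_A f dμ`. -/
def integralOn (μ : RealRadonMeasure Y) (A : Set Y) (f : Y → ℝ) : ℝ :=
  ∫ y in A, f y ∂μ.pos - ∫ y in A, f y ∂μ.neg

end RealRadonMeasure

variable {n m : ℕ} {X : Type u} [TopologicalSpace X] [ChartedSpace (EuclideanQuadrant n) X]
  {W : X → Type u} [∀ x, AddCommGroup (W x)] [∀ x, Module ℝ (W x)]
  [TopologicalSpace (TotalSpace (EuclideanSpace ℝ (Fin m)) W)] [∀ x, TopologicalSpace (W x)]
  [FiberBundle (EuclideanSpace ℝ (Fin m)) W]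

/-- A vector valued Radon measure on `X` acting on the sections of `E`: for each vector bundle
chart `(U, φ, Φ)` an `ℝ^ι`-valued Radon measure on `φ(U)`, such that two of these local
representatives agree on every continuous section of `E` supported in both chart domains. -/
structure BundleMeasure [CompactSpace X] [IsManifold (quadrant n) ∞ X] {ι : Type} [Fintype ι]
    (E : CoordBundle n m W ι) where
  meas : ∀ a : VBChart n m W, ι → RealRadonMeasure (a.img univ)
  compat : ∀ (a b : VBChart n m W), ∀ χ ∈ E.Sec (Body.whole n X) 0,
    closure {x | χ x ≠ 0} ⊆ a.dom ∩ b.dom →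
      ∑ c, (meas a c).integralOn univ (fun y => E.rep a χ y c) =
        ∑ c, (meas b c).integralOn univ (fun y => E.rep b χ y c)

variable (n m W) in
/-- A finite vector bundle atlas of `W → X` with a subordinate partition of unity. -/
structure PartitionedAtlas where
  A : ℕ
  chart : Fin A → VBChart n m W
  u : PartitionOfUnity (Fin A) X
  isSubordinate : u.IsSubordinate fun i => (chart i).dom

theorem PartitionedAtlas.nonempty [CompactSpace X] [T2Space X] [IsManifold (quadrant n) ∞ X]
    [VectorBundle ℝ (EuclideanSpace ℝ (Fin m)) W]
    [ContMDiffVectorBundle ∞ (EuclideanSpace ℝ (Fin m)) W (quadrant n)] :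
    Nonempty (PartitionedAtlas n m W) := by
  obtain ⟨t, ht⟩ := isCompact_univ.elim_finite_subcover
    (fun x : X => (VBChart.atPoint n m W x).dom) (fun x => (VBChart.atPoint n m W x).isOpen_dom)
    (fun x _ => mem_iUnion.2 ⟨x, VBChart.mem_dom_atPoint x⟩)
  let e := t.equivFin
  obtain ⟨u, hu⟩ := PartitionOfUnity.exists_isSubordinate (isClosed_univ (X := X))
    (fun i : Fin t.card => (VBChart.atPoint n m W (e.symm i).1).dom)
    (fun i => (VBChart.atPoint n m W _).isOpen_dom) (by
      intro x hx
      obtain ⟨z, hz, hxz⟩ := mem_iUnion₂.1 (ht hx)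
      exact mem_iUnion.2 ⟨e ⟨z, hz⟩, by simpa using hxz⟩)
  exact ⟨⟨t.card, _, u, hu⟩⟩

variable [CompactSpace X] [IsManifold (quadrant n) ∞ X] {ι : Type} [Fintype ι]

/-- `∫_R χ · dς = v`. Here `ς` is a vector valued Radon measure on `X`, and `χ` is a section over
the body `R` whose local representatives `χ_a` have the components of sections of `E`. For every
vector bundle atlas and every subordinate partition of unity `(u_a)`, all integrals exist and
`∑_a ∑_c ∫_{φ_a(U_a ∩ R)} u_a χ_a^c dς_{a,c} = v`. -/
def BundleMeasure.HasIntegral {E : CoordBundle n m W ι} (ς : BundleMeasure E) (R : Body n X)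
    {E' : CoordBundle n m W ι} (χ : E'.Sec R 0) (v : ℝ) : Prop :=
  ∀ 𝔓 : PartitionedAtlas n m W,
    (∀ i c, (ς.meas (𝔓.chart i) c).IntegrableOn {y | (𝔓.chart i).inv y ∈ R.carrier}
      (fun y => 𝔓.u i ((𝔓.chart i).inv y) * E'.rep (𝔓.chart i) χ.1 y c)) ∧
    ∑ i, ∑ c, (ς.meas (𝔓.chart i) c).integralOn {y | (𝔓.chart i).inv y ∈ R.carrier}
      (fun y => 𝔓.u i ((𝔓.chart i).inv y) * E'.rep (𝔓.chart i) χ.1 y c) = v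

variable (n m W)

/-- Vector valued hyper-stress measures on `X`: Radon measures acting on sections of `J^rW`. -/
abbrev HyperStressMeasure (r : ℕ) := BundleMeasure (jetB m W (Body.whole n X) r)

/-- Non-holonomic stress measures on `X`: Radon measures acting on sections of `Ĵ^rW`. -/
abbrev NonholonomicStressMeasure (r : ℕ) := BundleMeasure (iterJetB m W (Body.whole n X) r)

variable {n m W}

/-- `ς` represents the force `F` on `X`: `F(w) = ∫_X j^r w · dς` for all `w ∈ C^r(W)`. -/
def HyperStressMeasure.Represents {r : ℕ} (ς : HyperStressMeasure n m W r)
    (F : Force m W (Body.whole n X) r) : Prop :=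
  ∀ w, ς.HasIntegral (Body.whole n X) (jet (Body.whole n X) r w) (F.toLin w)

/-- `ς̂` represents the force `F` on `X`: `F(w) = ∫_X ĵ^r w · dς̂` for all `w ∈ C^r(W)`. -/
def NonholonomicStressMeasure.Represents {r : ℕ} (ς : NonholonomicStressMeasure n m W r)
    (F : Force m W (Body.whole n X) r) : Prop :=
  ∀ w, ς.HasIntegral (Body.whole n X) (iterJet (Body.whole n X) r w) (F.toLin w)

end Measures

end GlobalStress

end

/-!
By the Hahn–Banach and Riesz theorems, a force is a sum of integrals of partial derivatives of the
section against finite measures on the compact sets of a precompact atlas. In another chart each of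
these partial derivatives is a linear combination of the local components of the jet, with
continuous coefficients; these coefficients are the densities which turn the measures into a
compatible family over all charts. As the local components of the iterated jet are partial
derivatives too, the same measures serve both jet bundles, and integrals of corresponding jets agree
on every body. Conversely, gluing with a partition of unity makes the integral of a section
continuous for the supremum of its components, so every stress measure induces forces.

Representing measures are not unique because a jet satisfies the fundamental theorem of calculus:
the first derivative integrated along a coordinate segment cancels against Dirac masses at the end
points on every jet, but not on every section of the jet bundle.
-/

noncomputable section

namespace GlobalStress

section EuclideanCalculus

theorem image_mem_nhds_of_leftInvOn {E : Type*} [NormedAddCommGroup E] [NormedSpace ℝ E]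
    [FiniteDimensional ℝ E] {g h : E → E} {N T : Set E} {z : E} (hN : N ∈ 𝓝 z)
    (hg : ContDiffAt ℝ 1 g z) (hh : DifferentiableWithinAt ℝ h T (g z)) (hgT : MapsTo g N T)
    (hhg : LeftInvOn h g N) : g '' N ∈ 𝓝 (g z) := by
  have := FiniteDimensional.complete ℝ E
  have hcomp : (fderivWithin ℝ h T (g z)).comp (fderiv ℝ g z) = ContinuousLinearMap.id ℝ E :=
    (hh.hasFDerivWithinAt.comp_hasFDerivAt z (hg.differentiableAt one_ne_zero).hasFDerivAt
      (Filter.mem_of_superset hN hgT)).unique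
      ((hasFDerivAt_id z).congr_of_eventuallyEq (Filter.mem_of_superset hN hhg))
  have hinj : Function.Injective (fderiv ℝ g z) :=
    Function.LeftInverse.injective (g := fderivWithin ℝ h T (g z)) (DFunLike.congr_fun hcomp)
  have hsurj : (fderiv ℝ g z).range = ⊤ :=
    LinearMap.range_eq_top.2 (LinearMap.injective_iff_surjective.1 hinj)
  rw [← (hg.hasStrictFDerivAt one_ne_zero).map_nhds_eq_of_surj hsurj]
  exact Filter.image_mem_map hN

variable {n k : ℕ} {S : Set (EuclideanSpace ℝ (Fin n))} {y : EuclideanSpace ℝ (Fin n)}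
  {f g : EuclideanSpace ℝ (Fin n) → ℝ}

theorem partialWithin_congr_of_eventuallyEq {I : Fin k → Fin n} (h : f =ᶠ[𝓝[S] y] g) (hy : y ∈ S) :
    partialWithin S I f y = partialWithin S I g y := by
  rw [partialWithin, partialWithin, h.iteratedFDerivWithin_eq (h.self_of_nhdsWithin hy)]

theorem partialWithin_zero (I : Fin 0 → Fin n) : partialWithin S I f y = f y := by
  simp [partialWithin]

theorem partialWithin_succ (hS : UniqueDiffOn ℝ S) (hy : y ∈ S)
    (hf : ContDiffWithinAt ℝ (k + 1 : ℕ) f S y) (I : Fin (k + 1) → Fin n) :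
    partialWithin S I f y =
      fderivWithin ℝ (partialWithin S (Fin.tail I) f) S y (EuclideanSpace.single (I 0) 1) := by
  have hd : DifferentiableWithinAt ℝ (iteratedFDerivWithin ℝ k f S) S y :=
    hf.differentiableWithinAt_iteratedFDerivWithin (by exact_mod_cast Nat.lt_succ_self k)
      (by rwa [insert_eq_of_mem hy])
  have hEval := ((ContinuousMultilinearMap.apply ℝ (fun _ : Fin k => EuclideanSpace ℝ (Fin n)) ℝ
    fun l => EuclideanSpace.single (Fin.tail I l) 1).hasFDerivAt.comp_hasFDerivWithinAt y
      hd.hasFDerivWithinAt).fderivWithin (hS y hy)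
  rw [partialWithin, iteratedFDerivWithin_succ_apply_left]
  exact (congrArg (fun L => L (EuclideanSpace.single (I 0) 1)) hEval).symm

theorem partialWithin_add_two (hS : UniqueDiffOn ℝ S) (hf : ContDiffOn ℝ (k + 2 : ℕ) f S)
    (hy : y ∈ S) (I : Fin (k + 2) → Fin n) :
    partialWithin S I f y =
      fderivWithin ℝ (fderivWithin ℝ (partialWithin S (Fin.tail (Fin.tail I)) f) S) S y
        (EuclideanSpace.single (I 0) 1) (EuclideanSpace.single (I 1) 1) := by
  have hC2 : ContDiffOn ℝ (2 : ℕ) (partialWithin S (Fin.tail (Fin.tail I)) f) S :=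
    contDiffOn_partialWithin hS hf (by omega)
  have hinner : EqOn (partialWithin S (Fin.tail I) f) (fun z =>
      fderivWithin ℝ (partialWithin S (Fin.tail (Fin.tail I)) f) S z
        (EuclideanSpace.single (I 1) 1)) S := fun z hz =>
    partialWithin_succ hS hz ((hf z hz).of_le (by exact_mod_cast Nat.le_succ _)) _
  have hd : DifferentiableWithinAt ℝ
      (fderivWithin ℝ (partialWithin S (Fin.tail (Fin.tail I)) f) S) S y :=
    (hC2.fderivWithin hS (m := 1) (by norm_num)).differentiableOn (by norm_num) y hy
  rw [partialWithin_succ hS hy (hf y hy), fderivWithin_congr' hinner hy,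
    fderivWithin_clm_apply (hS y hy) hd (differentiableWithinAt_const _)]
  simp

theorem partialWithin_comp_swap_zero_one (hS : UniqueDiffOn ℝ S) (hi : S ⊆ closure (interior S))
    (hf : ContDiffOn ℝ (k + 2 : ℕ) f S) (hy : y ∈ S) (I : Fin (k + 2) → Fin n) :
    partialWithin S (I ∘ Equiv.swap 0 1) f y = partialWithin S I f y := by
  have htail : Fin.tail (Fin.tail (I ∘ Equiv.swap 0 1)) = Fin.tail (Fin.tail I) := by
    funext l
    simp only [Fin.tail, Function.comp]
    rw [Equiv.swap_apply_of_ne_of_ne] <;> simp [Fin.ext_iff]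
  have hC2 : ContDiffOn ℝ (2 : ℕ) (partialWithin S (Fin.tail (Fin.tail I)) f) S :=
    contDiffOn_partialWithin hS hf (by omega)
  have hsymm := (hC2 y hy).isSymmSndFDerivWithinAt (by simp) hS (hi hy) hy
  rw [partialWithin_add_two hS hf hy, partialWithin_add_two hS hf hy, htail, hsymm.eq]
  simp

theorem tail_comp_swap_succ {α : Type*} (I : Fin (k + 1) → α) (i j : Fin k) :
    Fin.tail (I ∘ Equiv.swap i.succ j.succ) = Fin.tail I ∘ Equiv.swap i j := by
  funext l
  simp only [Fin.tail, Function.comp, (Fin.succ_injective k).swap_apply]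

theorem partialWithin_comp_swap_adjacent (hS : UniqueDiffOn ℝ S)
    (hi : S ⊆ closure (interior S)) {k : ℕ} (hf : ContDiffOn ℝ (k + 1 : ℕ) f S) (hy : y ∈ S)
    (I : Fin (k + 1) → Fin n) (i : Fin k) :
    partialWithin S (I ∘ Equiv.swap i.castSucc i.succ) f y = partialWithin S I f y := by
  induction k generalizing y with
  | zero => exact i.elim0
  | succ k ih =>
    induction i using Fin.cases with
    | zero => exact partialWithin_comp_swap_zero_one hS hi hf hy I
    | succ i =>
      have h0 : (I ∘ Equiv.swap i.succ.castSucc i.succ.succ) 0 = I 0 :=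
        congrArg I (Equiv.swap_apply_of_ne_of_ne (by simp [Fin.ext_iff]) (by simp [Fin.ext_iff]))
      have htail : Fin.tail (I ∘ Equiv.swap i.succ.castSucc i.succ.succ) =
          Fin.tail I ∘ Equiv.swap i.castSucc i.succ := by
        rw [← Fin.succ_castSucc, tail_comp_swap_succ]
      rw [partialWithin_succ hS hy (hf y hy), partialWithin_succ hS hy (hf y hy), h0, htail]
      congr 1
      exact fderivWithin_congr' (fun z hz =>
        ih (hf.of_le (by exact_mod_cast Nat.le_succ _)) hz _ i) hy

theorem partialWithin_comp_perm (hS : UniqueDiffOn ℝ S) (hi : S ⊆ closure (interior S))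
    (hf : ContDiffOn ℝ k f S) (hy : y ∈ S) (I : Fin k → Fin n) (σ : Equiv.Perm (Fin k)) :
    partialWithin S (I ∘ σ) f y = partialWithin S I f y := by
  cases k with
  | zero => congr 1; exact Subsingleton.elim _ _
  | succ k =>
    have hσ : σ ∈ Submonoid.closure
        (Set.range fun i : Fin k => Equiv.swap i.castSucc i.succ) := by
      rw [Equiv.Perm.mclosure_swap_castSucc_succ]; trivial
    induction hσ using Submonoid.closure_induction generalizing I with
    | one => rfl
    | mul σ τ _ _ ihσ ihτ => rw [Equiv.Perm.coe_mul, ← Function.comp_assoc, ihτ, ihσ]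
    | mem _ hswap =>
      obtain ⟨i, rfl⟩ := hswap
      exact partialWithin_comp_swap_adjacent hS hi hf hy I i

end EuclideanCalculus

section Charts

theorem continuousAt_extend_symm_comp {n : ℕ} {X Z : Type*} [TopologicalSpace X]
    [TopologicalSpace Z] {φ : OpenPartialHomeomorph X (EuclideanQuadrant n)}
    {h : Z → EuclideanSpace ℝ (Fin n)} {x : X} {z : Z} (hx : x ∈ φ.source)
    (hxz : φ.extend (quadrant n) x = h z) (hh : ContinuousAt h z) :
    ContinuousAt (fun z => (φ.extend (quadrant n)).symm (h z)) z :=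
  ContinuousAt.comp (g := (φ.extend (quadrant n)).symm) (hxz ▸ φ.continuousAt_extend_symm hx) hh

variable {n m : ℕ} {X : Type u} [TopologicalSpace X] [ChartedSpace (EuclideanQuadrant n) X]

/-- The map `φ` is a chart of `X` and `ψ` a local diffeomorphism of `ℝⁿ` which together straighten
the body `R` to the closed quadrant, as in `Body.locally_quadrant`. -/
structure Body.Straightens (R : Body n X) (φ : OpenPartialHomeomorph X (EuclideanQuadrant n))
    (ψ : OpenPartialHomeomorph (EuclideanSpace ℝ (Fin n)) (EuclideanSpace ℝ (Fin n))) : Prop where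
  mem_maximalAtlas : φ ∈ IsManifold.maximalAtlas (quadrant n) ∞ X
  contDiffOn : ContDiffOn ℝ ∞ ψ ψ.source
  contDiffOn_symm : ContDiffOn ℝ ∞ ψ.symm ψ.target
  mem_image_iff : ∀ y ∈ ψ.source,
    y ∈ φ.extend (quadrant n) '' (φ.source ∩ R.carrier) ↔ ∀ i, 0 ≤ ψ y i

namespace Body.Straightens

variable {R : Body n X} {φ : OpenPartialHomeomorph X (EuclideanQuadrant n)}
  {ψ : OpenPartialHomeomorph (EuclideanSpace ℝ (Fin n)) (EuclideanSpace ℝ (Fin n))}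
  {x : X} {z : EuclideanSpace ℝ (Fin n)}

theorem exists_eq_symm (h : R.Straightens φ ψ) (hz : z ∈ ψ.target) (hpos : ∀ i, 0 ≤ z i) :
    ∃ x ∈ φ.source ∩ R.carrier, φ.extend (quadrant n) x = ψ.symm z :=
  (h.mem_image_iff _ (ψ.map_target hz)).2 (by rwa [ψ.right_inv hz])

theorem exists_pos_mem_of_mem_nhds (h : R.Straightens φ ψ) (hxφ : x ∈ φ.source)
    (hxR : x ∈ R.carrier) (hxψ : φ.extend (quadrant n) x ∈ ψ.source) {U : Set X} (hU : U ∈ 𝓝 x) :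
    ∃ w ∈ U ∩ (φ.source ∩ R.carrier), φ.extend (quadrant n) w ∈ ψ.source ∧
      ∀ i, 0 < ψ (φ.extend (quadrant n) w) i := by
  set z := ψ (φ.extend (quadrant n) x)
  have hzt : z ∈ ψ.target := ψ.map_source hxψ
  have hxz : φ.extend (quadrant n) x = ψ.symm z := (ψ.left_inv hxψ).symm
  have hnear : ∀ᶠ z' in 𝓝 z, z' ∈ ψ.target ∧ (φ.extend (quadrant n)).symm (ψ.symm z') ∈ U := by
    refine (ψ.open_target.eventually_mem hzt).and
      (continuousAt_extend_symm_comp hxφ hxz (ψ.continuousAt_symm hzt) ?_)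
    simpa only [← hxz, φ.extend_left_inv hxφ] using hU
  have hshift : Filter.Tendsto (fun t : ℝ => z + t • (WithLp.toLp 2 fun _ => (1 : ℝ)))
      (𝓝[>] 0) (𝓝 z) := by
    have : Continuous fun t : ℝ => z + t • (WithLp.toLp 2 fun _ : Fin n => (1 : ℝ)) := by
      fun_prop
    simpa using (this.tendsto 0).mono_left nhdsWithin_le_nhds
  obtain ⟨t, ⟨ht, htU⟩, ht0⟩ := ((hshift.eventually hnear).and self_mem_nhdsWithin).exists
  have hpos : ∀ i, 0 < (z + t • WithLp.toLp 2 fun _ => 1 : EuclideanSpace ℝ (Fin n)) i := by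
    intro i
    have hz : 0 ≤ z i := (h.mem_image_iff _ hxψ).1 ⟨x, ⟨hxφ, hxR⟩, rfl⟩ i
    simpa using add_pos_of_nonneg_of_pos hz ht0
  obtain ⟨w, ⟨hwφ, hwR⟩, hw⟩ := h.exists_eq_symm ht fun i => (hpos i).le
  rw [← hw, φ.extend_left_inv hwφ] at htU
  exact ⟨w, ⟨htU, hwφ, hwR⟩, hw ▸ ψ.map_target ht, by rwa [hw, ψ.right_inv ht]⟩

end Body.Straightens

variable {W : X → Type u} [∀ x, AddCommGroup (W x)] [∀ x, Module ℝ (W x)]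
  [TopologicalSpace (TotalSpace (EuclideanSpace ℝ (Fin m)) W)] [∀ x, TopologicalSpace (W x)]
  [FiberBundle (EuclideanSpace ℝ (Fin m)) W]

namespace VBChart

variable {R : Body n X} {φ : OpenPartialHomeomorph X (EuclideanQuadrant n)}
  {ψ : OpenPartialHomeomorph (EuclideanSpace ℝ (Fin n)) (EuclideanSpace ℝ (Fin n))}

theorem ext_inv (a : VBChart n m W) {S : Set X} {y : EuclideanSpace ℝ (Fin n)}
    (hy : y ∈ a.img S) : a.ext (a.inv y) = y := by
  obtain ⟨x, hx, rfl⟩ := hy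
  rw [a.inv_ext hx.1]

theorem inv_mem (a : VBChart n m W) {S : Set X} {y : EuclideanSpace ℝ (Fin n)}
    (hy : y ∈ a.img S) : a.inv y ∈ a.dom ∩ S := by
  obtain ⟨x, hx, rfl⟩ := hy
  rwa [a.inv_ext hx.1]

theorem ext_mem (a : VBChart n m W) {S : Set X} {x : X} (hx : x ∈ a.dom ∩ S) :
    a.ext x ∈ a.img S := ⟨x, hx, rfl⟩

theorem continuousAt_ext (a : VBChart n m W) {x : X} (hx : x ∈ a.dom) : ContinuousAt a.ext x :=
  a.chart.continuousAt_extend hx.1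

theorem continuousAt_inv (a : VBChart n m W) {x : X} (hx : x ∈ a.dom) :
    ContinuousAt a.inv (a.ext x) :=
  a.chart.continuousAt_extend_symm hx.1

theorem continuousOn_ext (a : VBChart n m W) : ContinuousOn a.ext a.dom := fun _ hx =>
  (a.continuousAt_ext hx).continuousWithinAt

theorem continuousOn_inv (a : VBChart n m W) (S : Set X) : ContinuousOn a.inv (a.img S) := by
  rintro _ ⟨x, hx, rfl⟩
  exact (a.continuousAt_inv hx.1).continuousWithinAt

theorem differentiableWithinAt_straighten (a : VBChart n m W) (h : R.Straightens φ ψ) {w : X}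
    (hwa : w ∈ a.dom) (hwφ : w ∈ φ.source) (hwψ : φ.extend (quadrant n) w ∈ ψ.source) :
    DifferentiableWithinAt ℝ (fun y => ψ (φ.extend (quadrant n) (a.inv y)))
      (range (quadrant n)) (a.ext w) := by
  have hψ : DifferentiableAt ℝ ψ (φ.extend (quadrant n) (a.inv (a.ext w))) := by
    rw [a.inv_ext hwa]
    exact ((h.contDiffOn _ hwψ).contDiffAt (ψ.open_source.mem_nhds hwψ)).differentiableAt (by simp)
  exact hψ.comp_differentiableWithinAt (a.ext w)
    (((quadrant n).contDiffWithinAt_extendCoordChange' a.chart_mem h.mem_maximalAtlas hwa.1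
      hwφ).differentiableWithinAt (by simp))

theorem ext_mem_interior_img (a : VBChart n m W) (h : R.Straightens φ ψ) {w : X}
    (hwa : w ∈ a.dom) (hw : w ∈ φ.source ∩ R.carrier)
    (hwψ : φ.extend (quadrant n) w ∈ ψ.source)
    (hpos : ∀ i, 0 < ψ (φ.extend (quadrant n) w) i) :
    a.ext w ∈ interior (a.img R.carrier) := by
  set p : EuclideanSpace ℝ (Fin n) → X := fun z => (φ.extend (quadrant n)).symm (ψ.symm z) with hp
  set z := ψ (φ.extend (quadrant n) w)
  have hzt : z ∈ ψ.target := ψ.map_source hwψ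
  have hwz : φ.extend (quadrant n) w = ψ.symm z := (ψ.left_inv hwψ).symm
  have hpz : p z = w := by simp only [hp, ← hwz, φ.extend_left_inv hw.1]
  set N : Set (EuclideanSpace ℝ (Fin n)) := {z | z ∈ ψ.target ∧ (∀ i, 0 ≤ z i) ∧ p z ∈ a.dom}
  have hN : N ∈ 𝓝 z := by
    refine (ψ.open_target.eventually_mem hzt).and
      ((Filter.eventually_all.2 fun i => ?_).and ?_)
    · have : ContinuousAt (fun z : EuclideanSpace ℝ (Fin n) => z i) z := by fun_prop
      exact (this.eventually (lt_mem_nhds (hpos i))).mono fun _ h => h.le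
    · exact continuousAt_extend_symm_comp hw.1 hwz (ψ.continuousAt_symm hzt)
        (a.isOpen_dom.mem_nhds (show p z ∈ a.dom by rwa [hpz]))
  have hlift : ∀ z' ∈ N, p z' ∈ φ.source ∩ R.carrier ∧
      φ.extend (quadrant n) (p z') = ψ.symm z' := by
    rintro z' ⟨hz't, hz'0, -⟩
    obtain ⟨v, hv, hvz⟩ := h.exists_eq_symm hz't hz'0
    have hpv : p z' = v := by simp only [hp, ← hvz, φ.extend_left_inv hv.1]
    exact hpv ▸ ⟨hv, hvz⟩
  have hsmooth : ContDiffAt ℝ ∞ (fun z => a.ext (p z)) z := by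
    refine ContDiffWithinAt.contDiffAt (s := N) (ContDiffWithinAt.comp (t := range (quadrant n))
      (g := (quadrant n).extendCoordChange φ a.chart) z ?_
      ((h.contDiffOn_symm z hzt).contDiffAt (ψ.open_target.mem_nhds hzt)).contDiffWithinAt ?_) hN
    · rw [← hwz]
      exact (quadrant n).contDiffWithinAt_extendCoordChange' h.mem_maximalAtlas a.chart_mem hw.1
        hwa.1
    · exact fun z' hz' => (hlift z' hz').2 ▸ mem_range_self (φ (p z'))
  have hmem : (fun z => a.ext (p z)) '' N ∈ 𝓝 (a.ext (p z)) :=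
    image_mem_nhds_of_leftInvOn hN (hsmooth.of_le (by simp))
      (by simpa only [hpz] using a.differentiableWithinAt_straighten h hwa hw.1 hwψ)
      (fun z' _ => mem_range_self (a.chart (p z'))) fun z' hz' => by
        rw [a.inv_ext hz'.2.2, (hlift z' hz').2, ψ.right_inv hz'.1]
  refine mem_interior_iff_mem_nhds.2 (Filter.mem_of_superset (by simpa only [hpz] using hmem) ?_)
  exact image_subset_iff.2 fun z' hz' => a.ext_mem ⟨hz'.2.2, (hlift z' hz').1.2⟩

theorem img_subset_closure_interior (a : VBChart n m W) (R : Body n X) :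
    a.img R.carrier ⊆ closure (interior (a.img R.carrier)) := by
  rintro _ ⟨x, ⟨hxa, hxR⟩, rfl⟩
  obtain ⟨φ, hφ, hxφ, ψ, hψ, hψs, hxψ, hiff⟩ := R.locally_quadrant x hxR
  have h : R.Straightens φ ψ := ⟨hφ, hψ, hψs, hiff⟩
  refine mem_closure_iff_nhds.2 fun V hV => ?_
  obtain ⟨w, ⟨⟨hwV, hwa⟩, hw⟩, hwψ, hpos⟩ := h.exists_pos_mem_of_mem_nhds hxφ hxR hxψ
    (Filter.inter_mem (a.continuousAt_ext hxa hV) (a.isOpen_dom.mem_nhds hxa))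
  exact ⟨a.ext w, hwV, a.ext_mem_interior_img h hwa hw hwψ hpos⟩

end VBChart

end Charts

section ChartDerivatives

variable {n m k l : ℕ} {X : Type u} [TopologicalSpace X] [ChartedSpace (EuclideanQuadrant n) X]
  {W : X → Type u} [∀ x, AddCommGroup (W x)] [∀ x, Module ℝ (W x)]
  [TopologicalSpace (TotalSpace (EuclideanSpace ℝ (Fin m)) W)] [∀ x, TopologicalSpace (W x)]
  [FiberBundle (EuclideanSpace ℝ (Fin m)) W]

/-- `f` is a real function of class `C^k` on the subset `S` of the manifold with corners `X`. -/
abbrev SmoothOn (n : ℕ) {X : Type u} [TopologicalSpace X] [ChartedSpace (EuclideanQuadrant n) X]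
    (k : ℕ∞ω) (f : X → ℝ) (S : Set X) : Prop :=
  ContMDiffOn (quadrant n) 𝓘(ℝ, ℝ) k f S

/-- `f` is a real function of class `C^k` on the subset `S` of `X` near the point `x`. -/
abbrev SmoothWithinAt (n : ℕ) {X : Type u} [TopologicalSpace X]
    [ChartedSpace (EuclideanQuadrant n) X] (k : ℕ∞ω) (f : X → ℝ) (S : Set X) (x : X) : Prop :=
  ContMDiffWithinAt (quadrant n) 𝓘(ℝ, ℝ) k f S x

theorem SmoothOn.smoothWithinAt {j k : ℕ∞ω} {f : X → ℝ} {U S : Set X} {x : X}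
    (hf : SmoothOn n k f (U ∩ S)) (hU : IsOpen U) (hx : x ∈ U ∩ S) (h : j ≤ k) :
    SmoothWithinAt n j f S x :=
  ((hf x hx).of_le h).mono_of_mem_nhdsWithin (Filter.inter_mem
    (mem_nhdsWithin_of_mem_nhds (hU.mem_nhds hx.1)) self_mem_nhdsWithin)

namespace VBChart

variable {f g : X → ℝ} {x : X} {R : Body n X}

theorem chart_mem_maximalAtlas (a : VBChart n m W) {k : ℕ∞ω} (hk : k ≤ ∞) :
    a.chart ∈ IsManifold.maximalAtlas (quadrant n) k X :=
  IsManifold.maximalAtlas_subset_of_le hk a.chart_mem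

theorem smoothOn_iff (a : VBChart n m W) {k : ℕ∞ω} (hk : k ≤ ∞) {S : Set X} :
    SmoothOn n k f (a.dom ∩ S) ↔ ContDiffOn ℝ k (f ∘ a.inv) (a.img S) := by
  rw [SmoothOn, contMDiffOn_iff_of_mem_maximalAtlas' (a.chart_mem_maximalAtlas hk)
    (IsManifold.chart_mem_maximalAtlas (0 : ℝ)) (fun _ hx => hx.1.1) (fun x _ => mem_univ _)]
  rfl

theorem contDiffWithinAt_comp_inv (a : VBChart n m W) {S : Set X} {k : ℕ∞ω} (hk : k ≤ ∞)
    (hf : SmoothWithinAt n k f S x) (hx : x ∈ a.dom ∩ S) :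
    ContDiffWithinAt ℝ k (f ∘ a.inv) (a.img S) (a.ext x) :=
  ((contMDiffWithinAt_iff_image (s := a.dom ∩ S) (a.chart_mem_maximalAtlas hk)
    (IsManifold.chart_mem_maximalAtlas (0 : ℝ)) (fun _ hx => hx.1.1) hx.1.1 (mem_univ _)).1
      (hf.mono inter_subset_right)).2

theorem differentiableWithinAt_comp_inv (a : VBChart n m W) {S : Set X}
    (hf : SmoothWithinAt n 1 f S x) (hx : x ∈ a.dom ∩ S) :
    DifferentiableWithinAt ℝ (f ∘ a.inv) (a.img S) (a.ext x) :=
  (a.contDiffWithinAt_comp_inv (by simp) hf hx).differentiableWithinAt (by simp)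

/-- The `i`-th partial derivative in the chart `a` of a function on `S ⊆ X`. -/
def dpd (a : VBChart n m W) (S : Set X) (i : Fin n) (f : X → ℝ) (x : X) : ℝ :=
  fderivWithin ℝ (f ∘ a.inv) (a.img S) (a.ext x) (EuclideanSpace.single i 1)

/-- The iterated partial derivative `∂_I` in the chart `a` of a function on `S ⊆ X`. -/
def pd (a : VBChart n m W) (S : Set X) (I : Fin k → Fin n) (f : X → ℝ) (x : X) : ℝ :=
  partialWithin (a.img S) I (f ∘ a.inv) (a.ext x)

theorem pd_comp_inv (a : VBChart n m W) (S : Set X) (I : Fin k → Fin n) (f : X → ℝ) :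
    EqOn (a.pd S I f ∘ a.inv) (partialWithin (a.img S) I (f ∘ a.inv)) (a.img S) := by
  intro y hy
  simp only [Function.comp, pd, a.ext_inv hy]

theorem pd_zero (a : VBChart n m W) (S : Set X) (I : Fin 0 → Fin n) (f : X → ℝ)
    (hx : x ∈ a.dom) : a.pd S I f x = f x := by
  rw [pd, partialWithin_zero, Function.comp, a.inv_ext hx]

theorem pd_succ (a : VBChart n m W) (R : Body n X) (I : Fin (k + 1) → Fin n)
    (hf : SmoothWithinAt n (k + 1 : ℕ) f R.carrier x) (hx : x ∈ a.dom ∩ R.carrier) :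
    a.pd R.carrier I f x = a.dpd R.carrier (I 0) (a.pd R.carrier (Fin.tail I) f) x := by
  rw [pd, partialWithin_succ (a.uniqueDiffOn_img R) (a.ext_mem hx)
    (a.contDiffWithinAt_comp_inv (by exact_mod_cast le_top) hf hx), dpd]
  congr 1
  exact (fderivWithin_congr' (a.pd_comp_inv _ _ _) (a.ext_mem hx)).symm

theorem smoothOn_pd (a : VBChart n m W) (R : Body n X) (I : Fin k → Fin n)
    (hf : SmoothOn n (l : ℕ) f (a.dom ∩ R.carrier)) {j : ℕ} (h : j + k ≤ l) :
    SmoothOn n j (a.pd R.carrier I f) (a.dom ∩ R.carrier) := by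
  rw [a.smoothOn_iff (by exact_mod_cast le_top)] at hf ⊢
  exact (contDiffOn_partialWithin (a.uniqueDiffOn_img R) hf h).congr (a.pd_comp_inv _ _ _)

theorem pd_comp_perm (a : VBChart n m W) (R : Body n X) (I : Fin k → Fin n)
    (hf : SmoothOn n (k : ℕ) f (a.dom ∩ R.carrier)) (hx : x ∈ a.dom ∩ R.carrier)
    (σ : Equiv.Perm (Fin k)) : a.pd R.carrier (I ∘ σ) f x = a.pd R.carrier I f x :=
  partialWithin_comp_perm (a.uniqueDiffOn_img R) (a.img_subset_closure_interior R)
    ((a.smoothOn_iff (by exact_mod_cast le_top)).1 hf) (a.ext_mem hx) I σ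

theorem tendsto_inv (a : VBChart n m W) {S : Set X} (hx : x ∈ a.dom) :
    Filter.Tendsto a.inv (𝓝[a.img S] (a.ext x)) (𝓝[S] x) := by
  refine tendsto_nhdsWithin_iff.2 ⟨?_, ?_⟩
  · simpa only [ContinuousWithinAt, a.inv_ext hx] using
      (a.continuousAt_inv hx).continuousWithinAt (s := a.img S)
  · exact eventually_mem_nhdsWithin.mono fun y hy => (a.inv_mem hy).2

theorem pd_congr_of_eventuallyEq (a : VBChart n m W) {S : Set X} (I : Fin k → Fin n)
    (h : f =ᶠ[𝓝[S] x] g) (hx : x ∈ a.dom ∩ S) : a.pd S I f x = a.pd S I g x :=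
  partialWithin_congr_of_eventuallyEq ((a.tendsto_inv hx.1).eventually h) (a.ext_mem hx)

theorem dpd_congr_of_eventuallyEq (a : VBChart n m W) (S : Set X) (i : Fin n)
    (h : f =ᶠ[𝓝[S] x] g) (hx : x ∈ a.dom ∩ S) : a.dpd S i f x = a.dpd S i g x := by
  have hcomp : f ∘ a.inv =ᶠ[𝓝[a.img S] (a.ext x)] g ∘ a.inv := (a.tendsto_inv hx.1).eventually h
  rw [dpd, dpd, hcomp.fderivWithin_eq_of_mem (a.ext_mem hx)]

theorem dpd_mul (a : VBChart n m W) (R : Body n X) (i : Fin n)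
    (hf : SmoothWithinAt n 1 f R.carrier x) (hg : SmoothWithinAt n 1 g R.carrier x)
    (hx : x ∈ a.dom ∩ R.carrier) :
    a.dpd R.carrier i (fun z => f z * g z) x =
      a.dpd R.carrier i f x * g x + f x * a.dpd R.carrier i g x := by
  have hfderiv := fderivWithin_fun_mul (a.uniqueDiffOn_img R _ (a.ext_mem hx))
    (a.differentiableWithinAt_comp_inv hf hx) (a.differentiableWithinAt_comp_inv hg hx)
  have happly := congrArg (fun L => L (EuclideanSpace.single i 1)) hfderiv
  simp only [Function.comp, a.inv_ext hx.1] at happly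
  refine happly.trans ?_
  simp only [add_apply, smul_apply, smul_eq_mul, dpd, Function.comp_def]
  ring

theorem dpd_sum (a : VBChart n m W) (R : Body n X) (i : Fin n) {P : Type*} (s : Finset P)
    {f : P → X → ℝ} (hf : ∀ p, SmoothWithinAt n 1 (f p) R.carrier x)
    (hx : x ∈ a.dom ∩ R.carrier) :
    a.dpd R.carrier i (fun z => ∑ p ∈ s, f p z) x = ∑ p ∈ s, a.dpd R.carrier i (f p) x := by
  have hfderiv := fderivWithin_fun_sum (u := s) (A := fun p => f p ∘ a.inv)
    (a.uniqueDiffOn_img R _ (a.ext_mem hx))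
    (fun p _ => a.differentiableWithinAt_comp_inv (hf p) hx)
  refine (congrArg (fun L => L (EuclideanSpace.single i 1)) hfderiv).trans ?_
  simp [dpd]

theorem dpd_restrict (a : VBChart n m W) (R : Body n X) (i : Fin n)
    (hf : SmoothWithinAt n 1 f univ x) (hx : x ∈ a.dom ∩ R.carrier) :
    a.dpd R.carrier i f x = a.dpd univ i f x := by
  have hmono := (a.differentiableWithinAt_comp_inv hf ⟨hx.1, mem_univ x⟩).hasFDerivWithinAt.mono
    (image_mono (f := a.ext) (inter_subset_inter_right a.dom (subset_univ R.carrier)))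
  exact congrArg (fun L => L (EuclideanSpace.single i 1))
    (hmono.fderivWithin (a.uniqueDiffOn_img R _ (a.ext_mem hx)))

theorem img_mem_nhdsWithin_img_univ (a : VBChart n m W) {U : Set X} (hU : IsOpen U)
    {y : EuclideanSpace ℝ (Fin n)} (hy : y ∈ a.img U) : a.img U ∈ 𝓝[a.img univ] y := by
  have hinv := a.inv_mem hy
  have hpre : a.inv ⁻¹' U ∈ 𝓝 y := by
    rw [← a.ext_inv hy]
    exact a.continuousAt_inv hinv.1 ((hU.mem_nhds (by rw [a.inv_ext hinv.1]; exact hinv.2)))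
  refine mem_nhdsWithin_iff_exists_mem_nhds_inter.2 ⟨_, hpre, ?_⟩
  rintro z ⟨hzU, hz⟩
  exact ⟨a.inv z, ⟨(a.inv_mem hz).1, hzU⟩, a.ext_inv hz⟩

theorem smoothOn_dpd [CompactSpace X] [IsManifold (quadrant n) ∞ X] (a : VBChart n m W)
    (i : Fin n) {U : Set X} (hU : IsOpen U) (hUa : U ⊆ a.dom) (hf : SmoothOn n ∞ f U) :
    SmoothOn n ∞ (a.dpd univ i f) U := by
  have hUa' : a.dom ∩ U = U := inter_eq_right.2 hUa
  have hsub : a.img U ⊆ a.img univ := image_mono (inter_subset_inter_right _ (subset_univ _))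
  rw [← hUa', a.smoothOn_iff le_rfl] at hf ⊢
  have hderiv : ContDiffOn ℝ ∞ (fun y => fderivWithin ℝ (f ∘ a.inv) (a.img univ) y
      (EuclideanSpace.single i 1)) (a.img U) := fun y hy =>
    ((((hf y hy).mono_of_mem_nhdsWithin (a.img_mem_nhdsWithin_img_univ hU hy)).fderivWithin_right
      (m := ∞) (a.uniqueDiffOn_img (Body.whole n X)) (by simp) (hsub hy)).clm_apply
        contDiffWithinAt_const).mono hsub
  refine hderiv.congr fun y hy => ?_
  simp only [Function.comp, dpd, a.ext_inv hy]

/-- The `j`-th coordinate function of the chart `a`. -/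
def coordFun (a : VBChart n m W) (j : Fin n) (x : X) : ℝ := a.ext x j

theorem smoothOn_coordFun (a : VBChart n m W) (j : Fin n) :
    SmoothOn n ∞ (a.coordFun j) a.dom := by
  rw [← inter_univ a.dom, a.smoothOn_iff le_rfl]
  have h : ContDiffOn ℝ ∞ (fun y : EuclideanSpace ℝ (Fin n) => y j) (a.img univ) := by
    fun_prop
  refine h.congr fun y hy => ?_
  simp only [Function.comp, coordFun, a.ext_inv hy]

theorem differentiableWithinAt_transition (a b : VBChart n m W) (S : Set X)
    (hx : x ∈ a.dom ∩ b.dom) :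
    DifferentiableWithinAt ℝ (fun y => a.ext (b.inv y)) (b.img S) (b.ext x) := by
  refine (((quadrant n).contDiffWithinAt_extendCoordChange' b.chart_mem a.chart_mem hx.2.1
    hx.1.1).differentiableWithinAt (by simp)).mono ?_
  rintro _ ⟨z, -, rfl⟩
  exact mem_range_self (b.chart z)

theorem fderivWithin_transition_apply (a b : VBChart n m W) (R : Body n X) (i j : Fin n)
    (hx : x ∈ (a.dom ∩ b.dom) ∩ R.carrier) :
    fderivWithin ℝ (fun y => a.ext (b.inv y)) (b.img R.carrier) (b.ext x)
      (EuclideanSpace.single i 1) j = b.dpd R.carrier i (a.coordFun j) x :=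
  (congrArg (fun L => L (EuclideanSpace.single i 1))
    (((EuclideanSpace.proj (𝕜 := ℝ) j).hasFDerivAt.comp_hasFDerivWithinAt _
      (a.differentiableWithinAt_transition b _ hx.1).hasFDerivWithinAt).fderivWithin
        (b.uniqueDiffOn_img R _ (b.ext_mem ⟨hx.1.2, hx.2⟩)))).symm

theorem fderivWithin_comp_inv_change (a b : VBChart n m W) (R : Body n X)
    (hf : SmoothWithinAt n 1 f R.carrier x) (hx : x ∈ (a.dom ∩ b.dom) ∩ R.carrier) :
    fderivWithin ℝ (f ∘ b.inv) (b.img R.carrier) (b.ext x) =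
      (fderivWithin ℝ (f ∘ a.inv) (a.img R.carrier) (a.ext x)).comp
        (fderivWithin ℝ (fun y => a.ext (b.inv y)) (b.img R.carrier) (b.ext x)) := by
  have hxa : x ∈ a.dom ∩ R.carrier := ⟨hx.1.1, hx.2⟩
  have hxb : x ∈ b.dom ∩ R.carrier := ⟨hx.1.2, hx.2⟩
  set S := b.img R.carrier ∩ b.inv ⁻¹' a.dom
  have hS : S ∈ 𝓝[b.img R.carrier] (b.ext x) := by
    refine Filter.inter_mem self_mem_nhdsWithin (mem_nhdsWithin_of_mem_nhds ?_)
    exact b.continuousAt_inv hx.1.2 (a.isOpen_dom.mem_nhds (by rw [b.inv_ext hx.1.2]; exact hx.1.1))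
  have hτx : a.ext (b.inv (b.ext x)) = a.ext x := by rw [b.inv_ext hx.1.2]
  have hτ : MapsTo (fun y => a.ext (b.inv y)) S (a.img R.carrier) := fun y hy =>
    a.ext_mem ⟨hy.2, (b.inv_mem hy.1).2⟩
  have hfa := (a.differentiableWithinAt_comp_inv hf hxa).hasFDerivWithinAt
  rw [← hτx] at hfa ⊢
  have hcomp := hfa.comp (b.ext x) ((a.differentiableWithinAt_transition b R.carrier
    hx.1).hasFDerivWithinAt.mono inter_subset_left) hτ
  have hcongr : HasFDerivWithinAt (f ∘ b.inv) _ S (b.ext x) :=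
    hcomp.congr (fun y hy => by simp only [Function.comp, a.inv_ext hy.2]) (by
      have hxS : b.ext x ∈ S := mem_of_mem_nhdsWithin (b.ext_mem hxb) hS
      simp only [Function.comp, a.inv_ext hxS.2])
  exact (hcongr.mono_of_mem_nhdsWithin hS).fderivWithin (b.uniqueDiffOn_img R _ (b.ext_mem hxb))

theorem dpd_change (a b : VBChart n m W) (R : Body n X) (i : Fin n)
    (hf : SmoothWithinAt n 1 f R.carrier x) (hx : x ∈ (a.dom ∩ b.dom) ∩ R.carrier) :
    b.dpd R.carrier i f x =
      ∑ j, b.dpd R.carrier i (a.coordFun j) x * a.dpd R.carrier j f x := by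
  have hbasis : ∀ v : EuclideanSpace ℝ (Fin n),
      v = ∑ j, v j • EuclideanSpace.single j (1 : ℝ) := fun v => by
    ext j
    simp [Pi.single_apply]
  rw [dpd, a.fderivWithin_comp_inv_change b R hf hx, ContinuousLinearMap.comp_apply,
    hbasis (fderivWithin ℝ (fun y => a.ext (b.inv y)) _ _ _), map_sum]
  simp only [map_smul, smul_eq_mul, a.fderivWithin_transition_apply b R i _ hx, dpd]

end VBChart

end ChartDerivatives

section Sections

variable {n m k : ℕ} {X : Type u} [TopologicalSpace X] [ChartedSpace (EuclideanQuadrant n) X]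
  {W : X → Type u} [∀ x, AddCommGroup (W x)] [∀ x, Module ℝ (W x)]
  [TopologicalSpace (TotalSpace (EuclideanSpace ℝ (Fin m)) W)] [∀ x, TopologicalSpace (W x)]
  [FiberBundle (EuclideanSpace ℝ (Fin m)) W] {ι : Type}

namespace CoordBundle

/-- The components of a section with respect to the chart `a`, as functions on `X`. -/
def comp (E : CoordBundle n m W ι) (a : VBChart n m W) (s : ∀ x, E.Fib x) (c : ι) (x : X) : ℝ :=
  E.coord a x (s x) c

theorem rep_eq_comp (E : CoordBundle n m W ι) (a : VBChart n m W) (s : ∀ x, E.Fib x)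
    (y : EuclideanSpace ℝ (Fin n)) (c : ι) : E.rep a s y c = E.comp a s c (a.inv y) := rfl

theorem mem_sec_iff (E : CoordBundle n m W ι) (R : Body n X) (s : ∀ x, E.Fib x) :
    s ∈ E.Sec R k ↔ (∀ x ∉ R.carrier, s x = 0) ∧
      ∀ a c, SmoothOn n k (E.comp a s c) (a.dom ∩ R.carrier) := by
  refine and_congr_right fun _ => forall_congr' fun a => forall_congr' fun c => ?_
  rw [a.smoothOn_iff (by exact_mod_cast le_top)]
  rfl

theorem Sec.smoothOn {E : CoordBundle n m W ι} {R : Body n X} (s : E.Sec R k)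
    (a : VBChart n m W) (c : ι) : SmoothOn n k (E.comp a s.1 c) (a.dom ∩ R.carrier) :=
  ((E.mem_sec_iff R s.1).1 s.2).2 a c

theorem Sec.comp_eq_zero {E : CoordBundle n m W ι} {R : Body n X} (s : E.Sec R k)
    (a : VBChart n m W) (c : ι) {x : X} (hx : x ∉ R.carrier) : E.comp a s.1 c x = 0 := by
  rw [comp, s.2.1 x hx, map_zero]; rfl

theorem jetBundle_coord_mk (E : CoordBundle n m W ι) (R : Body n X) (r : ℕ) (a : VBChart n m W)
    {x : X} (hx : x ∈ a.dom ∩ R.carrier) (s : E.Sec R r) (p : JetIdx n r × ι) :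
    (E.jetBundle R r).coord a x (Submodule.Quotient.mk s) p =
      a.pd R.carrier p.1.2.1 (E.comp a s.1 p.2) x := by
  simp only [jetBundle]
  rw [dif_pos hx]
  rfl

end CoordBundle

end Sections

section Polynomials

variable {n k : ℕ}

theorem iteratedFDeriv_eq_zero_of_homogeneous {E F : Type*} [NormedAddCommGroup E]
    [NormedSpace ℝ E] [NormedAddCommGroup F] [NormedSpace ℝ F] {f : E → F} {j : ℕ}
    (hf : ContDiff ℝ j f) (hhom : ∀ y, f ((2 : ℝ) • y) = (2 : ℝ) ^ k • f y) (hjk : j ≠ k) :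
    iteratedFDeriv ℝ j f 0 = 0 := by
  have hscale : (2 : ℝ) ^ j • iteratedFDeriv ℝ j f 0 = (2 : ℝ) ^ k • iteratedFDeriv ℝ j f 0 := by
    have hcomp := congrFun (iteratedFDeriv_comp_const_smul (2 : ℝ) hf) 0
    rw [smul_zero] at hcomp
    rw [← hcomp, ← iteratedFDeriv_const_smul_apply hf.contDiffAt]
    exact congrArg (fun g => iteratedFDeriv ℝ j g 0) (funext hhom)
  refine (smul_eq_zero.1 (sub_eq_zero.2 hscale ▸ sub_smul _ _ _)).resolve_left ?_
  exact sub_ne_zero.2 fun h => hjk (pow_right_injective₀ two_pos (by norm_num) h)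

/-- The monomial `∏ₗ (y - y₀)^{i_l}`, `I = i₁ ⋯ iₖ`, centred at `y₀`. -/
def monomialAt (y₀ : EuclideanSpace ℝ (Fin n)) (I : Fin k → Fin n)
    (y : EuclideanSpace ℝ (Fin n)) : ℝ := ∏ l, (y - y₀) (I l)

theorem contDiff_monomialAt (y₀ : EuclideanSpace ℝ (Fin n)) (I : Fin k → Fin n) :
    ContDiff ℝ ∞ (monomialAt y₀ I) :=
  contDiff_prod fun l _ =>
    (EuclideanSpace.proj (𝕜 := ℝ) (I l)).contDiff.comp (contDiff_id.sub contDiff_const)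

theorem iteratedFDeriv_monomialAt (y₀ : EuclideanSpace ℝ (Fin n)) (I : Fin k → Fin n) (j : ℕ) :
    iteratedFDeriv ℝ j (monomialAt y₀ I) y₀ = iteratedFDeriv ℝ j (monomialAt 0 I) 0 := by
  have hshift : monomialAt y₀ I = fun y => monomialAt 0 I (y - y₀) := by
    funext y
    simp only [monomialAt, sub_zero]
  rw [hshift, iteratedFDeriv_comp_sub, sub_self]

theorem iteratedFDeriv_monomialAt_of_ne (y₀ : EuclideanSpace ℝ (Fin n)) (I : Fin k → Fin n)
    {j : ℕ} (hjk : j ≠ k) : iteratedFDeriv ℝ j (monomialAt y₀ I) y₀ = 0 := by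
  rw [iteratedFDeriv_monomialAt]
  refine iteratedFDeriv_eq_zero_of_homogeneous
    ((contDiff_monomialAt 0 I).of_le (by exact_mod_cast le_top)) (fun y => ?_) hjk
  simp [monomialAt, Finset.prod_mul_distrib]

theorem iteratedFDeriv_monomialAt_apply_single (y₀ : EuclideanSpace ℝ (Fin n))
    (I J : Fin k → Fin n) :
    iteratedFDeriv ℝ k (monomialAt y₀ I) y₀ (fun l => EuclideanSpace.single (J l) 1) =
      Fintype.card {σ : Equiv.Perm (Fin k) // J ∘ σ = I} := by
  set M : ContinuousMultilinearMap ℝ (fun _ : Fin k => EuclideanSpace ℝ (Fin n)) ℝ :=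
    (ContinuousMultilinearMap.mkPiAlgebra ℝ (Fin k) ℝ).compContinuousLinearMap
      fun l => EuclideanSpace.proj (I l)
  have hM : monomialAt 0 I = fun y => M fun _ => y := by
    funext y
    simp [M, monomialAt]
  have hM_single (σ : Equiv.Perm (Fin k)) :
      M (fun l => EuclideanSpace.single (J (σ l)) 1) = if J ∘ σ = I then 1 else 0 := by
    have hprod : M (fun l => EuclideanSpace.single (J (σ l)) 1) =
        ∏ l, if J (σ l) = I l then (1 : ℝ) else 0 := by
      simp [M, eq_comm]
    rw [hprod, Finset.prod_ite_zero, Finset.prod_const_one]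
    simp only [funext_iff, Function.comp, Finset.mem_univ, true_imp_iff]
  rw [iteratedFDeriv_monomialAt, hM, M.iteratedFDeriv_comp_diagonal]
  simp only [hM_single, Finset.sum_boole, Fintype.card_subtype]

theorem iteratedFDeriv_monomialAt_jetIdx {r : ℕ} (y₀ : EuclideanSpace ℝ (Fin n))
    {p q : JetIdx n r} (hpq : q ≠ p) :
    iteratedFDeriv ℝ q.1 (monomialAt y₀ p.2.1) y₀ (fun l => EuclideanSpace.single (q.2.1 l) 1) =
      0 := by
  obtain ⟨k, I, hI⟩ := p
  obtain ⟨j, J, hJ⟩ := q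
  rcases eq_or_ne j k with rfl | hjk
  · rw [iteratedFDeriv_monomialAt_apply_single, Nat.cast_eq_zero, Fintype.card_eq_zero_iff]
    refine ⟨fun ⟨σ, hσ⟩ => hpq ?_⟩
    have hJI : J ∘ σ = J :=
      Tuple.unique_monotone (τ := 1) (by rwa [hσ]) (by simpa using hJ)
    obtain rfl : J = I := hJI.symm.trans hσ
    rfl
  · rw [iteratedFDeriv_monomialAt_of_ne y₀ I fun h => hjk (Fin.ext h)]
    rfl

theorem exists_contDiff_iteratedFDeriv_eq {r : ℕ} (y₀ : EuclideanSpace ℝ (Fin n))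
    (v : JetIdx n r → ℝ) : ∃ f : EuclideanSpace ℝ (Fin n) → ℝ, ContDiff ℝ ∞ f ∧
      ∀ q : JetIdx n r, iteratedFDeriv ℝ q.1 f y₀ (fun l => EuclideanSpace.single (q.2.1 l) 1) =
        v q := by
  set N : JetIdx n r → ℝ := fun p =>
    Fintype.card {σ : Equiv.Perm (Fin p.1) // p.2.1 ∘ σ = p.2.1}
  have hN (p : JetIdx n r) : N p ≠ 0 :=
    Nat.cast_ne_zero.2 (Fintype.card_pos_iff.2 ⟨1, rfl⟩).ne'
  have hsmooth (p : JetIdx n r) := contDiff_monomialAt y₀ p.2.1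
  refine ⟨fun y => ∑ p, (v p / N p) • monomialAt y₀ p.2.1 y,
    ContDiff.sum fun p _ => (hsmooth p).const_smul _, fun q => ?_⟩
  have hle : ((q.1 : ℕ) : ℕ∞ω) ≤ ∞ := by exact_mod_cast le_top
  rw [iteratedFDeriv_fun_sum_apply fun p _ =>
    ((hsmooth p).const_smul _).contDiffAt.of_le hle]
  have hsmul (p : JetIdx n r) := iteratedFDeriv_const_smul_apply' (a := v p / N p)
    ((hsmooth p).contDiffAt (x := y₀).of_le hle)
  simp only [hsmul, sum_apply, smul_apply]
  rw [Finset.sum_eq_single q (fun p _ hpq => by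
    rw [iteratedFDeriv_monomialAt_jetIdx y₀ hpq.symm, smul_zero]) (by simp),
    iteratedFDeriv_monomialAt_apply_single, smul_eq_mul, div_mul_cancel₀ _ (hN q)]

end Polynomials

section SmoothTransitions

variable {n m k : ℕ} {X : Type u} [TopologicalSpace X] [ChartedSpace (EuclideanQuadrant n) X]
  {W : X → Type u} [∀ x, AddCommGroup (W x)] [∀ x, Module ℝ (W x)]
  [TopologicalSpace (TotalSpace (EuclideanSpace ℝ (Fin m)) W)] [∀ x, TopologicalSpace (W x)]
  [FiberBundle (EuclideanSpace ℝ (Fin m)) W] {ι : Type} [Fintype ι]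

/-- `E R`, for the bodies `R`, are the restrictions of a smooth vector bundle of rank `|ι|`: their
fibre coordinates are linear isomorphisms over `R`, and change between charts by smooth matrices
which are the same for all bodies. -/
structure HasSmoothTransitions (E : Body n X → CoordBundle n m W ι) : Prop where
  exists_transition : ∀ a b : VBChart n m W, ∃ T : ι → ι → X → ℝ,
    (∀ c d, SmoothOn n ∞ (T c d) (a.dom ∩ b.dom)) ∧
    ∀ (R : Body n X), ∀ x ∈ (a.dom ∩ b.dom) ∩ R.carrier, ∀ ξ c,
      (E R).coord b x ξ c = ∑ d, T c d x * (E R).coord a x ξ d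
  bijective : ∀ (R : Body n X) (a : VBChart n m W), ∀ x ∈ a.dom ∩ R.carrier,
    Function.Bijective ((E R).coord a x)

theorem VBChart.smoothOn_triv_symm_single (a b : VBChart n m W) (c d : Fin m) :
    SmoothOn n ∞ (fun x => (b.triv ⟨x, a.triv.symm x (EuclideanSpace.single d 1)⟩).2 c)
      (a.dom ∩ b.dom) := by
  have hsymm : ContMDiffOn (quadrant n) ((quadrant n).prod 𝓘(ℝ, EuclideanSpace ℝ (Fin m))) ∞
      (fun x => a.triv.toOpenPartialHomeomorph.symm (x, EuclideanSpace.single d 1))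
      (a.dom ∩ b.dom) :=
    a.contMDiffOn_triv_symm.comp (contMDiffOn_id.prodMk contMDiffOn_const)
      fun _ hx => a.triv.mem_target.2 hx.1.2
  have htriv := b.contMDiffOn_triv.comp hsymm fun x hx => by
    refine b.triv.mem_source.2 ?_
    rw [a.triv.proj_symm_apply (a.triv.mem_target.2 hx.1.2)]
    exact hx.2.2
  have hcoord := (EuclideanSpace.proj (𝕜 := ℝ) c).contMDiff (n := ∞) |>.comp_contMDiffOn
    ((contMDiff_snd (I := quadrant n) (J := 𝓘(ℝ, EuclideanSpace ℝ (Fin m)))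
      (n := ∞)).comp_contMDiffOn htriv)
  refine hcoord.congr fun x hx => ?_
  simp only [Function.comp, ← a.triv.mk_symm hx.1.2 (EuclideanSpace.single d (1 : ℝ))]
  rfl

theorem VBChart.linearMapAt_eq_sum (a b : VBChart n m W) {x : X} (hx : x ∈ a.dom ∩ b.dom)
    (ξ : W x) (c : Fin m) :
    haveI := a.isLinear
    haveI := b.isLinear
    b.triv.linearMapAt ℝ x ξ c = ∑ d, (b.triv ⟨x, a.triv.symm x (EuclideanSpace.single d 1)⟩).2 c *
      a.triv.linearMapAt ℝ x ξ d := by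
  have := a.isLinear
  have := b.isLinear
  have hbasis : ξ = ∑ d, (a.triv.linearMapAt ℝ x ξ d) •
      a.triv.symmₗ ℝ x (EuclideanSpace.single d (1 : ℝ)) := by
    conv_lhs => rw [← a.triv.symmₗ_linearMapAt (R := ℝ) hx.1.2 ξ]
    simp only [← map_smul, ← map_sum]
    congr 1
    ext d
    simp [Pi.single_apply]
  conv_lhs => rw [hbasis]
  simp only [map_sum, map_smul, WithLp.ofLp_sum, WithLp.ofLp_smul, Finset.sum_apply,
    Pi.smul_apply, smul_eq_mul]
  refine Finset.sum_congr rfl fun d _ => ?_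
  rw [mul_comm, b.triv.coe_linearMapAt_of_mem hx.2.2, a.triv.coe_symmₗ]
  exact hx.1.2

theorem hasSmoothTransitions_baseBundle :
    HasSmoothTransitions fun _ : Body n X => baseBundle n m W where
  exists_transition a b := ⟨fun c d x =>
    (b.triv ⟨x, a.triv.symm x (EuclideanSpace.single d 1)⟩).2 c, a.smoothOn_triv_symm_single b,
      fun _ _ hx => a.linearMapAt_eq_sum b hx.1⟩
  bijective R a x hx := by
    have := a.isLinear
    have hlin : Function.Bijective (a.triv.linearMapAt ℝ x) :=
      Function.bijective_iff_has_inverse.2 ⟨a.triv.symmₗ ℝ x,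
        a.triv.symmₗ_linearMapAt hx.1.2, a.triv.linearMapAt_symmₗ hx.1.2⟩
    exact (EuclideanSpace.equiv (Fin m) ℝ).bijective.comp hlin

namespace HasSmoothTransitions

variable {E : Body n X → CoordBundle n m W ι} {R : Body n X} {s : ∀ x, (E R).Fib x}

/-- The transition matrices from the fibre coordinates of the chart `a` to those of `b`. -/
def transition (hE : HasSmoothTransitions E) (a b : VBChart n m W) : ι → ι → X → ℝ :=
  (hE.exists_transition a b).choose

theorem smoothOn_transition (hE : HasSmoothTransitions E) (a b : VBChart n m W) (c d : ι) :
    SmoothOn n ∞ (hE.transition a b c d) (a.dom ∩ b.dom) :=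
  (hE.exists_transition a b).choose_spec.1 c d

theorem coord_eq_sum (hE : HasSmoothTransitions E) (a b : VBChart n m W) {x : X}
    (hx : x ∈ (a.dom ∩ b.dom) ∩ R.carrier) (ξ : (E R).Fib x) (c : ι) :
    (E R).coord b x ξ c = ∑ d, hE.transition a b c d x * (E R).coord a x ξ d :=
  (hE.exists_transition a b).choose_spec.2 R x hx ξ c

theorem comp_eq_sum (hE : HasSmoothTransitions E) (a b : VBChart n m W) {x : X}
    (hx : x ∈ (a.dom ∩ b.dom) ∩ R.carrier) (c : ι) :
    (E R).comp b s c x = ∑ d, hE.transition a b c d x * (E R).comp a s d x :=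
  hE.coord_eq_sum a b hx (s x) c

theorem mem_sec_of_support_subset (hE : HasSmoothTransitions E) (a : VBChart n m W) {C : Set X}
    (hC : IsClosed C) (hCa : C ⊆ a.dom) (hs0 : ∀ x ∉ C ∩ R.carrier, s x = 0)
    (hs : ∀ c, SmoothOn n k ((E R).comp a s c) (a.dom ∩ R.carrier)) : s ∈ (E R).Sec R k := by
  refine ((E R).mem_sec_iff R s).2 ⟨fun x hx => hs0 x fun h => hx h.2, fun b c x hx => ?_⟩
  by_cases hxa : x ∈ a.dom
  · have hsum : SmoothWithinAt n k
        (fun z => ∑ d, hE.transition a b c d z * (E R).comp a s d z) R.carrier x :=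
      contMDiffWithinAt_finsetSum fun d _ =>
        (((hE.smoothOn_transition a b c d x ⟨hxa, hx.1⟩).contMDiffAt ((a.isOpen_dom.inter
          b.isOpen_dom).mem_nhds ⟨hxa, hx.1⟩)).of_le
            (by exact_mod_cast le_top)).contMDiffWithinAt.mul
          ((hs d).smoothWithinAt a.isOpen_dom ⟨hxa, hx.2⟩ le_rfl)
    refine (hsum.congr_of_eventuallyEq ?_ (hE.comp_eq_sum a b ⟨⟨hxa, hx.1⟩, hx.2⟩ c)).mono
      inter_subset_right
    filter_upwards [mem_nhdsWithin_of_mem_nhds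
      ((a.isOpen_dom.inter b.isOpen_dom).mem_nhds ⟨hxa, hx.1⟩), self_mem_nhdsWithin] with z hz hzR
    exact hE.comp_eq_sum a b ⟨hz, hzR⟩ c
  · have hcomp : ∀ z ∉ C, (E R).comp b s c z = 0 := fun z hz => by
      rw [CoordBundle.comp, hs0 z fun h => hz h.1, map_zero]; rfl
    have hxC : x ∉ C := fun h => hxa (hCa h)
    exact (contMDiffWithinAt_const (c := (0 : ℝ))).congr_of_eventuallyEq
      (mem_nhdsWithin_of_mem_nhds (Filter.mem_of_superset (hC.isOpen_compl.mem_nhds hxC) hcomp))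
      (hcomp x hxC)

theorem exists_sec_of_comp (hE : HasSmoothTransitions E) (R : Body n X) (a : VBChart n m W)
    {f : ι → X → ℝ} {C : Set X} (hC : IsClosed C) (hCa : C ⊆ a.dom) (hf0 : ∀ c, ∀ x ∉ C, f c x = 0)
    (hf : ∀ c, SmoothOn n k (f c) (a.dom ∩ R.carrier)) :
    ∃ s ∈ (E R).Sec R k, (∀ x ∈ a.dom ∩ R.carrier, ∀ c, (E R).comp a s c x = f c x) ∧
      ∀ x ∉ C, s x = 0 := by
  classical
  choose! g hg using fun x (hx : x ∈ a.dom ∩ R.carrier) => (hE.bijective R a x hx).2 (f · x)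
  set s : ∀ x, (E R).Fib x := fun x => if x ∈ a.dom ∩ R.carrier then g x else 0 with hs
  have hcoord : ∀ x ∈ a.dom ∩ R.carrier, (E R).coord a x (s x) = (f · x) := fun x hx => by
    simp only [hs, if_pos hx, hg x hx]
  have hcomp : ∀ x ∈ a.dom ∩ R.carrier, ∀ c, (E R).comp a s c x = f c x := fun x hx =>
    congrFun (hcoord x hx)
  have hs0 : ∀ x ∉ C ∩ R.carrier, s x = 0 := fun x hx => by
    by_cases hxa : x ∈ a.dom ∩ R.carrier
    · refine (hE.bijective R a x hxa).1 ?_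
      rw [hcoord x hxa, map_zero]
      exact funext fun c => hf0 c x fun hxC => hx ⟨hxC, hxa.2⟩
    · simp only [hs, if_neg hxa]
  exact ⟨s, hE.mem_sec_of_support_subset a hC hCa hs0 fun c =>
    (hf c).congr fun x hx => hcomp x hx c, hcomp, fun x hx => hs0 x fun h => hx h.1⟩

end HasSmoothTransitions

end SmoothTransitions

section DiffOps

variable {n m j k : ℕ} {X : Type u} [TopologicalSpace X] [ChartedSpace (EuclideanQuadrant n) X]
  {W : X → Type u} [∀ x, AddCommGroup (W x)] [∀ x, Module ℝ (W x)]
  [TopologicalSpace (TotalSpace (EuclideanSpace ℝ (Fin m)) W)] [∀ x, TopologicalSpace (W x)]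
  [FiberBundle (EuclideanSpace ℝ (Fin m)) W] {ι : Type}

/-- The non-decreasing rearrangement of a multi-index of order at most `k`. -/
def JetIdx.sort (hj : j ≤ k) (I : Fin j → Fin n) : JetIdx n k :=
  ⟨⟨j, Nat.lt_succ_of_le hj⟩, I ∘ Tuple.sort I, Tuple.monotone_sort I⟩

namespace VBChart

theorem pd_sort (a : VBChart n m W) (R : Body n X) (hj : j ≤ k) (I : Fin j → Fin n) {f : X → ℝ}
    (hf : SmoothOn n (k : ℕ) f (a.dom ∩ R.carrier)) {x : X} (hx : x ∈ a.dom ∩ R.carrier) :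
    a.pd R.carrier (JetIdx.sort hj I).2.1 f x = a.pd R.carrier I f x :=
  a.pd_comp_perm R I (hf.of_le (by exact_mod_cast hj)) hx _

theorem dpd_mul_pd (b a : VBChart n m W) {R : Body n X} (i : Fin n) (I : Fin k → Fin n)
    {f g : X → ℝ} {x : X} (hg : SmoothWithinAt n 1 g univ x)
    (hf : SmoothOn n (k + 1 : ℕ) f (a.dom ∩ R.carrier))
    (hx : x ∈ (b.dom ∩ a.dom) ∩ R.carrier) :
    b.dpd R.carrier i (fun z => g z * a.pd R.carrier I f z) x =
      b.dpd univ i g x * a.pd R.carrier I f x + g x * ∑ l, b.dpd univ i (a.coordFun l) x *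
        a.pd R.carrier (Fin.cons l I : Fin (k + 1) → Fin n) f x := by
  have hxa : x ∈ a.dom ∩ R.carrier := ⟨hx.1.2, hx.2⟩
  have hxb : x ∈ b.dom ∩ R.carrier := ⟨hx.1.1, hx.2⟩
  have hcoord (l : Fin n) : SmoothWithinAt n 1 (a.coordFun l) univ x :=
    (((a.smoothOn_coordFun l x hxa.1).contMDiffAt (a.isOpen_dom.mem_nhds hxa.1)).of_le
      (by simp)).contMDiffWithinAt
  have hpd : SmoothWithinAt n 1 (a.pd R.carrier I f) R.carrier x :=
    SmoothOn.smoothWithinAt (a.smoothOn_pd R I hf (Nat.add_comm 1 k).le) a.isOpen_dom hxa le_rfl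
  rw [b.dpd_mul R _ (hg.mono (subset_univ _)) hpd hxb, b.dpd_restrict R _ hg hxb,
    a.dpd_change b R _ hpd ⟨hx.1.symm, hx.2⟩]
  refine congrArg₂ (· + ·) rfl (congrArg _ (Finset.sum_congr rfl fun l _ => ?_))
  rw [a.pd_succ R (Fin.cons l I) (SmoothOn.smoothWithinAt hf a.isOpen_dom hxa le_rfl) hxa,
    b.dpd_restrict R _ (hcoord l) hxb]
  rfl

variable [Fintype ι] {V : Set X} {a : VBChart n m W} {D D' : Body n X → (ι → X → ℝ) → X → ℝ}

/-- `D` is on `V`, for the functions of class `C^k` on the bodies, a linear differential operator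
of order at most `k`, whose smooth coefficients in the chart `a` are the same for all bodies. -/
def IsDiffOp (a : VBChart n m W) (V : Set X) (k : ℕ) (D : Body n X → (ι → X → ℝ) → X → ℝ) :
    Prop :=
  ∃ q : JetIdx n k × ι → X → ℝ, (∀ p, SmoothOn n ∞ (q p) V) ∧
    ∀ (R : Body n X) (f : ι → X → ℝ), (∀ c, SmoothOn n (k : ℕ) (f c) (a.dom ∩ R.carrier)) →
      ∀ x ∈ V ∩ R.carrier, D R f x = ∑ p, q p x * a.pd R.carrier p.1.2.1 (f p.2) x

theorem isDiffOp_pd (hV : V ⊆ a.dom) (hj : j ≤ k) (I : Fin j → Fin n) (c : ι) :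
    a.IsDiffOp V k fun R f x => a.pd R.carrier I (f c) x := by
  classical
  refine ⟨fun p _ => if p = (JetIdx.sort hj I, c) then 1 else 0, fun p => contMDiffOn_const,
    fun R f hf x hx => ?_⟩
  simp only [ite_mul, one_mul, zero_mul, Finset.sum_ite_eq', Finset.mem_univ, if_true]
  exact (a.pd_sort R hj I (hf c) ⟨hV hx.1, hx.2⟩).symm

namespace IsDiffOp

theorem congr (hD : a.IsDiffOp V k D) (h : ∀ (R : Body n X) (f : ι → X → ℝ),
    (∀ c, SmoothOn n (k : ℕ) (f c) (a.dom ∩ R.carrier)) →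
      ∀ x ∈ V ∩ R.carrier, D' R f x = D R f x) : a.IsDiffOp V k D' := by
  obtain ⟨q, hq, hDq⟩ := hD
  exact ⟨q, hq, fun R f hf x hx => (h R f hf x hx).trans (hDq R f hf x hx)⟩

theorem sum {P : Type*} [Fintype P] {D : P → Body n X → (ι → X → ℝ) → X → ℝ}
    (hD : ∀ p, a.IsDiffOp V k (D p)) : a.IsDiffOp V k fun R f x => ∑ p, D p R f x := by
  choose q hq hDq using hD
  refine ⟨fun p' x => ∑ p, q p p' x, fun p' => contMDiffOn_finsetSum fun p _ => hq p p',
    fun R f hf x hx => ?_⟩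
  simp only [fun p => hDq p R f hf x hx, Finset.sum_mul]
  exact Finset.sum_comm

theorem add (hD : a.IsDiffOp V k D) (hD' : a.IsDiffOp V k D') :
    a.IsDiffOp V k fun R f x => D R f x + D' R f x := by
  obtain ⟨q, hq, hDq⟩ := hD
  obtain ⟨q', hq', hDq'⟩ := hD'
  refine ⟨fun p x => q p x + q' p x, fun p => (hq p).add (hq' p), fun R f hf x hx => ?_⟩
  simp only [hDq R f hf x hx, hDq' R f hf x hx, add_mul, Finset.sum_add_distrib]

theorem mul {g : X → ℝ} (hD : a.IsDiffOp V k D) (hg : SmoothOn n ∞ g V) :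
    a.IsDiffOp V k fun R f x => g x * D R f x := by
  obtain ⟨q, hq, hDq⟩ := hD
  refine ⟨fun p x => g x * q p x, fun p => hg.mul (hq p), fun R f hf x hx => ?_⟩
  simp only [hDq R f hf x hx, Finset.mul_sum, mul_assoc]

theorem dpd [IsManifold (quadrant n) ∞ X] [CompactSpace X] {b : VBChart n m W} (hV : IsOpen V)
    (hVab : V ⊆ a.dom ∩ b.dom) (i : Fin n) (hD : a.IsDiffOp V k D) :
    a.IsDiffOp V (k + 1) fun R f x => b.dpd R.carrier i (D R f) x := by
  have hVa : V ⊆ a.dom := hVab.trans inter_subset_left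
  have hVb : V ⊆ b.dom := hVab.trans inter_subset_right
  obtain ⟨q, hq, hDq⟩ := hD
  have hdq (p) := b.smoothOn_dpd i hV hVb (hq p)
  have hdcoord (l : Fin n) := b.smoothOn_dpd i hV hVb ((a.smoothOn_coordFun l).mono hVa)
  have hk (p : JetIdx n k) : (p.1 : ℕ) ≤ k := Nat.lt_succ_iff.1 p.1.2
  refine congr (sum fun p : JetIdx n k × ι =>
    ((isDiffOp_pd hVa ((hk p.1).trans k.le_succ) p.1.2.1 p.2).mul (hdq p)).add
      ((sum fun l : Fin n => (isDiffOp_pd hVa (Nat.succ_le_succ (hk p.1))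
        (Fin.cons l p.1.2.1) p.2).mul (hdcoord l)).mul (hq p))) fun R f hf x hx => ?_
  have hxa : x ∈ a.dom ∩ R.carrier := ⟨hVa hx.1, hx.2⟩
  have hxb : x ∈ b.dom ∩ R.carrier := ⟨hVb hx.1, hx.2⟩
  have hqx (p) : SmoothWithinAt n 1 (q p) univ x :=
    (((hq p x hx.1).contMDiffAt (hV.mem_nhds hx.1)).of_le (by simp)).contMDiffWithinAt
  have hfx (p : JetIdx n k × ι) : SmoothOn n (p.1.1 + 1 : ℕ) (f p.2) (a.dom ∩ R.carrier) :=
    (hf p.2).of_le (by exact_mod_cast Nat.succ_le_succ (hk p.1))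
  have hgerm : D R f =ᶠ[𝓝[R.carrier] x]
      fun z => ∑ p, q p z * a.pd R.carrier p.1.2.1 (f p.2) z := by
    filter_upwards [mem_nhdsWithin_of_mem_nhds (hV.mem_nhds hx.1), self_mem_nhdsWithin]
      with z hz hzR
    exact hDq R f (fun c => (hf c).of_le (by exact_mod_cast k.le_succ)) z ⟨hz, hzR⟩
  rw [b.dpd_congr_of_eventuallyEq _ _ hgerm hxb,
    b.dpd_sum R _ _ (f := fun p z => q p z * a.pd R.carrier p.1.2.1 (f p.2) z)
      (fun p => ((hqx p).mono (subset_univ _)).mul (SmoothOn.smoothWithinAt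
        (a.smoothOn_pd R p.1.2.1 (hfx p) (Nat.add_comm 1 _).le) a.isOpen_dom hxa le_rfl)) hxb]
  exact Finset.sum_congr rfl fun p _ => b.dpd_mul_pd a i p.1.2.1 (hqx p) (hfx p) ⟨⟨hxb.1, hxa.1⟩,
    hx.2⟩

end IsDiffOp

end VBChart

theorem HasSmoothTransitions.isDiffOp_pd [Fintype ι] [IsManifold (quadrant n) ∞ X]
    [CompactSpace X] {E : Body n X → CoordBundle n m W ι} (hE : HasSmoothTransitions E)
    (a b : VBChart n m W) (J : Fin k → Fin n) (c : ι) : a.IsDiffOp (a.dom ∩ b.dom) k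
      fun R f => b.pd R.carrier J fun x => ∑ d, hE.transition a b c d x * f d x := by
  induction k with
  | zero =>
    refine (VBChart.IsDiffOp.sum fun d => (VBChart.isDiffOp_pd inter_subset_left le_rfl J
      d).mul (hE.smoothOn_transition a b c d)).congr fun R f _ x hx => ?_
    simp only [b.pd_zero _ _ _ hx.1.2, a.pd_zero _ _ _ hx.1.1]
  | succ k ih =>
    have hab := a.isOpen_dom.inter b.isOpen_dom
    refine ((ih (Fin.tail J)).dpd hab subset_rfl (J 0)).congr fun R f hf x hx => ?_
    refine b.pd_succ R J (contMDiffWithinAt_finsetSum fun d _ => ContMDiffWithinAt.mul ?_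
      (SmoothOn.smoothWithinAt (hf d) a.isOpen_dom ⟨hx.1.1, hx.2⟩ le_rfl)) ⟨hx.1.2, hx.2⟩
    exact (((hE.smoothOn_transition a b c d x hx.1).contMDiffAt (hab.mem_nhds hx.1)).of_le
      (by exact_mod_cast le_top)).contMDiffWithinAt

end DiffOps

section Jets

variable {n m k r : ℕ} {X : Type u} [TopologicalSpace X] [ChartedSpace (EuclideanQuadrant n) X]
  {W : X → Type u} [∀ x, AddCommGroup (W x)] [∀ x, Module ℝ (W x)]
  [TopologicalSpace (TotalSpace (EuclideanSpace ℝ (Fin m)) W)] [∀ x, TopologicalSpace (W x)]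
  [FiberBundle (EuclideanSpace ℝ (Fin m)) W] {ι : Type}

theorem exists_bump [IsManifold (quadrant n) ∞ X] [CompactSpace X] [T2Space X] {x : X} {U : Set X}
    (hU : U ∈ 𝓝 x) : ∃ (ρ : X → ℝ) (C : Set X), IsClosed C ∧ C ⊆ U ∧ SmoothOn n ∞ ρ univ ∧
      (∀ᶠ z in 𝓝 x, ρ z = 1) ∧ (∀ z ∉ C, ρ z = 0) ∧ ∀ z, ρ z ∈ Icc (0 : ℝ) 1 := by
  obtain ⟨C, hCx, hC, hCU⟩ := exists_mem_nhds_isClosed_subset hU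
  obtain ⟨ρ, hρ1, hρ0, hρ01⟩ := exists_contMDiffMap_one_nhds_of_subset_interior (quadrant n)
    (n := ⊤) (isClosed_singleton (x := x))
    (singleton_subset_iff.2 (mem_interior_iff_mem_nhds.2 hCx))
  rw [nhdsSet_singleton] at hρ1
  exact ⟨ρ, C, hC, hCU, ρ.contMDiff.contMDiffOn, hρ1, hρ0, hρ01⟩

namespace VBChart

theorem smoothOn_comp_ext (a : VBChart n m W) {P : EuclideanSpace ℝ (Fin n) → ℝ}
    (hP : ContDiff ℝ ∞ P) : SmoothOn n ∞ (fun x => P (a.ext x)) a.dom := by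
  rw [← inter_univ a.dom, a.smoothOn_iff le_rfl]
  refine hP.contDiffOn.congr fun y hy => ?_
  simp only [Function.comp, a.ext_inv hy]

theorem pd_comp_ext (a : VBChart n m W) (R : Body n X) (I : Fin k → Fin n)
    {P : EuclideanSpace ℝ (Fin n) → ℝ} (hP : ContDiff ℝ k P) {x : X} (hx : x ∈ a.dom ∩ R.carrier) :
    a.pd R.carrier I (fun z => P (a.ext z)) x =
      iteratedFDeriv ℝ k P (a.ext x) fun l => EuclideanSpace.single (I l) 1 := by
  have hcongr : EqOn ((fun z => P (a.ext z)) ∘ a.inv) P (a.img R.carrier) := fun y hy => by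
    simp only [Function.comp, a.ext_inv hy]
  rw [pd, partialWithin, iteratedFDerivWithin_congr hcongr (a.ext_mem hx),
    iteratedFDerivWithin_eq_iteratedFDeriv (a.uniqueDiffOn_img R) hP.contDiffAt (a.ext_mem hx)]

theorem exists_jet [IsManifold (quadrant n) ∞ X] [CompactSpace X] [T2Space X]
    (a : VBChart n m W) {x : X} (hx : x ∈ a.dom) (v : JetIdx n r × ι → ℝ) :
    ∃ (f : ι → X → ℝ) (C : Set X), IsClosed C ∧ C ⊆ a.dom ∧ (∀ c, ∀ z ∉ C, f c z = 0) ∧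
      (∀ c, SmoothOn n ∞ (f c) a.dom) ∧ ∀ (R : Body n X), x ∈ R.carrier →
        ∀ p, a.pd R.carrier p.1.2.1 (f p.2) x = v p := by
  obtain ⟨ρ, C, hC, hCa, hρ, hρ1, hρ0, -⟩ := exists_bump (n := n) (a.isOpen_dom.mem_nhds hx)
  choose P hP hPv using fun c =>
    exists_contDiff_iteratedFDeriv_eq (r := r) (a.ext x) fun p => v (p, c)
  refine ⟨fun c z => ρ z * P c (a.ext z), C, hC, hCa,
    fun c z hz => mul_eq_zero_of_left (hρ0 z hz) _,
    fun c => (hρ.mono (subset_univ _)).mul (a.smoothOn_comp_ext (hP c)), fun R hxR p => ?_⟩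
  have hgerm : (fun z => ρ z * P p.2 (a.ext z)) =ᶠ[𝓝[R.carrier] x] fun z => P p.2 (a.ext z) := by
    filter_upwards [mem_nhdsWithin_of_mem_nhds hρ1] with z hz
    rw [hz, one_mul]
  rw [a.pd_congr_of_eventuallyEq _ hgerm ⟨hx, hxR⟩,
    a.pd_comp_ext R _ ((hP p.2).of_le (by exact_mod_cast le_top)) ⟨hx, hxR⟩, hPv]

theorem IsDiffOp.mono [Fintype ι] {a : VBChart n m W} {V : Set X} (hV : V ⊆ a.dom)
    {D : Body n X → (ι → X → ℝ) → X → ℝ} (hD : a.IsDiffOp V k D) (hk : k ≤ r) :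
    a.IsDiffOp V r D := by
  obtain ⟨q, hq, hDq⟩ := hD
  exact (IsDiffOp.sum fun p => (isDiffOp_pd hV ((Nat.lt_succ_iff.1 p.1.1.2).trans hk) p.1.2.1
    p.2).mul (hq p)).congr fun R f hf x hx =>
      hDq R f (fun c => (hf c).of_le (by exact_mod_cast hk)) x hx

end VBChart

namespace HasSmoothTransitions

variable [Fintype ι] [IsManifold (quadrant n) ∞ X] [CompactSpace X]
  {E : Body n X → CoordBundle n m W ι}

theorem exists_jetBundle_transition (hE : HasSmoothTransitions E) (r : ℕ) (a b : VBChart n m W) :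
    ∃ T : JetIdx n r × ι → JetIdx n r × ι → X → ℝ,
      (∀ p q, SmoothOn n ∞ (T p q) (a.dom ∩ b.dom)) ∧
      ∀ (R : Body n X), ∀ x ∈ (a.dom ∩ b.dom) ∩ R.carrier, ∀ ξ p,
        ((E R).jetBundle R r).coord b x ξ p =
          ∑ q, T p q x * ((E R).jetBundle R r).coord a x ξ q := by
  choose T hT hTsum using fun p : JetIdx n r × ι => (hE.isDiffOp_pd a b p.1.2.1 p.2).mono
    inter_subset_left (Nat.lt_succ_iff.1 p.1.1.2)
  refine ⟨T, hT, fun R x hx ξ p => ?_⟩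
  obtain ⟨s, rfl⟩ := Submodule.Quotient.mk_surjective _ ξ
  have hgerm : (E R).comp b s.1 p.2 =ᶠ[𝓝[R.carrier] x]
      fun z => ∑ d, hE.transition a b p.2 d z * (E R).comp a s.1 d z := by
    filter_upwards [mem_nhdsWithin_of_mem_nhds ((a.isOpen_dom.inter b.isOpen_dom).mem_nhds hx.1),
      self_mem_nhdsWithin] with z hz hzR
    exact hE.comp_eq_sum a b ⟨hz, hzR⟩ p.2
  rw [(E R).jetBundle_coord_mk R r b ⟨hx.1.2, hx.2⟩,
    b.pd_congr_of_eventuallyEq _ hgerm ⟨hx.1.2, hx.2⟩]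
  refine (hTsum p R (fun d => (E R).comp a s.1 d) (CoordBundle.Sec.smoothOn s a) x hx).trans ?_
  exact Finset.sum_congr rfl fun q _ => by
    rw [(E R).jetBundle_coord_mk R r a ⟨hx.1.1, hx.2⟩]

theorem injective_jetBundle_coord (hE : HasSmoothTransitions E) (r : ℕ) (R : Body n X)
    (a : VBChart n m W) {x : X} (hx : x ∈ a.dom ∩ R.carrier) :
    Function.Injective (((E R).jetBundle R r).coord a x) := by
  rw [← LinearMap.ker_eq_bot, LinearMap.ker_eq_bot']
  intro ξ hξ
  obtain ⟨s, rfl⟩ := Submodule.Quotient.mk_surjective _ ξ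
  refine (Submodule.Quotient.mk_eq_zero _).2 ?_
  simp only [CoordBundle.vanishing, Submodule.mem_iInf]
  refine fun b hxb => LinearMap.mem_ker.2 (funext fun p => ?_)
  obtain ⟨T, -, hT⟩ := hE.exists_jetBundle_transition r a b
  have hcoord := hT R x ⟨⟨hx.1, hxb.1⟩, hx.2⟩ (Submodule.Quotient.mk s) p
  rw [(E R).jetBundle_coord_mk R r b hxb, hξ] at hcoord
  exact hcoord.trans (by simp)

variable [T2Space X]

theorem surjective_jetBundle_coord (hE : HasSmoothTransitions E) (r : ℕ) (R : Body n X)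
    (a : VBChart n m W) {x : X} (hx : x ∈ a.dom ∩ R.carrier) :
    Function.Surjective (((E R).jetBundle R r).coord a x) := by
  intro v
  obtain ⟨f, C, hC, hCa, hf0, hf, hfv⟩ := a.exists_jet hx.1 v
  obtain ⟨s, hs, hsf, -⟩ := hE.exists_sec_of_comp (k := r) R a hC hCa hf0
    fun c => ((hf c).of_le (by exact_mod_cast le_top)).mono inter_subset_left
  refine ⟨Submodule.Quotient.mk ⟨s, hs⟩, funext fun p => ?_⟩
  rw [(E R).jetBundle_coord_mk R r a hx, ← hfv R hx.2 p]
  refine a.pd_congr_of_eventuallyEq _ ?_ hx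
  filter_upwards [mem_nhdsWithin_of_mem_nhds (a.isOpen_dom.mem_nhds hx.1), self_mem_nhdsWithin]
    with z hz hzR
  exact hsf z ⟨hz, hzR⟩ p.2

theorem jetBundle (hE : HasSmoothTransitions E) (r : ℕ) :
    HasSmoothTransitions fun R => (E R).jetBundle R r where
  exists_transition := hE.exists_jetBundle_transition r
  bijective R a _ hx := ⟨hE.injective_jetBundle_coord r R a hx,
    hE.surjective_jetBundle_coord r R a hx⟩

end HasSmoothTransitions

variable [IsManifold (quadrant n) ∞ X] [CompactSpace X] [T2Space X]

theorem hasSmoothTransitions_jetB (r : ℕ) :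
    HasSmoothTransitions fun R : Body n X => jetB m W R r :=
  hasSmoothTransitions_baseBundle.jetBundle r

theorem hasSmoothTransitions_iterJetB (r : ℕ) :
    HasSmoothTransitions fun R : Body n X => iterJetB m W R r := by
  induction r with
  | zero => exact hasSmoothTransitions_baseBundle
  | succ r ih => exact ih.jetBundle 1

end Jets

section JetCoordinates

variable {n m j k l r : ℕ} {X : Type u} [TopologicalSpace X] [ChartedSpace (EuclideanQuadrant n) X]
  {W : X → Type u} [∀ x, AddCommGroup (W x)] [∀ x, Module ℝ (W x)]
  [TopologicalSpace (TotalSpace (EuclideanSpace ℝ (Fin m)) W)] [∀ x, TopologicalSpace (W x)]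
  [FiberBundle (EuclideanSpace ℝ (Fin m)) W] {x : X}

theorem comp_jet (R : Body n X) (r : ℕ) (w : CrSec m W R r) (a : VBChart n m W)
    (hx : x ∈ a.dom ∩ R.carrier) (p : JetIdx n r × Fin m) :
    (jetB m W R r).comp a (jet R r w).1 p x =
      a.pd R.carrier p.1.2.1 ((baseBundle n m W).comp a w.1 p.2) x :=
  (baseBundle n m W).jetBundle_coord_mk R r a hx _ p

theorem comp_iterJetAux_succ (R : Body n X) (r : ℕ) (h : k + (r + 1) ≤ l) (w : CrSec m W R l)
    (a : VBChart n m W) (hx : x ∈ a.dom ∩ R.carrier) (p : JetIdx n 1 × IterIdx n m r) :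
    (iterJetB m W R (r + 1)).comp a (iterJetAux R (r + 1) h w).1 p x =
      a.pd R.carrier p.1.2.1 ((iterJetB m W R r).comp a
        (iterJetAux R r (k := k + 1) (by omega) w).1 p.2) x :=
  (iterJetB m W R r).jetBundle_coord_mk R 1 a hx _ p

/-- The local component `θ` of the iterated jets `ĵ^r` is the partial derivative `∂_I` of the
component `α`, in every chart and over every body. -/
def IsIterJetPartial (W : X → Type u) [∀ x, AddCommGroup (W x)] [∀ x, Module ℝ (W x)]
    [TopologicalSpace (TotalSpace (EuclideanSpace ℝ (Fin m)) W)] [∀ x, TopologicalSpace (W x)]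
    [FiberBundle (EuclideanSpace ℝ (Fin m)) W] (r : ℕ) (θ : IterIdx n m r) (I : Fin k → Fin n)
    (α : Fin m) : Prop :=
  ∀ (R : Body n X) {j l : ℕ} (h : j + r ≤ l) (w : CrSec m W R l) (a : VBChart n m W),
    ∀ x ∈ a.dom ∩ R.carrier, (iterJetB m W R r).comp a (iterJetAux R r h w).1 θ x =
      a.pd R.carrier I ((baseBundle n m W).comp a w.1 α) x

namespace IsIterJetPartial

theorem base (I : Fin 0 → Fin n) (α : Fin m) : IsIterJetPartial W 0 α I α :=
  fun R _ _ _ w a _ hx => (a.pd_zero R.carrier I ((baseBundle n m W).comp a w.1 α) hx.1).symm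

variable {θ : IterIdx n m r} {I : Fin k → Fin n} {α : Fin m}

theorem value (hθ : IsIterJetPartial W r θ I α) {p : JetIdx n 1} (hp : (p.1 : ℕ) = 0) :
    IsIterJetPartial W (r + 1) (p, θ) I α := by
  obtain ⟨⟨k', hk'⟩, J⟩ := p
  obtain rfl : k' = 0 := hp
  intro R j l h w a x hx
  rw [comp_iterJetAux_succ R r h w a hx, a.pd_zero _ _ _ hx.1]
  exact hθ R (by omega) w a x hx

theorem derivative (hk : k ≤ r) (hθ : IsIterJetPartial W r θ I α) (i : Fin n) :
    IsIterJetPartial W (r + 1) (⟨1, fun _ => i, fun _ _ _ => le_rfl⟩, θ)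
      (Fin.cons i I : Fin (k + 1) → Fin n) α := by
  intro R j l h w a x hx
  have hw : SmoothWithinAt n (k + 1 : ℕ) ((baseBundle n m W).comp a w.1 α) R.carrier x :=
    SmoothOn.smoothWithinAt (CoordBundle.Sec.smoothOn (E := baseBundle n m W) w a α) a.isOpen_dom
      hx (by exact_mod_cast (by omega : k + 1 ≤ l))
  have hv : SmoothWithinAt n (0 + 1 : ℕ) ((iterJetB m W R r).comp a
      (iterJetAux R r (k := j + 1) (by omega) w).1 θ) R.carrier x :=
    SmoothOn.smoothWithinAt (CoordBundle.Sec.smoothOn _ a θ) a.isOpen_dom hx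
      (by exact_mod_cast (by omega : 0 + 1 ≤ j + 1))
  refine (comp_iterJetAux_succ R r h w a hx _).trans ((a.pd_succ R (fun _ => i) hv hx).trans ?_)
  rw [a.pd_succ R _ hw hx]
  refine a.dpd_congr_of_eventuallyEq _ _ ?_ hx
  filter_upwards [mem_nhdsWithin_of_mem_nhds (a.isOpen_dom.mem_nhds hx.1), self_mem_nhdsWithin]
    with z hz hzR
  rw [a.pd_zero _ _ _ hz]
  exact hθ R (by omega) w a z ⟨hz, hzR⟩

end IsIterJetPartial

theorem exists_isIterJetPartial_of_component (r : ℕ) (θ : IterIdx n m r) :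
    ∃ (k : ℕ) (I : Fin k → Fin n) (α : Fin m), k ≤ r ∧ IsIterJetPartial W r θ I α := by
  induction r with
  | zero => exact ⟨0, Fin.elim0, θ, le_rfl, .base _ θ⟩
  | succ r ih =>
    obtain ⟨k, I, α, hk, hI⟩ := ih θ.2
    obtain ⟨⟨⟨k', hk'⟩, J, hJ⟩, θ⟩ := θ
    obtain rfl | rfl : k' = 0 ∨ k' = 1 := by omega
    · exact ⟨k, I, α, hk.trans r.le_succ, hI.value rfl⟩
    · obtain ⟨i, rfl⟩ : ∃ i, J = fun _ => i := ⟨J 0, funext fun l => by rw [Subsingleton.elim l 0]⟩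
      exact ⟨k + 1, Fin.cons i I, α, Nat.succ_le_succ hk, hI.derivative hk i⟩

theorem exists_isIterJetPartial_of_multiindex (hk : k ≤ r) (I : Fin k → Fin n) (α : Fin m) :
    ∃ θ : IterIdx n m r, IsIterJetPartial W r θ I α := by
  induction r generalizing k with
  | zero =>
    obtain rfl : k = 0 := by omega
    exact ⟨α, .base I α⟩
  | succ r ih =>
    rcases k with _ | k
    · obtain ⟨θ, hθ⟩ := ih r.zero_le I
      exact ⟨(⟨0, Fin.elim0, fun i => i.elim0⟩, θ), hθ.value rfl⟩
    · obtain ⟨θ, hθ⟩ := ih (Nat.le_of_succ_le_succ hk) (Fin.tail I)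
      have hI := hθ.derivative (Nat.le_of_succ_le_succ hk) (I 0)
      rw [Fin.cons_self_tail] at hI
      exact ⟨_, hI⟩

end JetCoordinates

section TestFunctions

variable {X : Type u} [MeasurableSpace X]

/-- Bounded measurable functions: the functions against which measures on `X` are compared. -/
def IsBddMeas (f : X → ℝ) : Prop := Measurable f ∧ ∃ C : ℝ, ∀ x, |f x| ≤ C

theorem IsBddMeas.sub {f g : X → ℝ} (hf : IsBddMeas f) (hg : IsBddMeas g) :
    IsBddMeas fun x => f x - g x := by
  obtain ⟨C, hC⟩ := hf.2
  obtain ⟨D, hD⟩ := hg.2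
  exact ⟨hf.1.sub hg.1, C + D, fun x => (abs_sub _ _).trans (add_le_add (hC x) (hD x))⟩

theorem IsBddMeas.integrable {f : X → ℝ} (hf : IsBddMeas f) (μ : Measure X) [IsFiniteMeasure μ] :
    Integrable f μ := by
  obtain ⟨C, hC⟩ := hf.2
  exact Integrable.of_bound hf.1.aestronglyMeasurable C (Filter.Eventually.of_forall hC)

/-- `Φ` is on the bounded measurable functions `1`-Lipschitz for the `L¹`-seminorm of some finite
measure. This holds for integration against a finite signed measure, and determines `Φ` by its
values on the continuous functions. -/
def HasMajorant (Φ : (X → ℝ) → ℝ) : Prop :=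
  ∃ ν : Measure X, IsFiniteMeasure ν ∧ ∀ f g, IsBddMeas f → IsBddMeas g →
    |Φ f - Φ g| ≤ ∫ x, |f x - g x| ∂ν

namespace HasMajorant

variable {Φ Ψ : (X → ℝ) → ℝ}

theorem zero : HasMajorant fun _ : X → ℝ => 0 :=
  ⟨0, inferInstance, fun f g _ _ => by simp⟩

theorem add (hΦ : HasMajorant Φ) (hΨ : HasMajorant Ψ) : HasMajorant fun f => Φ f + Ψ f := by
  obtain ⟨μ, _, hμ⟩ := hΦ
  obtain ⟨ν, _, hν⟩ := hΨ
  refine ⟨μ + ν, inferInstance, fun f g hf hg => ?_⟩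
  have hi := fun (ν : Measure X) [IsFiniteMeasure ν] => ((hf.sub hg).integrable ν).abs
  rw [integral_add_measure (hi μ) (hi ν), add_sub_add_comm]
  exact (abs_add_le _ _).trans (add_le_add (hμ f g hf hg) (hν f g hf hg))

theorem neg (hΦ : HasMajorant Φ) : HasMajorant fun f => -Φ f := by
  obtain ⟨μ, h, hμ⟩ := hΦ
  refine ⟨μ, h, fun f g hf hg => ?_⟩
  rw [← neg_sub', abs_neg]
  exact hμ f g hf hg

theorem sub (hΦ : HasMajorant Φ) (hΨ : HasMajorant Ψ) : HasMajorant fun f => Φ f - Ψ f := by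
  simpa only [sub_eq_add_neg] using hΦ.add hΨ.neg

theorem sum {P : Type*} (s : Finset P) {Φ : P → (X → ℝ) → ℝ} (hΦ : ∀ p, HasMajorant (Φ p)) :
    HasMajorant fun f => ∑ p ∈ s, Φ p f := by
  classical
  induction s using Finset.induction_on with
  | empty => simpa using zero
  | insert p s hp ih =>
    simp only [Finset.sum_insert hp]
    exact (hΦ p).add ih

end HasMajorant

variable [TopologicalSpace X]

/-- Bounded measurable functions vanishing outside a compact subset of `U`; they are integrable for
all Radon measures on `U`. -/
structure IsTestFun (U : Set X) (f : X → ℝ) : Prop where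
  measurable : Measurable f
  exists_compact : ∃ (K : Set X) (C : ℝ), IsCompact K ∧ K ⊆ U ∧ (∀ x ∉ K, f x = 0) ∧
    ∀ x, |f x| ≤ C

namespace IsTestFun

variable {U V : Set X} {f g : X → ℝ}

theorem isBddMeas (hf : IsTestFun U f) : IsBddMeas f :=
  ⟨hf.measurable, let ⟨_, C, _, _, _, h⟩ := hf.exists_compact; ⟨C, h⟩⟩

theorem mono (hf : IsTestFun U f) (h : U ⊆ V) : IsTestFun V f :=
  ⟨hf.1, let ⟨K, C, hK, hKU, h0, hC⟩ := hf.2; ⟨K, C, hK, hKU.trans h, h0, hC⟩⟩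

theorem bdd_mul (hg : IsBddMeas g) (hf : IsTestFun U f) : IsTestFun U fun x => g x * f x := by
  obtain ⟨K, C, hK, hKU, h0, hC⟩ := hf.2
  obtain ⟨D, hD⟩ := hg.2
  refine ⟨hg.1.mul hf.1, K, D * C, hK, hKU, fun x hx => by rw [h0 x hx, mul_zero], fun x => ?_⟩
  rw [abs_mul]
  exact mul_le_mul (hD x) (hC x) (abs_nonneg _) ((abs_nonneg _).trans (hD x))

theorem zero : IsTestFun U fun _ => 0 :=
  ⟨measurable_const, ∅, 0, isCompact_empty, empty_subset _, fun _ _ => rfl, fun _ => by simp⟩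

theorem add (hf : IsTestFun U f) (hg : IsTestFun U g) : IsTestFun U fun x => f x + g x := by
  obtain ⟨K, C, hK, hKU, h0, hC⟩ := hf.2
  obtain ⟨L, D, hL, hLU, h0', hD⟩ := hg.2
  refine ⟨hf.1.add hg.1, K ∪ L, C + D, hK.union hL, union_subset hKU hLU, fun x hx => ?_,
    fun x => (abs_add_le _ _).trans (add_le_add (hC x) (hD x))⟩
  rw [h0 x fun h => hx (Or.inl h), h0' x fun h => hx (Or.inr h), add_zero]

theorem sum {P : Type*} (s : Finset P) {f : P → X → ℝ} (hf : ∀ p, IsTestFun U (f p)) :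
    IsTestFun U fun x => ∑ p ∈ s, f p x := by
  classical
  induction s using Finset.induction_on with
  | empty => simpa using zero
  | insert p s hp ih =>
    simp only [Finset.sum_insert hp]
    exact (hf p).add ih

theorem of_continuousOn [BorelSpace X] [T2Space X] {K : Set X} (hK : IsCompact K) (hKU : K ⊆ U)
    (hf : ContinuousOn f K) (h0 : ∀ x ∉ K, f x = 0) : IsTestFun U f := by
  classical
  obtain ⟨C, hC⟩ := hK.exists_bound_of_continuousOn hf
  refine ⟨?_, K, max C 0, hK, hKU, h0, fun x => ?_⟩
  · convert! hf.measurable_piecewise (g := fun _ => 0) continuousOn_const hK.measurableSet using 1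
    funext x
    by_cases hx : x ∈ K
    · rw [piecewise_eq_of_mem _ _ _ hx]
    · rw [piecewise_eq_of_notMem _ _ _ hx, h0 x hx]
  · by_cases hx : x ∈ K
    · exact (hC x hx).trans (le_max_left _ _)
    · rw [h0 x hx, abs_zero]
      exact le_max_right _ _

end IsTestFun

theorem HasMajorant.eq_of_eq_on_continuous [BorelSpace X] [CompactSpace X] [T2Space X]
    [SecondCountableTopology X] {Φ Ψ : (X → ℝ) → ℝ} (hΦ : HasMajorant Φ) (hΨ : HasMajorant Ψ)
    (h : ∀ f : X → ℝ, Continuous f → Φ f = Ψ f) {f : X → ℝ} (hf : IsBddMeas f) : Φ f = Ψ f := by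
  let : MetricSpace X := TopologicalSpace.metrizableSpaceMetric X
  have hcont : ∀ g : X → ℝ, Continuous g → IsBddMeas g := fun g hg => by
    obtain ⟨C, hC⟩ := isCompact_univ.exists_bound_of_continuousOn hg.continuousOn
    exact ⟨hg.measurable, C, fun x => hC x (mem_univ x)⟩
  obtain ⟨ν, _, hν⟩ := hΦ.sub hΨ
  rw [← sub_eq_zero, ← abs_nonpos_iff]
  refine le_of_forall_pos_le_add fun ε hε => ?_
  obtain ⟨g, hg, -⟩ := (hf.integrable ν).exists_boundedContinuous_integral_sub_le hε
  have hfg := hν f g hf (hcont g g.continuous)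
  simp only [h g g.continuous, sub_self, sub_zero] at hfg
  rw [zero_add]
  exact hfg.trans hg

end TestFunctions

section ChartMeasures

variable {n m : ℕ} {X : Type u} [TopologicalSpace X] [ChartedSpace (EuclideanQuadrant n) X]
  {W : X → Type u} [∀ x, AddCommGroup (W x)] [∀ x, Module ℝ (W x)]
  [TopologicalSpace (TotalSpace (EuclideanSpace ℝ (Fin m)) W)] [∀ x, TopologicalSpace (W x)]
  [FiberBundle (EuclideanSpace ℝ (Fin m)) W]

theorem secondCountableTopology_of_compact (n : ℕ) (X : Type u) [TopologicalSpace X]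
    [ChartedSpace (EuclideanQuadrant n) X] [CompactSpace X] : SecondCountableTopology X := by
  have : SecondCountableTopology (EuclideanQuadrant n) :=
    inferInstanceAs (SecondCountableTopology {x : EuclideanSpace ℝ (Fin n) // ∀ i, 0 ≤ x i})
  exact ChartedSpace.secondCountable_of_sigmaCompact (EuclideanQuadrant n) X

namespace VBChart

/-- The inverse of the chart `a` as an open embedding of the image of `a`, which carries the local
measures of a `BundleMeasure`, into `X`. -/
def point (a : VBChart n m W) (y : a.img univ) : X := a.inv y

theorem point_mem (a : VBChart n m W) (y : a.img univ) : a.point y ∈ a.dom := (a.inv_mem y.2).1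

theorem isOpenEmbedding_point (a : VBChart n m W) : Topology.IsOpenEmbedding a.point := by
  let h : a.img univ ≃ₜ a.dom :=
    { toFun := fun y => ⟨a.inv y, a.point_mem y⟩
      invFun := fun x => ⟨a.ext x, a.ext_mem ⟨x.2, mem_univ _⟩⟩
      left_inv := fun y => Subtype.ext (a.ext_inv y.2)
      right_inv := fun x => Subtype.ext (a.inv_ext x.2)
      continuous_toFun :=
        (continuousOn_iff_continuous_domRestrict.1 (a.continuousOn_inv univ)).subtype_mk _
      continuous_invFun :=
        (continuousOn_iff_continuous_domRestrict.1 a.continuousOn_ext).subtype_mk _ }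
  exact a.isOpen_dom.isOpenEmbedding_subtypeVal.comp h.isOpenEmbedding

theorem range_point (a : VBChart n m W) : range a.point = a.dom := by
  refine Subset.antisymm (range_subset_iff.2 a.point_mem) fun x hx => ?_
  exact ⟨⟨a.ext x, a.ext_mem ⟨hx, mem_univ _⟩⟩, a.inv_ext hx⟩

theorem isCompact_preimage_point (a : VBChart n m W) {K : Set X} (hK : IsCompact K)
    (hKa : K ⊆ a.dom) : IsCompact (a.point ⁻¹' K) :=
  a.isOpenEmbedding_point.isInducing.isCompact_preimage_iff (by rwa [a.range_point]) |>.2 hK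

theorem locallyCompactSpace_img [CompactSpace X] [T2Space X] (a : VBChart n m W) :
    LocallyCompactSpace (a.img univ) :=
  a.isOpenEmbedding_point.locallyCompactSpace

theorem abs_integral_point_le (a : VBChart n m W) (μ : Measure (a.img univ))
    [IsFiniteMeasureOnCompacts μ] {f : X → ℝ} {K : Set X} (hK : IsCompact K) (hKa : K ⊆ a.dom)
    (h0 : ∀ x ∉ K, f x = 0) {C : ℝ} (hC : ∀ x ∈ K, |f x| ≤ C) :
    |∫ y, f (a.point y) ∂μ| ≤ C * μ.real (a.point ⁻¹' K) := by
  rw [← setIntegral_eq_integral_of_forall_compl_eq_zero (s := a.point ⁻¹' K) (μ := μ)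
    (f := fun y => f (a.point y)) fun y hy => h0 _ hy]
  exact norm_setIntegral_le_of_norm_le_const (f := fun y => f (a.point y))
    (a.isCompact_preimage_point hK hKa).measure_lt_top fun y hy => hC _ hy

variable [MeasurableSpace X] [BorelSpace X]

theorem measurableEmbedding_point (a : VBChart n m W) : MeasurableEmbedding a.point :=
  a.isOpenEmbedding_point.measurableEmbedding

theorem integrable_point (a : VBChart n m W) (μ : Measure (a.img univ))
    [IsFiniteMeasureOnCompacts μ] {f : X → ℝ} (hf : IsTestFun a.dom f) :
    Integrable (fun y => f (a.point y)) μ := by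
  obtain ⟨K, C, hK, hKU, h0, hC⟩ := hf.2
  have hK' := a.isCompact_preimage_point hK hKU
  rw [← integrableOn_iff_integrable_of_support_subset (s := a.point ⁻¹' K)
    (Function.support_subset_iff'.2 fun y hy => h0 _ hy)]
  exact Measure.integrableOn_of_bounded (M := C) hK'.measure_lt_top.ne
    (hf.1.comp a.measurableEmbedding_point.measurable).aestronglyMeasurable
    (Filter.Eventually.of_forall fun y => hC _)

theorem hasMajorant_integral_point (a : VBChart n m W) (μ : Measure (a.img univ))
    [IsFiniteMeasureOnCompacts μ] {h : X → ℝ} (hh : IsTestFun a.dom h) :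
    HasMajorant fun g => ∫ y, g (a.point y) * h (a.point y) ∂μ := by
  obtain ⟨K, C, hK, hKU, h0, hC⟩ := hh.2
  have hK' := a.isCompact_preimage_point hK hKU
  have : IsFiniteMeasure (μ.restrict (a.point ⁻¹' K)) :=
    isFiniteMeasure_restrict.2 hK'.measure_lt_top.ne
  set ν := (μ.restrict (a.point ⁻¹' K)).map a.point with hν
  have : IsFiniteMeasure ν := Measure.isFiniteMeasure_map _ _
  refine ⟨ENNReal.ofReal C • ν, ?_, fun f g hf hg => ?_⟩
  · exact Measure.smul_finite _ ENNReal.ofReal_ne_top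
  rw [← integral_sub (a.integrable_point μ (IsTestFun.bdd_mul hf hh))
    (a.integrable_point μ (IsTestFun.bdd_mul hg hh)), integral_smul_measure, hν,
    a.measurableEmbedding_point.integral_map]
  rw [← setIntegral_eq_integral_of_forall_compl_eq_zero (s := a.point ⁻¹' K) fun y hy => by
    rw [h0 _ hy, mul_zero, mul_zero, sub_zero]]
  refine (abs_integral_le_integral_abs).trans ?_
  rw [smul_eq_mul, ← integral_const_mul]
  refine integral_mono_of_nonneg (Filter.Eventually.of_forall fun _ => abs_nonneg _) ?_
    (Filter.Eventually.of_forall fun y => ?_)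
  · exact ((a.measurableEmbedding_point.integrable_map_iff).1
      (((hf.sub hg).integrable ν).abs)).const_mul _
  · simp only
    rw [← sub_mul, abs_mul, mul_comm]
    refine mul_le_mul_of_nonneg_right ?_ (abs_nonneg _)
    rw [ENNReal.toReal_ofReal ((abs_nonneg _).trans (hC (a.point y)))]
    exact hC _

end VBChart

end ChartMeasures

section Gluing

instance {Y : Type*} [TopologicalSpace Y] [MeasurableSpace Y] (μ : RealRadonMeasure Y) :
    μ.pos.Regular := μ.regular_pos

instance {Y : Type*} [TopologicalSpace Y] [MeasurableSpace Y] (μ : RealRadonMeasure Y) :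
    μ.neg.Regular := μ.regular_neg

variable {n m : ℕ} {X : Type u} [TopologicalSpace X] [ChartedSpace (EuclideanQuadrant n) X]
  {W : X → Type u} [∀ x, AddCommGroup (W x)] [∀ x, Module ℝ (W x)]
  [TopologicalSpace (TotalSpace (EuclideanSpace ℝ (Fin m)) W)] [∀ x, TopologicalSpace (W x)]
  [FiberBundle (EuclideanSpace ℝ (Fin m)) W] {ι : Type}

theorem IsTestFun.of_tsupport_subset [T2Space X] [CompactSpace X] [MeasurableSpace X]
    [BorelSpace X] {u g : X → ℝ} {U : Set X} (hu : Continuous u) (hU : tsupport u ⊆ U)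
    (hg : ContinuousOn g U) : IsTestFun U fun x => u x * g x :=
  .of_continuousOn (isClosed_tsupport u).isCompact hU (hu.continuousOn.mul (hg.mono hU))
    fun x hx => by rw [image_eq_zero_of_notMem_tsupport hx, zero_mul]

namespace CoordBundle.Sec

variable {E : CoordBundle n m W ι} {R : Body n X} {k : ℕ}

theorem continuousOn (s : E.Sec R k) (a : VBChart n m W) (c : ι) :
    ContinuousOn (E.comp a s.1 c) (a.dom ∩ R.carrier) :=
  (smoothOn s a c).continuousOn

variable [T2Space X] [CompactSpace X] [MeasurableSpace X] [BorelSpace X]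

theorem isTestFun (s : E.Sec R k) (a : VBChart n m W) (c : ι) {u : X → ℝ} (hu : Continuous u)
    (hua : tsupport u ⊆ a.dom) : IsTestFun a.dom fun x => u x * E.comp a s.1 c x := by
  refine .of_continuousOn (K := tsupport u ∩ R.carrier)
    ((isClosed_tsupport u).isCompact.inter R.isCompact) (inter_subset_left.trans hua)
    (hu.continuousOn.mul ((continuousOn s a c).mono (inter_subset_inter_left _ hua)))
    fun x hx => ?_
  by_cases hxu : x ∈ tsupport u
  · rw [comp_eq_zero s a c fun hxR => hx ⟨hxu, hxR⟩, mul_zero]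
  · rw [image_eq_zero_of_notMem_tsupport hxu, zero_mul]

theorem exists_isBddMeas (s : E.Sec R k) (a : VBChart n m W) (c : ι) {u : X → ℝ}
    (hua : tsupport u ⊆ a.dom) :
    ∃ g, IsBddMeas g ∧ ∀ x, g x * u x = u x * E.comp a s.1 c x := by
  set K := tsupport u ∩ R.carrier
  refine ⟨K.indicator (E.comp a s.1 c), (IsTestFun.of_continuousOn (U := a.dom) (K := K)
    ((isClosed_tsupport u).isCompact.inter R.isCompact) (inter_subset_left.trans hua) ?_
    fun _ hx => indicator_of_notMem hx _).isBddMeas, fun x => ?_⟩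
  · exact ((continuousOn s a c).mono (inter_subset_inter_left _ hua)).congr
      fun _ hx => indicator_of_mem hx _
  by_cases hx : x ∈ K
  · rw [indicator_of_mem hx, mul_comm]
  rw [indicator_of_notMem hx, zero_mul]
  by_cases hxu : x ∈ tsupport u
  · rw [comp_eq_zero s a c fun hxR => hx ⟨hxu, hxR⟩, mul_zero]
  · rw [image_eq_zero_of_notMem_tsupport hxu, zero_mul]

end CoordBundle.Sec

namespace PartitionedAtlas

theorem tsupport_subset (𝔓 : PartitionedAtlas n m W) (i : Fin 𝔓.A) :
    tsupport (𝔓.u i) ⊆ (𝔓.chart i).dom := 𝔓.isSubordinate i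

theorem sum_eq_one (𝔓 : PartitionedAtlas n m W) (x : X) : ∑ i, 𝔓.u i x = 1 := by
  rw [← finsum_eq_sum_of_fintype]
  exact 𝔓.u.sum_eq_one (mem_univ x)

end PartitionedAtlas

variable [CompactSpace X] [IsManifold (quadrant n) ∞ X] [Fintype ι]

namespace BundleMeasure

variable {E₀ : CoordBundle n m W ι} (ς : BundleMeasure E₀)

section Integral

variable {a : VBChart n m W} {c : ι}

/-- The integral of a function on `X` with respect to a local component of `ς`. -/
def int (a : VBChart n m W) (c : ι) (f : X → ℝ) : ℝ :=
  ∫ y, f (a.point y) ∂(ς.meas a c).pos - ∫ y, f (a.point y) ∂(ς.meas a c).neg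

theorem int_congr {f g : X → ℝ} (h : EqOn f g a.dom) : ς.int a c f = ς.int a c g := by
  have hfg : (fun y => f (a.point y)) = fun y => g (a.point y) :=
    funext fun y => h (a.point_mem y)
  rw [int, int, hfg]

theorem integralOn_univ_rep {E : CoordBundle n m W ι} (a : VBChart n m W) (s : ∀ x, E.Fib x)
    (c : ι) : (ς.meas a c).integralOn univ (fun y => E.rep a s y c) =
      ς.int a c (E.comp a s c) := by
  rw [RealRadonMeasure.integralOn, Measure.restrict_univ, Measure.restrict_univ]
  rfl

theorem int_zero (a : VBChart n m W) (c : ι) : ς.int a c (fun _ => 0) = 0 := by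
  simp [int]

theorem int_const_mul (z : ℝ) (f : X → ℝ) :
    ς.int a c (fun x => z * f x) = z * ς.int a c f := by
  simp only [int, integral_const_mul, mul_sub]

theorem abs_int_le {f : X → ℝ} {K : Set X} (hK : IsCompact K)
    (hKa : K ⊆ a.dom) (h0 : ∀ x ∉ K, f x = 0) {C : ℝ} (hC : ∀ x ∈ K, |f x| ≤ C) :
    |ς.int a c f| ≤ C * ((ς.meas a c).pos.real (a.point ⁻¹' K) +
      (ς.meas a c).neg.real (a.point ⁻¹' K)) := by
  rw [mul_add]
  exact (abs_sub _ _).trans (add_le_add (a.abs_integral_point_le _ hK hKa h0 hC)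
    (a.abs_integral_point_le _ hK hKa h0 hC))

variable [MeasurableSpace X] [BorelSpace X]

theorem int_add {f g : X → ℝ} (hf : IsTestFun a.dom f) (hg : IsTestFun a.dom g) :
    ς.int a c (fun x => f x + g x) = ς.int a c f + ς.int a c g := by
  simp only [int]
  rw [integral_add (a.integrable_point _ hf) (a.integrable_point _ hg),
    integral_add (a.integrable_point _ hf) (a.integrable_point _ hg), add_sub_add_comm]

theorem int_sum {P : Type*} (s : Finset P) {f : P → X → ℝ} (hf : ∀ p, IsTestFun a.dom (f p)) :
    ς.int a c (fun x => ∑ p ∈ s, f p x) = ∑ p ∈ s, ς.int a c (f p) := by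
  classical
  induction s using Finset.induction_on with
  | empty => simpa using ς.int_zero a c
  | insert p s hp ih =>
    simp only [Finset.sum_insert hp]
    rw [ς.int_add (hf p) (IsTestFun.sum s hf), ih]

theorem hasMajorant_int {h : X → ℝ} (hh : IsTestFun a.dom h) :
    HasMajorant fun g => ς.int a c fun x => g x * h x :=
  (a.hasMajorant_integral_point _ hh).sub (a.hasMajorant_integral_point _ hh)

end Integral

end BundleMeasure

namespace HasSmoothTransitions

variable {E : Body n X → CoordBundle n m W ι}

theorem exists_sec_comp_eq_single [DecidableEq ι] (hE : HasSmoothTransitions E)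
    (a : VBChart n m W) (d : ι) {u : X → ℝ} (hu : Continuous u) (hua : tsupport u ⊆ a.dom) :
    ∃ s ∈ (E (Body.whole n X)).Sec (Body.whole n X) 0,
      (∀ x ∈ a.dom, ∀ c, (E (Body.whole n X)).comp a s c x = if d = c then u x else 0) ∧
      ∀ x ∉ tsupport u, s x = 0 := by
  obtain ⟨s, hs, hsu, hs0⟩ := hE.exists_sec_of_comp (Body.whole n X) a (k := 0)
    (f := fun c x => if d = c then u x else 0) (isClosed_tsupport u) hua
    (fun c x hx => by simp [image_eq_zero_of_notMem_tsupport hx])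
    (fun c => contMDiffOn_zero_iff.2 <| Continuous.continuousOn <| by
      split_ifs
      exacts [hu, continuous_const])
  exact ⟨s, hs, fun x hx => hsu x ⟨hx, mem_univ x⟩, hs0⟩

theorem int_eq_sum_int_transition (hE : HasSmoothTransitions E)
    (ς : BundleMeasure (E (Body.whole n X))) (a b : VBChart n m W) (d : ι) {u : X → ℝ}
    (hu : Continuous u) (hua : tsupport u ⊆ a.dom ∩ b.dom) :
    ς.int a d u = ∑ c, ς.int b c fun x => u x * hE.transition a b c d x := by
  classical
  obtain ⟨s, hs, hsu, hs0⟩ :=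
    hE.exists_sec_comp_eq_single a d hu (hua.trans inter_subset_left)
  have hsupp : closure {x | s x ≠ 0} ⊆ tsupport u :=
    closure_minimal (fun x hx => by_contra fun h => hx (hs0 x h)) (isClosed_tsupport u)
  have hcompat := ς.compat a b s hs (hsupp.trans hua)
  simp only [ς.integralOn_univ_rep] at hcompat
  have hleft : ∑ c, ς.int a c ((E (Body.whole n X)).comp a s c) = ς.int a d u := by
    rw [Finset.sum_eq_single d (fun c _ hc => ?_) fun hd => absurd (Finset.mem_univ d) hd]
    · exact ς.int_congr fun x hx => by rw [hsu x hx, if_pos rfl]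
    · rw [← ς.int_zero a c]
      exact ς.int_congr fun x hx => by rw [hsu x hx, if_neg hc.symm]
  rw [← hleft, hcompat]
  refine Finset.sum_congr rfl fun c _ => ς.int_congr fun x hx => ?_
  by_cases hxu : x ∈ tsupport u
  · rw [hE.comp_eq_sum a b ⟨⟨(hua hxu).1, hx⟩, mem_univ x⟩]
    simp only [hsu x (hua hxu).1, mul_ite, mul_zero, Finset.sum_ite_eq, Finset.mem_univ, if_true]
    exact mul_comm _ _
  · rw [CoordBundle.comp, hs0 x hxu, map_zero, image_eq_zero_of_notMem_tsupport hxu, zero_mul,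
      Pi.zero_apply]

variable [T2Space X] [MeasurableSpace X] [BorelSpace X]

/-- Compatibility is imposed only on continuous sections; domination by a finite measure extends
it to bounded measurable coefficients, which is needed for sections over bodies other than `X`. -/
theorem int_mul_eq_sum_int_transition (hE : HasSmoothTransitions E)
    (ς : BundleMeasure (E (Body.whole n X))) (a b : VBChart n m W) (d : ι) {u : X → ℝ}
    (hu : Continuous u) (hua : tsupport u ⊆ a.dom ∩ b.dom) {g : X → ℝ} (hg : IsBddMeas g) :
    ς.int a d (fun x => g x * u x) =
      ∑ c, ς.int b c fun x => g x * (u x * hE.transition a b c d x) := by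
  have := secondCountableTopology_of_compact n X
  have hu' : IsTestFun (a.dom ∩ b.dom) u := by
    simpa only [mul_one] using IsTestFun.of_tsupport_subset hu hua (continuousOn_const (c := 1))
  refine HasMajorant.eq_of_eq_on_continuous (ς.hasMajorant_int (hu'.mono inter_subset_left))
    (.sum _ fun c => ς.hasMajorant_int ((IsTestFun.of_tsupport_subset hu hua
      (hE.smoothOn_transition a b c d).continuousOn).mono inter_subset_right))
    (fun f hf => ?_) hg
  simp only [← mul_assoc]
  exact hE.int_eq_sum_int_transition ς a b d (hf.mul hu) (tsupport_mul_subset_right.trans hua)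

theorem sum_int_eq (hE : HasSmoothTransitions E) (ς : BundleMeasure (E (Body.whole n X)))
    {R : Body n X} (χ : (E R).Sec R 0) (a b : VBChart n m W) {u : X → ℝ} (hu : Continuous u)
    (hua : tsupport u ⊆ a.dom ∩ b.dom) :
    ∑ c, ς.int a c (fun x => u x * (E R).comp a χ.1 c x) =
      ∑ c, ς.int b c (fun x => u x * (E R).comp b χ.1 c x) := by
  choose g hg hgu using fun d => CoordBundle.Sec.exists_isBddMeas χ a d
    (hua.trans inter_subset_left)
  simp only [← hgu, hE.int_mul_eq_sum_int_transition ς a b _ hu hua (hg _)]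
  rw [Finset.sum_comm]
  refine Finset.sum_congr rfl fun c _ => ?_
  rw [← ς.int_sum _ fun d => IsTestFun.bdd_mul (hg d) ((IsTestFun.of_tsupport_subset hu hua
      (hE.smoothOn_transition a b c d).continuousOn).mono inter_subset_right)]
  refine ς.int_congr fun x _ => ?_
  simp only [← mul_assoc, hgu]
  by_cases hxu : x ∈ tsupport u
  · by_cases hxR : x ∈ R.carrier
    · rw [hE.comp_eq_sum a b ⟨hua hxu, hxR⟩, Finset.mul_sum]
      exact Finset.sum_congr rfl fun d _ => by ring
    · simp only [CoordBundle.Sec.comp_eq_zero χ _ _ hxR, mul_zero, zero_mul,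
        Finset.sum_const_zero]
  · simp only [image_eq_zero_of_notMem_tsupport hxu, zero_mul, Finset.sum_const_zero]

end HasSmoothTransitions

variable [T2Space X] [MeasurableSpace X] [BorelSpace X]

namespace BundleMeasure

variable {E₀ : CoordBundle n m W ι} (ς : BundleMeasure E₀)

/-- The integral of a section over a body with respect to `ς`, computed in the partitioned atlas
`𝔓`. The section vanishes outside its body, so no restriction of the measures is needed. -/
def glued (𝔓 : PartitionedAtlas n m W) {E₁ : CoordBundle n m W ι} (s : ∀ x, E₁.Fib x) : ℝ :=
  ∑ i, ∑ c, ς.int (𝔓.chart i) c fun x => 𝔓.u i x * E₁.comp (𝔓.chart i) s c x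

theorem hasIntegral_iff {E₁ : CoordBundle n m W ι} {R : Body n X} (χ : E₁.Sec R 0) (v : ℝ) :
    ς.HasIntegral R χ v ↔ ∀ 𝔓 : PartitionedAtlas n m W, ς.glued 𝔓 χ.1 = v := by
  refine forall_congr' fun 𝔓 => ?_
  have hzero (i c) (y : (𝔓.chart i).img univ)
      (hy : y ∉ {y : (𝔓.chart i).img univ | (𝔓.chart i).inv y ∈ R.carrier}) :
      𝔓.u i ((𝔓.chart i).inv y) * E₁.rep (𝔓.chart i) χ.1 y c = 0 := by
    rw [E₁.rep_eq_comp, CoordBundle.Sec.comp_eq_zero χ _ c hy, mul_zero]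
  have hint (i c) (μ : Measure ((𝔓.chart i).img univ)) [μ.Regular] :=
    (𝔓.chart i).integrable_point μ
      (CoordBundle.Sec.isTestFun χ _ c (𝔓.u i).continuous (𝔓.tsupport_subset i))
  refine (and_iff_right fun i c =>
    ⟨(hint i c _).integrableOn, (hint i c _).integrableOn⟩).trans (Eq.congr_left ?_)
  refine Finset.sum_congr rfl fun i _ => Finset.sum_congr rfl fun c _ => ?_
  rw [RealRadonMeasure.integralOn, setIntegral_eq_integral_of_forall_compl_eq_zero (hzero i c),
    setIntegral_eq_integral_of_forall_compl_eq_zero (hzero i c)]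
  rfl

theorem glued_eq_sum_mul (ς : BundleMeasure E₀) {E₁ : CoordBundle n m W ι} {R : Body n X}
    (χ : E₁.Sec R 0) (𝔓 𝔔 : PartitionedAtlas n m W) :
    ς.glued 𝔓 χ.1 = ∑ i, ∑ j, ∑ c, ς.int (𝔓.chart i) c fun x =>
      (𝔓.u i x * 𝔔.u j x) * E₁.comp (𝔓.chart i) χ.1 c x := by
  refine Finset.sum_congr rfl fun i _ => ?_
  rw [Finset.sum_comm]
  refine Finset.sum_congr rfl fun c _ => ?_
  rw [← ς.int_sum _ fun j => CoordBundle.Sec.isTestFun χ _ c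
    (u := fun x => 𝔓.u i x * 𝔔.u j x) ((𝔓.u i).continuous.mul (𝔔.u j).continuous)
    (tsupport_mul_subset_left.trans (𝔓.tsupport_subset i))]
  refine ς.int_congr fun x _ => ?_
  rw [← Finset.sum_mul, ← Finset.mul_sum, 𝔔.sum_eq_one, mul_one]

end BundleMeasure

namespace HasSmoothTransitions

variable {E : Body n X → CoordBundle n m W ι}

theorem glued_eq (hE : HasSmoothTransitions E) (ς : BundleMeasure (E (Body.whole n X)))
    {R : Body n X} (χ : (E R).Sec R 0) (𝔓 𝔔 : PartitionedAtlas n m W) :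
    ς.glued 𝔓 χ.1 = ς.glued 𝔔 χ.1 := by
  rw [ς.glued_eq_sum_mul χ 𝔓 𝔔, ς.glued_eq_sum_mul χ 𝔔 𝔓, Finset.sum_comm]
  refine Finset.sum_congr rfl fun j _ => Finset.sum_congr rfl fun i _ => ?_
  rw [hE.sum_int_eq ς χ (𝔓.chart i) (𝔔.chart j) (u := fun x => 𝔓.u i x * 𝔔.u j x)
    ((𝔓.u i).continuous.mul (𝔔.u j).continuous)
    (subset_inter (tsupport_mul_subset_left.trans (𝔓.tsupport_subset i))
      (tsupport_mul_subset_right.trans (𝔔.tsupport_subset j)))]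
  simp only [mul_comm (𝔓.u i _)]

theorem hasIntegral_glued (hE : HasSmoothTransitions E) (ς : BundleMeasure (E (Body.whole n X)))
    {R : Body n X} (χ : (E R).Sec R 0) (𝔓 : PartitionedAtlas n m W) :
    ς.HasIntegral R χ (ς.glued 𝔓 χ.1) :=
  (ς.hasIntegral_iff χ _).2 fun 𝔔 => hE.glued_eq ς χ 𝔔 𝔓

end HasSmoothTransitions

end Gluing

section Forces

variable {n m r k : ℕ} {X : Type u} [TopologicalSpace X] [ChartedSpace (EuclideanQuadrant n) X]
  {W : X → Type u} [∀ x, AddCommGroup (W x)] [∀ x, Module ℝ (W x)]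
  [TopologicalSpace (TotalSpace (EuclideanSpace ℝ (Fin m)) W)] [∀ x, TopologicalSpace (W x)]
  [FiberBundle (EuclideanSpace ℝ (Fin m)) W] {R : Body n X}

/-- The partial derivative `∂_I w_a^α` in the chart `a` of a section of `W` over `R`, as a function
on `X`. -/
def secPd (R : Body n X) (a : VBChart n m W) (I : Fin k → Fin n) (α : Fin m) (w : ∀ x, W x)
    (x : X) : ℝ :=
  a.pd R.carrier I ((baseBundle n m W).comp a w α) x

theorem contDiffWithinAt_comp_inv_ext (w : CrSec m W R r) (a : VBChart n m W) (hk : k ≤ r)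
    (α : Fin m) {x : X} (hx : x ∈ a.dom ∩ R.carrier) :
    ContDiffWithinAt ℝ k ((baseBundle n m W).comp a w.1 α ∘ a.inv) (a.img R.carrier) (a.ext x) :=
  (w.2.2 a α _ (a.ext_mem hx)).of_le (by exact_mod_cast hk)

theorem secPd_add (w w' : CrSec m W R r) (a : VBChart n m W) (hk : k ≤ r) (I : Fin k → Fin n)
    (α : Fin m) {x : X} (hx : x ∈ a.dom ∩ R.carrier) :
    secPd R a I α (w + w').1 x = secPd R a I α w.1 x + secPd R a I α w'.1 x := by
  have hadd : (baseBundle n m W).comp a (w + w').1 α ∘ a.inv =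
      (baseBundle n m W).comp a w.1 α ∘ a.inv + (baseBundle n m W).comp a w'.1 α ∘ a.inv :=
    funext fun y => congrFun (map_add ((baseBundle n m W).coord a (a.inv y)) _ _) α
  rw [secPd, VBChart.pd, hadd, partialWithin_add (a.uniqueDiffOn_img R) (a.ext_mem hx)
    (contDiffWithinAt_comp_inv_ext w a hk α hx) (contDiffWithinAt_comp_inv_ext w' a hk α hx)]
  rfl

theorem secPd_smul (z : ℝ) (w : CrSec m W R r) (a : VBChart n m W) (hk : k ≤ r)
    (I : Fin k → Fin n) (α : Fin m) {x : X} (hx : x ∈ a.dom ∩ R.carrier) :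
    secPd R a I α (z • w).1 x = z * secPd R a I α w.1 x := by
  have hsmul : (baseBundle n m W).comp a (z • w).1 α ∘ a.inv =
      z • ((baseBundle n m W).comp a w.1 α ∘ a.inv) :=
    funext fun y => congrFun (map_smul ((baseBundle n m W).coord a (a.inv y)) _ _) α
  rw [secPd, VBChart.pd, hsmul, partialWithin_smul z (a.uniqueDiffOn_img R) (a.ext_mem hx)
    (contDiffWithinAt_comp_inv_ext w a hk α hx)]
  rfl

theorem continuousOn_secPd (w : CrSec m W R r) (a : VBChart n m W) (hk : k ≤ r)
    (I : Fin k → Fin n) (α : Fin m) : ContinuousOn (secPd R a I α w.1) (a.dom ∩ R.carrier) :=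
  (a.smoothOn_pd R I (CoordBundle.Sec.smoothOn (E := baseBundle n m W) w a α) (j := 0)
    (by omega)).continuousOn

namespace PrecompactAtlas

theorem crNorm_nonneg (𝔎 : PrecompactAtlas m W R) (w : CrSec m W R r) : 0 ≤ 𝔎.crNorm r w := by
  refine Real.sSup_nonneg ?_
  rintro _ ⟨i, α, k, I, x, -, -, rfl⟩
  exact abs_nonneg _

theorem crNorm_le (𝔎 : PrecompactAtlas m W R) (w : CrSec m W R r) {M : ℝ} (hM : 0 ≤ M)
    (h : ∀ i α (k : ℕ) (I : Fin k → Fin n), k ≤ r → ∀ x ∈ 𝔎.K i,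
      |secPd R (𝔎.chart i) I α w.1 x| ≤ M) : 𝔎.crNorm r w ≤ M := by
  refine Real.sSup_le ?_ hM
  rintro _ ⟨i, α, k, I, x, hk, hx, rfl⟩
  exact h i α k I hk x hx

theorem le_crNorm (𝔎 : PrecompactAtlas m W R) (w : CrSec m W R r) (i : Fin 𝔎.A) (α : Fin m)
    (hk : k ≤ r) (I : Fin k → Fin n) {x : X} (hx : x ∈ 𝔎.K i) :
    |secPd R (𝔎.chart i) I α w.1 x| ≤ 𝔎.crNorm r w := by
  refine le_csSup ?_ ⟨i, α, k, I, x, hk, hx, rfl⟩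
  choose B hB using fun p : (Σ k : Fin (r + 1), Fin k → Fin n) × Fin 𝔎.A × Fin m =>
    (𝔎.isCompact p.2.1).exists_bound_of_continuousOn
      ((continuousOn_secPd w (𝔎.chart p.2.1) (Nat.lt_succ_iff.1 p.1.1.2) p.1.2 p.2.2).mono
        (𝔎.subset p.2.1))
  refine ⟨∑ p, |B p|, ?_⟩
  rintro _ ⟨i, α, k, I, x, hk, hx, rfl⟩
  have hBx := hB (⟨⟨k, Nat.lt_succ_of_le hk⟩, I⟩, i, α) x hx
  exact (hBx.trans (le_abs_self _)).trans
    (Finset.single_le_sum (f := fun p => |B p|) (fun p _ => abs_nonneg _) (Finset.mem_univ _))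

end PrecompactAtlas

/-- The precompact atlas on a body consisting of the supports of a partition of unity; it bounds
the integrals in that partition by a `C^r`-norm. -/
def PartitionedAtlas.precompact [CompactSpace X] (𝔓 : PartitionedAtlas n m W) (R : Body n X)
    [T2Space X] : PrecompactAtlas m W R where
  A := 𝔓.A
  chart := 𝔓.chart
  K i := tsupport (𝔓.u i) ∩ R.carrier
  isCompact i := (isClosed_tsupport _).isCompact.inter R.isCompact
  subset i := inter_subset_inter_left _ (𝔓.isSubordinate i)
  cover x _ := by
    obtain ⟨i, hi⟩ := 𝔓.u.exists_pos (mem_univ x)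
    refine ⟨i, Filter.inter_mem (mem_nhdsWithin_of_mem_nhds ?_) self_mem_nhdsWithin⟩
    have hsupp : Function.support (𝔓.u i) ∈ 𝓝 x :=
      (𝔓.u i).continuous.isOpen_support.mem_nhds hi.ne'
    exact Filter.mem_of_superset hsupp (subset_tsupport _)

variable {ι : Type}

/-- The local component `c` of `D w` is, in every chart, the partial derivative `∂_I` of the
component `α` of `w`. -/
def IsPartialComponent {E : CoordBundle n m W ι} (D : CrSec m W R r → E.Sec R 0) (c : ι)
    (I : Fin k → Fin n) (α : Fin m) : Prop :=
  ∀ (w : CrSec m W R r) (a : VBChart n m W), ∀ x ∈ a.dom ∩ R.carrier,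
    E.comp a (D w).1 c x = secPd R a I α w.1 x

/-- The local components of `D w` are partial derivatives of order at most `r` of those of `w`,
the same ones in all charts. The jet extensions are the examples. -/
def HasPartialComponents {E : CoordBundle n m W ι} (D : CrSec m W R r → E.Sec R 0) : Prop :=
  ∀ c : ι, ∃ (k : ℕ) (I : Fin k → Fin n) (α : Fin m), k ≤ r ∧ IsPartialComponent D c I α

theorem isPartialComponent_jet (R : Body n X) (r : ℕ) (p : JetIdx n r × Fin m) :
    IsPartialComponent (jet (W := W) R r) p p.1.2.1 p.2 :=
  fun w a _ hx => comp_jet R r w a hx p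

theorem IsIterJetPartial.isPartialComponent {θ : IterIdx n m r} {I : Fin k → Fin n} {α : Fin m}
    (hθ : IsIterJetPartial W r θ I α) (R : Body n X) :
    IsPartialComponent (iterJet (W := W) R r) θ I α :=
  hθ R (by simp)

theorem hasPartialComponents_jet (R : Body n X) (r : ℕ) :
    HasPartialComponents (jet (m := m) (W := W) R r) := fun p =>
  ⟨_, p.1.2.1, p.2, Nat.lt_succ_iff.1 p.1.1.2, isPartialComponent_jet R r p⟩

theorem hasPartialComponents_iterJet (R : Body n X) (r : ℕ) :
    HasPartialComponents (iterJet (m := m) (W := W) R r) := fun θ => by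
  obtain ⟨k, I, α, hk, hθ⟩ := exists_isIterJetPartial_of_component (X := X) (W := W) r θ
  exact ⟨k, I, α, hk, hθ.isPartialComponent R⟩

namespace HasPartialComponents

variable {E : CoordBundle n m W ι} {D : CrSec m W R r → E.Sec R 0}

theorem comp_add (hD : HasPartialComponents D) (w w' : CrSec m W R r) {a : VBChart n m W} (c : ι)
    {x : X} (hx : x ∈ a.dom) :
    E.comp a (D (w + w')).1 c x = E.comp a (D w).1 c x + E.comp a (D w').1 c x := by
  by_cases hxR : x ∈ R.carrier
  · obtain ⟨k, I, α, hk, hD⟩ := hD c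
    simp only [hD _ a x ⟨hx, hxR⟩, secPd_add w w' a hk I α ⟨hx, hxR⟩]
  · simp only [CoordBundle.Sec.comp_eq_zero _ a c hxR, add_zero]

theorem comp_smul (hD : HasPartialComponents D) (z : ℝ) (w : CrSec m W R r) {a : VBChart n m W}
    (c : ι) {x : X} (hx : x ∈ a.dom) :
    E.comp a (D (z • w)).1 c x = z * E.comp a (D w).1 c x := by
  by_cases hxR : x ∈ R.carrier
  · obtain ⟨k, I, α, hk, hD⟩ := hD c
    simp only [hD _ a x ⟨hx, hxR⟩, secPd_smul z w a hk I α ⟨hx, hxR⟩]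
  · simp only [CoordBundle.Sec.comp_eq_zero _ a c hxR, mul_zero]

theorem abs_comp_le_crNorm (hD : HasPartialComponents D) (𝔎 : PrecompactAtlas m W R)
    (w : CrSec m W R r) (i : Fin 𝔎.A) (c : ι) {x : X} (hx : x ∈ 𝔎.K i) :
    |E.comp (𝔎.chart i) (D w).1 c x| ≤ 𝔎.crNorm r w := by
  obtain ⟨k, I, α, hk, hD⟩ := hD c
  rw [hD w _ x (𝔎.subset i hx)]
  exact 𝔎.le_crNorm w i α hk I hx

variable [CompactSpace X] [IsManifold (quadrant n) ∞ X] [T2Space X] [Fintype ι]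
  {E₀ : CoordBundle n m W ι} (ς : BundleMeasure E₀) (𝔓 : PartitionedAtlas n m W)

theorem abs_glued_le (hD : HasPartialComponents D) (w : CrSec m W R r) :
    |ς.glued 𝔓 (D w).1| ≤ (∑ i, ∑ c, ((ς.meas (𝔓.chart i) c).pos.real
        ((𝔓.chart i).point ⁻¹' (tsupport (𝔓.u i) ∩ R.carrier)) +
      (ς.meas (𝔓.chart i) c).neg.real
        ((𝔓.chart i).point ⁻¹' (tsupport (𝔓.u i) ∩ R.carrier)))) *
      (𝔓.precompact R).crNorm r w := by
  rw [BundleMeasure.glued, Finset.sum_mul]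
  refine (Finset.abs_sum_le_sum_abs _ _).trans (Finset.sum_le_sum fun i _ => ?_)
  rw [Finset.sum_mul]
  refine (Finset.abs_sum_le_sum_abs _ _).trans (Finset.sum_le_sum fun c _ => ?_)
  rw [mul_comm]
  refine ς.abs_int_le ((𝔓.precompact R).isCompact i)
    (inter_subset_left.trans (𝔓.tsupport_subset i)) (fun x hx => ?_) fun x hx => ?_
  · by_cases hxu : x ∈ tsupport (𝔓.u i)
    · rw [CoordBundle.Sec.comp_eq_zero (D w) _ c fun hxR => hx ⟨hxu, hxR⟩, mul_zero]
    · rw [image_eq_zero_of_notMem_tsupport hxu, zero_mul]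
  · rw [abs_mul, abs_of_nonneg (𝔓.u.nonneg i x)]
    exact (mul_le_of_le_one_left (abs_nonneg _) (𝔓.u.le_one i x)).trans
      (hD.abs_comp_le_crNorm (𝔓.precompact R) w i c hx)

variable [MeasurableSpace X] [BorelSpace X]

/-- The linear functional `w ↦ ∫_R D w · dς`. -/
def gluedLinear (hD : HasPartialComponents D) : CrSec m W R r →ₗ[ℝ] ℝ where
  toFun w := ς.glued 𝔓 (D w).1
  map_add' w w' := by
    simp only [BundleMeasure.glued, ← Finset.sum_add_distrib]
    refine Finset.sum_congr rfl fun i _ => Finset.sum_congr rfl fun c _ => ?_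
    have htest (v : CrSec m W R r) := CoordBundle.Sec.isTestFun (D v) (𝔓.chart i) c
      (𝔓.u i).continuous (𝔓.tsupport_subset i)
    rw [← ς.int_add (htest w) (htest w')]
    exact ς.int_congr fun x hx => by rw [hD.comp_add w w' c hx, mul_add]
  map_smul' z w := by
    simp only [BundleMeasure.glued, RingHom.id_apply, smul_eq_mul, Finset.mul_sum]
    refine Finset.sum_congr rfl fun i _ => Finset.sum_congr rfl fun c _ => ?_
    rw [← ς.int_const_mul]
    exact ς.int_congr fun x hx => by rw [hD.comp_smul z w c hx, mul_left_comm]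

end HasPartialComponents

variable [CompactSpace X] [IsManifold (quadrant n) ∞ X] [T2Space X] [Fintype ι]

theorem HasSmoothTransitions.exists_force [VectorBundle ℝ (EuclideanSpace ℝ (Fin m)) W]
    [ContMDiffVectorBundle ∞ (EuclideanSpace ℝ (Fin m)) W (quadrant n)]
    {E : Body n X → CoordBundle n m W ι} (hE : HasSmoothTransitions E)
    (ς : BundleMeasure (E (Body.whole n X))) {D : CrSec m W R r → (E R).Sec R 0}
    (hD : HasPartialComponents D) :
    ∃ F : Force m W R r, ∀ w, ς.HasIntegral R (D w) (F.toLin w) := by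
  borelize X
  obtain ⟨𝔓⟩ := PartitionedAtlas.nonempty (n := n) (m := m) (W := W)
  exact ⟨⟨hD.gluedLinear ς 𝔓, 𝔓.precompact R, _, hD.abs_glued_le ς 𝔓⟩,
    fun w => hE.hasIntegral_glued ς (D w) 𝔓⟩

end Forces

section JordanDecomposition

theorem withDensity_tsub_mutuallySingular {Y : Type*} [MeasurableSpace Y] (σ : Measure Y)
    {p q : Y → ENNReal} (hp : Measurable p) (hq : Measurable q) :
    σ.withDensity (p - q) ⟂ₘ σ.withDensity (q - p) := by
  have hpq : MeasurableSet {y | p y ≤ q y} := measurableSet_le hp hq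
  refine ⟨_, hpq, ?_, ?_⟩
  · rw [withDensity_apply _ hpq, setLIntegral_congr_fun (f := p - q) (g := fun _ => 0) hpq
      fun y hy => tsub_eq_zero_of_le hy, lintegral_zero]
  · rw [withDensity_apply _ hpq.compl, setLIntegral_congr_fun (f := q - p) (g := fun _ => 0)
      hpq.compl fun y (hy : ¬p y ≤ q y) => tsub_eq_zero_of_le (not_le.1 hy).le, lintegral_zero]

theorem exists_mutuallySingular_add_eq {Y : Type*} [MeasurableSpace Y] (P N : Measure Y)
    [SigmaFinite P] [SigmaFinite N] :
    ∃ P' N' : Measure Y, P' ≤ P ∧ N' ≤ N ∧ P' ⟂ₘ N' ∧ P' + N = N' + P := by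
  set p := P.rnDeriv (P + N)
  set q := N.rnDeriv (P + N)
  have hp : Measurable p := Measure.measurable_rnDeriv _ _
  have hq : Measurable q := Measure.measurable_rnDeriv _ _
  have hP : (P + N).withDensity p = P := Measure.withDensity_rnDeriv_eq P _
    (Measure.absolutelyContinuous_of_le (Measure.le_add_right le_rfl))
  have hN : (P + N).withDensity q = N := Measure.withDensity_rnDeriv_eq N _
    (Measure.absolutelyContinuous_of_le (Measure.le_add_left le_rfl))
  refine ⟨(P + N).withDensity (p - q), (P + N).withDensity (q - p),
    (withDensity_mono (.of_forall fun y => tsub_le_self)).trans_eq hP,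
    (withDensity_mono (.of_forall fun y => tsub_le_self)).trans_eq hN,
    withDensity_tsub_mutuallySingular _ hp hq, ?_⟩
  calc (P + N).withDensity (p - q) + N
      = (P + N).withDensity (p - q + q) := by rw [withDensity_add_left (hp.sub hq), hN]
    _ = (P + N).withDensity (q - p + p) := by
      congr 1
      funext y
      simp only [Pi.add_apply, Pi.sub_apply, tsub_add_eq_max, max_comm]
    _ = (P + N).withDensity (q - p) + P := by rw [withDensity_add_left (hq.sub hp), hP]

variable {Y : Type*} [TopologicalSpace Y] [MeasurableSpace Y] [BorelSpace Y]
  [SecondCountableTopology Y] [LocallyCompactSpace Y] [T2Space Y]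

theorem exists_realRadonMeasure_sub (P N : Measure Y) [IsFiniteMeasureOnCompacts P]
    [IsFiniteMeasureOnCompacts N] : ∃ ρ : RealRadonMeasure Y,
      ρ.pos ≤ P ∧ ρ.neg ≤ N ∧ ∀ f : Y → ℝ, Integrable f P → Integrable f N →
        ∫ y, f y ∂ρ.pos - ∫ y, f y ∂ρ.neg = ∫ y, f y ∂P - ∫ y, f y ∂N := by
  let _ : MetricSpace Y := TopologicalSpace.metrizableSpaceMetric Y
  have : IsLocallyFiniteMeasure P := isLocallyFiniteMeasure_of_isFiniteMeasureOnCompacts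
  have : IsLocallyFiniteMeasure N := isLocallyFiniteMeasure_of_isFiniteMeasureOnCompacts
  obtain ⟨P', N', hP, hN, hsing, hadd⟩ := exists_mutuallySingular_add_eq P N
  have : IsLocallyFiniteMeasure P' := Measure.isLocallyFiniteMeasure_of_le hP
  have : IsLocallyFiniteMeasure N' := Measure.isLocallyFiniteMeasure_of_le hN
  refine ⟨⟨P', N', inferInstance, inferInstance, hsing⟩, hP, hN, fun f hfP hfN => ?_⟩
  have hint : ∫ y, f y ∂(P' + N) = ∫ y, f y ∂(N' + P) := by rw [hadd]
  rw [integral_add_measure (hfP.mono_measure hP) hfN,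
    integral_add_measure (hfN.mono_measure hN) hfP] at hint
  linarith

end JordanDecomposition

section RadonFunctionals

variable {n m : ℕ} {X : Type u} [TopologicalSpace X] [ChartedSpace (EuclideanQuadrant n) X]
  {W : X → Type u} [∀ x, AddCommGroup (W x)] [∀ x, Module ℝ (W x)]
  [TopologicalSpace (TotalSpace (EuclideanSpace ℝ (Fin m)) W)] [∀ x, TopologicalSpace (W x)]
  [FiberBundle (EuclideanSpace ℝ (Fin m)) W] [MeasurableSpace X]

/-- Measurable functions which are bounded on the compact subsets of `U`. -/
structure IsLocBdd (U : Set X) (h : X → ℝ) : Prop where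
  measurable : Measurable h
  exists_bound : ∀ L, IsCompact L → L ⊆ U → ∃ C : ℝ, ∀ x ∈ L, |h x| ≤ C

namespace IsLocBdd

variable {U : Set X} {f h : X → ℝ}

theorem neg (hh : IsLocBdd U h) : IsLocBdd U fun x => -h x :=
  ⟨hh.measurable.neg, fun L hL hLU => by simpa only [abs_neg] using hh.exists_bound L hL hLU⟩

theorem max_zero (hh : IsLocBdd U h) : IsLocBdd U fun x => max (h x) 0 := by
  refine ⟨hh.measurable.max measurable_const, fun L hL hLU => ?_⟩
  obtain ⟨C, hC⟩ := hh.exists_bound L hL hLU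
  refine ⟨C, fun x hx => ?_⟩
  rw [abs_of_nonneg (le_max_right _ _)]
  exact max_le ((le_abs_self _).trans (hC x hx)) ((abs_nonneg _).trans (hC x hx))

theorem mul_isTestFun (hh : IsLocBdd U h) (hf : IsTestFun U f) :
    IsTestFun U fun x => h x * f x := by
  obtain ⟨K, C, hK, hKU, h0, hC⟩ := hf.exists_compact
  obtain ⟨D, hD⟩ := hh.exists_bound K hK hKU
  refine ⟨hh.measurable.mul hf.measurable, K, |D| * C, hK, hKU, fun x hx => by
    rw [h0 x hx, mul_zero], fun x => ?_⟩
  by_cases hx : x ∈ K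
  · rw [abs_mul]
    exact mul_le_mul ((hD x hx).trans (le_abs_self D)) (hC x) (abs_nonneg _) (abs_nonneg _)
  · rw [h0 x hx, mul_zero, abs_zero]
    exact mul_nonneg (abs_nonneg _) ((abs_nonneg _).trans (hC x))

end IsLocBdd

namespace VBChart

/-- `Λ` is, on the test functions in a chart domain, the integral with respect to a real Radon
measure on the image of the chart. -/
def IsRadonFunctional (a : VBChart n m W) (Λ : (X → ℝ) → ℝ) : Prop :=
  ∃ ρ : RealRadonMeasure (a.img univ), ∀ f, IsTestFun a.dom f →
    ∫ y, f (a.point y) ∂ρ.pos - ∫ y, f (a.point y) ∂ρ.neg = Λ f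

theorem isRadonFunctional_zero (a : VBChart n m W) : a.IsRadonFunctional fun _ => 0 :=
  ⟨⟨0, 0, inferInstance, inferInstance, Measure.MutuallySingular.zero_right⟩, fun _ _ => by simp⟩

/-- The representative in the chart `b` of the measure `h⁺ μ` on `X`. -/
def localMeasure (b : VBChart n m W) (μ : Measure X) (h : X → ℝ) : Measure (b.img univ) :=
  (μ.withDensity fun x => ENNReal.ofReal (h x)).comap b.point

variable [BorelSpace X]

theorem isFiniteMeasureOnCompacts_localMeasure [T2Space X] (b : VBChart n m W) (μ : Measure X)
    [IsFiniteMeasure μ] {h : X → ℝ} (hh : IsLocBdd b.dom h) :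
    IsFiniteMeasureOnCompacts (b.localMeasure μ h) := by
  refine ⟨fun L hL => ?_⟩
  have hL' : IsCompact (b.point '' L) := hL.image b.isOpenEmbedding_point.continuous
  obtain ⟨C, hC⟩ := hh.exists_bound _ hL' (image_subset_iff.2 fun y _ => b.point_mem y)
  rw [localMeasure, b.measurableEmbedding_point.comap_apply,
    withDensity_apply _ hL'.measurableSet]
  refine (setLIntegral_mono (g := fun _ => ENNReal.ofReal C) measurable_const fun x hx =>
    ENNReal.ofReal_le_ofReal ((le_abs_self _).trans (hC x hx))).trans_lt ?_
  rw [setLIntegral_const]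
  exact ENNReal.mul_lt_top ENNReal.ofReal_lt_top (measure_lt_top _ _)

theorem integral_localMeasure (b : VBChart n m W) (μ : Measure X) {h : X → ℝ}
    (hh : Measurable h) {f : X → ℝ} (hf : IsTestFun b.dom f) :
    ∫ y, f (b.point y) ∂b.localMeasure μ h = ∫ x, max (h x) 0 * f x ∂μ := by
  obtain ⟨K, _, _, hKU, h0, _⟩ := hf.exists_compact
  rw [← b.measurableEmbedding_point.integral_map (μ := b.localMeasure μ h) (g := f),
    localMeasure, b.measurableEmbedding_point.map_comap, b.range_point,
    setIntegral_eq_integral_of_forall_compl_eq_zero fun x hx => h0 x fun hxK => hx (hKU hxK),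
    integral_withDensity_eq_integral_toReal_smul hh.ennreal_ofReal
      (.of_forall fun _ => ENNReal.ofReal_lt_top)]
  simp only [ENNReal.toReal_ofReal', smul_eq_mul]

variable [CompactSpace X] [T2Space X]

theorem isRadonFunctional_integral_mul (a : VBChart n m W) (μ : Measure X) [IsFiniteMeasure μ]
    {h : X → ℝ} (hh : IsLocBdd a.dom h) : a.IsRadonFunctional fun f => ∫ x, h x * f x ∂μ := by
  have := a.locallyCompactSpace_img
  have := a.isFiniteMeasureOnCompacts_localMeasure μ hh
  have := a.isFiniteMeasureOnCompacts_localMeasure μ hh.neg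
  obtain ⟨ρ, -, -, hρ⟩ := exists_realRadonMeasure_sub (a.localMeasure μ h)
    (a.localMeasure μ fun x => -h x)
  refine ⟨ρ, fun f hf => ?_⟩
  rw [hρ _ (a.integrable_point _ hf) (a.integrable_point _ hf),
    a.integral_localMeasure _ hh.measurable hf, a.integral_localMeasure _ hh.neg.measurable hf,
    ← integral_sub ((hh.max_zero.mul_isTestFun hf).isBddMeas.integrable _)
      ((hh.neg.max_zero.mul_isTestFun hf).isBddMeas.integrable _)]
  simp only [← sub_mul, max_zero_sub_max_neg_zero_eq_self]

namespace IsRadonFunctional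

variable {a : VBChart n m W} {Λ Λ' : (X → ℝ) → ℝ}

theorem add (hΛ : a.IsRadonFunctional Λ) (hΛ' : a.IsRadonFunctional Λ') :
    a.IsRadonFunctional fun f => Λ f + Λ' f := by
  obtain ⟨σ, hσ⟩ := hΛ
  obtain ⟨τ, hτ⟩ := hΛ'
  have := a.locallyCompactSpace_img
  have hfin (μ ν : Measure (a.img univ)) [IsFiniteMeasureOnCompacts μ]
      [IsFiniteMeasureOnCompacts ν] : IsFiniteMeasureOnCompacts (μ + ν) := ⟨fun K hK => by
    rw [Measure.add_apply]
    exact ENNReal.add_lt_top.2 ⟨hK.measure_lt_top, hK.measure_lt_top⟩⟩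
  obtain ⟨ρ, -, -, hρ⟩ := exists_realRadonMeasure_sub (σ.pos + τ.pos) (σ.neg + τ.neg)
  refine ⟨ρ, fun f hf => ?_⟩
  have hint (μ : Measure (a.img univ)) [IsFiniteMeasureOnCompacts μ] := a.integrable_point μ hf
  rw [hρ _ (hint _) (hint _), integral_add_measure (hint _) (hint _),
    integral_add_measure (hint _) (hint _), add_sub_add_comm, hσ f hf, hτ f hf]

theorem sum {P : Type*} (s : Finset P) {Λ : P → (X → ℝ) → ℝ}
    (hΛ : ∀ p, a.IsRadonFunctional (Λ p)) : a.IsRadonFunctional fun f => ∑ p ∈ s, Λ p f := by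
  classical
  induction s using Finset.induction_on with
  | empty => simpa using a.isRadonFunctional_zero
  | insert p s hp ih =>
    simp only [Finset.sum_insert hp]
    exact (hΛ p).add ih

end IsRadonFunctional

end VBChart

variable [BorelSpace X] [T2Space X] {ι : Type}

namespace CoordBundle.Sec

variable {E : CoordBundle n m W ι} {R : Body n X} {k : ℕ}

theorem integrableOn_mul (s : E.Sec R k) {a : VBChart n m W} (c : ι) {K : Set X}
    (hK : IsCompact K) (hKa : K ⊆ a.dom) {u : X → ℝ} (hu : Continuous u) (μ : Measure X)
    [IsFiniteMeasure μ] : IntegrableOn (fun x => u x * E.comp a s.1 c x) K μ := by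
  refine IntegrableOn.of_forall_sdiff_eq_zero (s := K ∩ R.carrier)
    (ContinuousOn.integrableOn_compact (hK.inter R.isCompact) (hu.continuousOn.mul
      ((continuousOn s a c).mono (inter_subset_inter_left _ hKa)))) hK.measurableSet fun x hx => ?_
  rw [comp_eq_zero s a c fun hxR => hx.2 ⟨hx.1, hxR⟩, mul_zero]

variable [CompactSpace X] [IsManifold (quadrant n) ∞ X]

theorem isTestFun_of_support_subset (s : E.Sec (Body.whole n X) k) {a : VBChart n m W}
    (hs : closure {x | s.1 x ≠ 0} ⊆ a.dom) (c : ι) : IsTestFun a.dom (E.comp a s.1 c) := by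
  refine .of_continuousOn isClosed_closure.isCompact hs
    ((continuousOn s a c).mono fun x hx => ⟨hs hx, mem_univ x⟩) fun x hx => ?_
  rw [CoordBundle.comp, not_not.1 fun h => hx (subset_closure h), map_zero]
  rfl

end CoordBundle.Sec

variable [CompactSpace X] [IsManifold (quadrant n) ∞ X] [Fintype ι]

namespace BundleMeasure

variable {E₀ : CoordBundle n m W ι}

theorem exists_int_eq {Λ : VBChart n m W → ι → (X → ℝ) → ℝ}
    (hΛ : ∀ (a : VBChart n m W) c, a.IsRadonFunctional (Λ a c))
    (hcompat : ∀ (a b : VBChart n m W) (χ : E₀.Sec (Body.whole n X) 0),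
      closure {x | χ.1 x ≠ 0} ⊆ a.dom ∩ b.dom →
        ∑ c, Λ a c (E₀.comp a χ.1 c) = ∑ c, Λ b c (E₀.comp b χ.1 c)) :
    ∃ ς : BundleMeasure E₀, ∀ a c f, IsTestFun a.dom f → ς.int a c f = Λ a c f := by
  choose ρ hρ using hΛ
  have hρΛ (a : VBChart n m W) (χ : E₀.Sec (Body.whole n X) 0)
      (hχ : closure {x | χ.1 x ≠ 0} ⊆ a.dom) (c : ι) :
      (ρ a c).integralOn univ (fun y => E₀.rep a χ.1 y c) = Λ a c (E₀.comp a χ.1 c) := by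
    rw [RealRadonMeasure.integralOn, Measure.restrict_univ, Measure.restrict_univ,
      ← hρ a c _ (CoordBundle.Sec.isTestFun_of_support_subset χ hχ c)]
    rfl
  refine ⟨⟨ρ, fun a b χ hχ hs => ?_⟩, fun a c f hf => hρ a c f hf⟩
  simp only [hρΛ a ⟨χ, hχ⟩ (hs.trans inter_subset_left),
    hρΛ b ⟨χ, hχ⟩ (hs.trans inter_subset_right)]
  exact hcompat a b ⟨χ, hχ⟩ hs

theorem exists_sum {P : Type*} [Fintype P] (ς : P → BundleMeasure E₀) :
    ∃ σ : BundleMeasure E₀, ∀ (R : Body n X) (E₁ : CoordBundle n m W ι) (χ : E₁.Sec R 0)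
      (v : P → ℝ), (∀ p, (ς p).HasIntegral R χ (v p)) → σ.HasIntegral R χ (∑ p, v p) := by
  obtain ⟨σ, hσ⟩ := exists_int_eq (E₀ := E₀) (Λ := fun a c f => ∑ p, (ς p).int a c f)
    (fun a c => .sum _ fun p => ⟨(ς p).meas a c, fun _ _ => rfl⟩) fun a b χ hχ => by
      simp only [← integralOn_univ_rep]
      rw [Finset.sum_comm, Finset.sum_congr rfl fun p _ => (ς p).compat a b χ.1 χ.2 hχ,
        Finset.sum_comm]
  refine ⟨σ, fun R E₁ χ v hv => (σ.hasIntegral_iff χ _).2 fun 𝔓 => ?_⟩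
  have hσ' (i c) := hσ (𝔓.chart i) c _
    (CoordBundle.Sec.isTestFun χ _ c (𝔓.u i).continuous (𝔓.tsupport_subset i))
  simp only [glued, hσ', ← ((ς _).hasIntegral_iff χ _).1 (hv _) 𝔓]
  exact (Finset.sum_congr rfl fun i _ => Finset.sum_comm).trans Finset.sum_comm

end BundleMeasure

end RadonFunctionals

section Construction

variable {n m : ℕ} {X : Type u} [TopologicalSpace X] [ChartedSpace (EuclideanQuadrant n) X]
  {W : X → Type u} [∀ x, AddCommGroup (W x)] [∀ x, Module ℝ (W x)]
  [TopologicalSpace (TotalSpace (EuclideanSpace ℝ (Fin m)) W)] [∀ x, TopologicalSpace (W x)]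
  [FiberBundle (EuclideanSpace ℝ (Fin m)) W] {ι : Type} [Fintype ι]
  {E : Body n X → CoordBundle n m W ι}

namespace HasSmoothTransitions

/-- The density, in the chart `b`, of the functional `χ ↦ z * ∫ x in K, χ_a^c`, where `K` lies in
the domain of the chart `a`. -/
def density (hE : HasSmoothTransitions E) (z : ℝ) (K : Set X) (a b : VBChart n m W)
    (c q : ι) : X → ℝ :=
  (K ∩ b.dom).indicator fun x => z * hE.transition b a c q x

variable {a : VBChart n m W} {K : Set X}

theorem sum_density_mul_comp (hE : HasSmoothTransitions E) (hKa : K ⊆ a.dom) (z : ℝ)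
    {R : Body n X} (χ : (E R).Sec R 0) {b : VBChart n m W} (c : ι) {x : X} (hx : x ∈ b.dom) :
    ∑ q, hE.density z K a b c q x * (E R).comp b χ.1 q x =
      K.indicator (fun x => z * (E R).comp a χ.1 c x) x := by
  by_cases hxK : x ∈ K
  · simp only [density, indicator_of_mem hxK, indicator_of_mem (mem_inter hxK hx)]
    by_cases hxR : x ∈ R.carrier
    · rw [hE.comp_eq_sum b a ⟨⟨hx, hKa hxK⟩, hxR⟩, Finset.mul_sum]
      exact Finset.sum_congr rfl fun q _ => mul_assoc _ _ _
    · simp only [CoordBundle.Sec.comp_eq_zero χ _ _ hxR, mul_zero, Finset.sum_const_zero]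
  · simp only [density, indicator_of_notMem hxK,
      indicator_of_notMem fun h => hxK (inter_subset_left h), zero_mul, Finset.sum_const_zero]

variable [T2Space X] [MeasurableSpace X] [BorelSpace X]

theorem isLocBdd_density (hE : HasSmoothTransitions E) (hKa : K ⊆ a.dom) (hK : IsCompact K)
    (z : ℝ) (b : VBChart n m W) (c q : ι) :
    IsLocBdd b.dom (hE.density z K a b c q) := by
  classical
  have hcont : ContinuousOn (fun x => z * hE.transition b a c q x) (K ∩ b.dom) :=
    continuousOn_const.mul ((hE.smoothOn_transition b a c q).continuousOn.mono
      fun x hx => ⟨hx.2, hKa hx.1⟩)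
  refine ⟨?_, fun L hL hLb => ?_⟩
  · have := hcont.measurable_piecewise (g := 0) continuousOn_const
      (hK.measurableSet.inter b.isOpen_dom.measurableSet)
    rwa [piecewise_eq_indicator] at this
  · obtain ⟨C, hC⟩ := (hK.inter hL).exists_bound_of_continuousOn
      (hcont.mono (inter_subset_inter_right _ hLb))
    refine ⟨max C 0, fun x hx => ?_⟩
    by_cases hxK : x ∈ K ∩ b.dom
    · rw [density, indicator_of_mem hxK]
      exact (hC x ⟨hxK.1, hx⟩).trans (le_max_left _ _)
    · rw [density, indicator_of_notMem hxK, abs_zero]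
      exact le_max_right _ _

theorem sum_integral_density (hE : HasSmoothTransitions E) (hKa : K ⊆ a.dom) (hK : IsCompact K)
    (μ : Measure X) [IsFiniteMeasure μ] (z : ℝ) {R : Body n X} (χ : (E R).Sec R 0)
    {b : VBChart n m W} (c : ι) {u : X → ℝ}
    (hu : ∀ q, IsTestFun b.dom fun x => u x * (E R).comp b χ.1 q x)
    (hu0 : ∀ x ∉ b.dom, u x * (E R).comp a χ.1 c x = 0) :
    ∑ q, ∫ x, hE.density z K a b c q x * (u x * (E R).comp b χ.1 q x) ∂μ =
      z * ∫ x in K, u x * (E R).comp a χ.1 c x ∂μ := by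
  rw [← integral_finsetSum _ fun q _ =>
      ((hE.isLocBdd_density hKa hK z b c q).mul_isTestFun (hu q)).isBddMeas.integrable μ,
    ← integral_const_mul, ← integral_indicator hK.measurableSet]
  refine integral_congr_ae (.of_forall fun x => ?_)
  by_cases hx : x ∈ b.dom
  · simp only [mul_left_comm _ (u x), ← Finset.mul_sum, hE.sum_density_mul_comp hKa z χ c hx,
      indicator_mul_right]
  · have hdensity (q) : hE.density z K a b c q x = 0 :=
      indicator_of_notMem (fun h => hx h.2) _
    simp only [hdensity, zero_mul, Finset.sum_const_zero]
    exact ((indicator_apply_eq_zero).2 fun _ => by rw [hu0 x hx, mul_zero]).symm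

variable [CompactSpace X] [IsManifold (quadrant n) ∞ X]

theorem exists_bundleMeasure_of_measure (hE : HasSmoothTransitions E) (hKa : K ⊆ a.dom)
    (hK : IsCompact K) (μ : Measure X) [IsFiniteMeasure μ] (z : ℝ) (c : ι) :
    ∃ ς : BundleMeasure (E (Body.whole n X)), ∀ (R : Body n X) (χ : (E R).Sec R 0),
      ς.HasIntegral R χ (z * ∫ x in K, (E R).comp a χ.1 c x ∂μ) := by
  have hlocal (b : VBChart n m W) (χ : (E (Body.whole n X)).Sec (Body.whole n X) 0)
      (hχ : closure {x | χ.1 x ≠ 0} ⊆ b.dom) :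
      ∑ q, ∫ x, hE.density z K a b c q x * (E (Body.whole n X)).comp b χ.1 q x ∂μ =
        z * ∫ x in K, (E (Body.whole n X)).comp a χ.1 c x ∂μ := by
    have := hE.sum_integral_density hKa hK μ z χ (b := b) c (u := fun _ => 1)
      (fun q => by simpa only [one_mul] using
        CoordBundle.Sec.isTestFun_of_support_subset χ hχ q)
      fun x hx => by
        rw [CoordBundle.comp, not_not.1 fun h => hx (hχ (subset_closure h)), map_zero]
        exact mul_zero _
    simpa only [one_mul] using this
  obtain ⟨ς, hς⟩ := BundleMeasure.exists_int_eq
    (fun b q => b.isRadonFunctional_integral_mul μ (hE.isLocBdd_density hKa hK z b c q))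
    fun b b' χ hχ => (hlocal b χ (hχ.trans inter_subset_left)).trans
      (hlocal b' χ (hχ.trans inter_subset_right)).symm
  refine ⟨ς, fun R χ => (ς.hasIntegral_iff χ _).2 fun 𝔓 => ?_⟩
  have htest (i q) := CoordBundle.Sec.isTestFun χ _ q (𝔓.u i).continuous (𝔓.tsupport_subset i)
  have hzero (i) (x) (hx : x ∉ (𝔓.chart i).dom) : 𝔓.u i x * (E R).comp a χ.1 c x = 0 := by
    rw [image_eq_zero_of_notMem_tsupport fun h => hx (𝔓.tsupport_subset i h), zero_mul]
  simp only [BundleMeasure.glued, hς _ _ _ (htest _ _),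
    hE.sum_integral_density hKa hK μ z χ c (htest _) (hzero _)]
  rw [← Finset.mul_sum, ← integral_finsetSum _ fun i _ =>
    CoordBundle.Sec.integrableOn_mul χ c hK hKa (𝔓.u i).continuous μ]
  simp only [← Finset.sum_mul, 𝔓.sum_eq_one, one_mul]

end HasSmoothTransitions

theorem HasSmoothTransitions.exists_bundleMeasure [T2Space X] [MeasurableSpace X] [BorelSpace X]
    [CompactSpace X] [IsManifold (quadrant n) ∞ X] (hE : HasSmoothTransitions E) {P : Type*}
    [Fintype P] (a : P → VBChart n m W) {K : P → Set X} (hK : ∀ p, IsCompact (K p))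
    (hKa : ∀ p, K p ⊆ (a p).dom) (μ : P → Measure X) [∀ p, IsFiniteMeasure (μ p)] (z : P → ℝ)
    (c : P → ι) : ∃ ς : BundleMeasure (E (Body.whole n X)), ∀ (R : Body n X)
      (χ : (E R).Sec R 0), ς.HasIntegral R χ
        (∑ p, z p * ∫ x in K p, (E R).comp (a p) χ.1 (c p) x ∂μ p) := by
  choose ς hς using fun p =>
    hE.exists_bundleMeasure_of_measure (hKa p) (hK p) (μ p) (z p) (c p)
  obtain ⟨σ, hσ⟩ := BundleMeasure.exists_sum ς
  exact ⟨σ, fun R χ => hσ R (E R) χ _ fun p => hς p R χ⟩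

end Construction

section Representation

open scoped CompactlySupported

section SupZero

variable {Z : Type*} [TopologicalSpace Z] [CompactSpace Z]

theorem le_norm_sup_zero (f : C(Z, ℝ)) (z : Z) : f z ≤ ‖f ⊔ 0‖ :=
  (le_max_left _ _).trans ((le_abs_self _).trans ((f ⊔ 0).norm_coe_le_norm z))

theorem norm_sup_zero_le (f : C(Z, ℝ)) {M : ℝ} (hM : 0 ≤ M) (hf : ∀ z, f z ≤ M) :
    ‖f ⊔ 0‖ ≤ M := by
  refine (ContinuousMap.norm_le _ hM).2 fun z => ?_
  rw [ContinuousMap.sup_apply, ContinuousMap.zero_apply, Real.norm_of_nonneg (le_max_right _ _)]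
  exact max_le (hf z) hM

theorem norm_smul_sup_zero {c : ℝ} (hc : 0 ≤ c) (f : C(Z, ℝ)) : ‖c • f ⊔ 0‖ = c * ‖f ⊔ 0‖ := by
  have hsup : c • f ⊔ 0 = c • (f ⊔ 0) := by
    ext z
    simp only [ContinuousMap.sup_apply, ContinuousMap.smul_apply, ContinuousMap.zero_apply,
      smul_eq_mul, mul_max_of_nonneg _ _ hc, mul_zero]
  rw [hsup, norm_smul, Real.norm_of_nonneg hc]

theorem norm_add_sup_zero_le (f g : C(Z, ℝ)) : ‖(f + g) ⊔ 0‖ ≤ ‖f ⊔ 0‖ + ‖g ⊔ 0‖ :=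
  norm_sup_zero_le _ (by positivity) fun z =>
    add_le_add (le_norm_sup_zero f z) (le_norm_sup_zero g z)

variable [T2Space Z] [MeasurableSpace Z] [BorelSpace Z]

theorem exists_measure_of_nonneg (Λ : C(Z, ℝ) →ₗ[ℝ] ℝ) (hΛ : ∀ f, 0 ≤ f → 0 ≤ Λ f) :
    ∃ μ : Measure Z, IsFiniteMeasure μ ∧ ∀ f : C(Z, ℝ), Λ f = ∫ z, f z ∂μ := by
  let Λ' : C_c(Z, ℝ) →ₚ[ℝ] ℝ := PositiveLinearMap.mk₀
    { toFun := fun f => Λ f.toContinuousMap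
      map_add' := fun f g => Λ.map_add f.toContinuousMap g.toContinuousMap
      map_smul' := fun c f => Λ.map_smul c f.toContinuousMap } fun f hf => hΛ _ hf
  refine ⟨RealRMK.rieszMeasure Λ', ⟨isCompact_univ.measure_lt_top⟩, fun f => ?_⟩
  exact (RealRMK.integral_rieszMeasure Λ'
    (CompactlySupportedContinuousMap.continuousMapEquiv f)).symm

/- Hahn-Banach is applied on `V × C(Z, ℝ)` rather than on `C(Z, ℝ)`: the sublinear bound forces the
extension to vanish on the pairs `(w, -L w)`, so `L` need not be injective. -/
theorem exists_measure_of_le {V : Type*} [AddCommGroup V] [Module ℝ V] (L : V →ₗ[ℝ] C(Z, ℝ))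
    (F : V →ₗ[ℝ] ℝ) {C : ℝ} (hC : 0 ≤ C) (hF : ∀ w, F w ≤ C * ‖L w ⊔ 0‖) :
    ∃ μ : Measure Z, IsFiniteMeasure μ ∧ ∀ w, F w = ∫ z, L w z ∂μ := by
  let Φ : V × C(Z, ℝ) →ₗ[ℝ] C(Z, ℝ) := L.coprod LinearMap.id
  let F₀ : V × C(Z, ℝ) →ₗ.[ℝ] ℝ :=
    ⟨Submodule.prod ⊤ ⊥, F ∘ₗ LinearMap.fst ℝ V C(Z, ℝ) ∘ₗ Submodule.subtype _⟩
  obtain ⟨g, hgF, hgΦ⟩ := exists_extension_of_le_sublinear F₀ (fun p => C * ‖Φ p ⊔ 0‖)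
    (fun c hc p => by rw [map_smul, norm_smul_sup_zero hc.le, mul_left_comm])
    (fun p q => by
      rw [map_add, ← mul_add]
      exact mul_le_mul_of_nonneg_left (norm_add_sup_zero_le _ _) hC) (by
      rintro ⟨⟨w, f⟩, hp⟩
      obtain rfl : f = 0 := hp.2
      simpa [Φ, F₀] using hF w)
  have hg_nonpos (p) (hp : ∀ z, Φ p z ≤ 0) : g p ≤ 0 :=
    (hgΦ p).trans (mul_nonpos_of_nonneg_of_nonpos hC (norm_sup_zero_le _ le_rfl hp))
  have hg_ker (w) : g (w, -L w) = 0 := by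
    refine le_antisymm (hg_nonpos _ fun z => by simp [Φ]) (neg_nonpos.1 ?_)
    rw [← map_neg]
    exact hg_nonpos _ fun z => by simp [Φ]
  obtain ⟨μ, hμ, hgμ⟩ := exists_measure_of_nonneg (g ∘ₗ LinearMap.inr ℝ V C(Z, ℝ)) fun f hf => by
    have hg_neg : g (-LinearMap.inr ℝ V C(Z, ℝ) f) ≤ 0 :=
      hg_nonpos _ fun z => by simpa [Φ] using hf z
    rwa [map_neg, neg_nonpos] at hg_neg
  refine ⟨μ, hμ, fun w => ?_⟩
  calc F w = g (w, 0) := (hgF ⟨(w, 0), by simp [F₀]⟩).symm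
    _ = g ((w, -L w) + LinearMap.inr ℝ V C(Z, ℝ) (L w)) := by simp
    _ = g (LinearMap.inr ℝ V C(Z, ℝ) (L w)) := by rw [map_add, hg_ker, zero_add]
    _ = ∫ z, L w z ∂μ := hgμ (L w)

end SupZero

variable {X : Type*} [TopologicalSpace X] [MeasurableSpace X] [BorelSpace X]

theorem exists_integral_sigma_eq_sum {P : Type*} [Fintype P] {K : P → Set X}
    (hK : ∀ p, MeasurableSet (K p)) [MeasurableSpace (Σ p, K p)] [BorelSpace (Σ p, K p)]
    (μ : Measure (Σ p, K p)) [IsFiniteMeasure μ] :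
    ∃ ν : P → Measure X, (∀ p, IsFiniteMeasure (ν p)) ∧ ∀ f : P → X → ℝ,
      (∀ p, ContinuousOn (f p) (K p)) → Integrable (fun z : Σ p, K p => f z.1 z.2) μ →
        ∫ z, f z.1 z.2 ∂μ = ∑ p, ∫ x in K p, f p x ∂ν p := by
  classical
  let A (p : P) : Set (Σ p, K p) := range (Sigma.mk p)
  have hA (p) : MeasurableSet (A p) := isOpen_range_sigmaMk.measurableSet
  have hAuniv : ⋃ p, A p = univ := eq_univ_of_forall fun z => mem_iUnion.2 ⟨z.1, z.2, rfl⟩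
  have hAdisj : Pairwise fun p q => Disjoint (A p) (A q) := by
    refine fun p q hpq => disjoint_left.2 ?_
    rintro _ ⟨x, rfl⟩ ⟨y, hy⟩
    exact hpq (congrArg Sigma.fst hy).symm
  have hval : Measurable fun z : Σ p, K p => (z.2 : X) :=
    (continuous_sigma fun p => continuous_subtype_val).measurable
  refine ⟨fun p => (μ.restrict (A p)).map fun z => z.2, fun p => inferInstance,
    fun f hf hfμ => ?_⟩
  rw [← setIntegral_univ, ← hAuniv, integral_iUnion_fintype hA hAdisj fun p => hfμ.integrableOn]
  refine Finset.sum_congr rfl fun p _ => ?_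
  have hmeas : Measurable ((K p).indicator (f p)) := by
    rw [← piecewise_eq_indicator]
    exact (hf p).measurable_piecewise continuousOn_const (hK p)
  rw [← integral_indicator (hK p), integral_map hval.aemeasurable hmeas.aestronglyMeasurable]
  refine setIntegral_congr_fun (hA p) ?_
  rintro _ ⟨x, rfl⟩
  exact (indicator_of_mem x.2 _).symm

theorem exists_measures_of_le [T2Space X] {P : Type*} [Fintype P] {K : P → Set X}
    (hK : ∀ p, IsCompact (K p)) {V : Type*} [AddCommGroup V] [Module ℝ V] (L : V → P → X → ℝ)
    (hL : ∀ w p, ContinuousOn (L w p) (K p))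
    (hadd : ∀ w w' p, ∀ x ∈ K p, L (w + w') p x = L w p x + L w' p x)
    (hsmul : ∀ (c : ℝ) w p, ∀ x ∈ K p, L (c • w) p x = c * L w p x)
    (F : V →ₗ[ℝ] ℝ) {C : ℝ} (hC : 0 ≤ C)
    (hF : ∀ w (M : ℝ), 0 ≤ M → (∀ p, ∀ x ∈ K p, L w p x ≤ M) → F w ≤ C * M) :
    ∃ μ : P → Measure X, (∀ p, IsFiniteMeasure (μ p)) ∧
      ∀ w, F w = ∑ p, ∫ x in K p, L w p x ∂μ p := by
  let Z := Σ p, K p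
  have (p : P) : CompactSpace (K p) := isCompact_iff_compactSpace.1 (hK p)
  let _ : MeasurableSpace Z := borel Z
  have : BorelSpace Z := ⟨rfl⟩
  let L' : V →ₗ[ℝ] C(Z, ℝ) :=
    { toFun := fun w => ⟨fun z => L w z.1 z.2.1, continuous_sigma fun p =>
        continuousOn_iff_continuous_domRestrict.1 (hL w p)⟩
      map_add' := fun w w' => ContinuousMap.ext fun z => hadd w w' z.1 z.2.1 z.2.2
      map_smul' := fun c w => ContinuousMap.ext fun z => hsmul c w z.1 z.2.1 z.2.2 }
  obtain ⟨μ, hμ, hFμ⟩ := exists_measure_of_le L' F hC fun w =>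
    hF w _ (norm_nonneg _) fun p x hx => le_norm_sup_zero (L' w) ⟨p, x, hx⟩
  obtain ⟨ν, hν, hμν⟩ := exists_integral_sigma_eq_sum (fun p => (hK p).measurableSet) μ
  exact ⟨ν, hν, fun w => (hFμ w).trans (hμν (L w) (hL w)
    ((L' w).continuous.integrable_of_hasCompactSupport (.of_compactSpace _)))⟩

end Representation

section ForceRepresentation

variable {n m r : ℕ} {X : Type u} [TopologicalSpace X] [ChartedSpace (EuclideanQuadrant n) X]
  {W : X → Type u} [∀ x, AddCommGroup (W x)] [∀ x, Module ℝ (W x)]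
  [TopologicalSpace (TotalSpace (EuclideanSpace ℝ (Fin m)) W)] [∀ x, TopologicalSpace (W x)]
  [FiberBundle (EuclideanSpace ℝ (Fin m)) W]

/-- The partial derivative of a section selected by a chart, a multi-index and a component, with
the sign selected by the Boolean. A bound for all of them bounds the `C^r`-norm. -/
def signedPd {R : Body n X} (𝔎 : PrecompactAtlas m W R)
    (p : Bool × Fin 𝔎.A × JetIdx n r × Fin m) (w : CrSec m W R r) (x : X) : ℝ :=
  cond p.1 1 (-1) * secPd R (𝔎.chart p.2.1) p.2.2.1.2.1 p.2.2.2 w.1 x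

theorem PrecompactAtlas.crNorm_le_of_signedPd_le {R : Body n X} (𝔎 : PrecompactAtlas m W R)
    (w : CrSec m W R r) {M : ℝ} (hM : 0 ≤ M)
    (hw : ∀ p, ∀ x ∈ 𝔎.K p.2.1, signedPd 𝔎 p w x ≤ M) : 𝔎.crNorm r w ≤ M := by
  refine 𝔎.crNorm_le w hM fun i α k I hk x hx => ?_
  have hsort : secPd R (𝔎.chart i) (JetIdx.sort hk I).2.1 α w.1 x =
      secPd R (𝔎.chart i) I α w.1 x :=
    (𝔎.chart i).pd_sort R hk I (CoordBundle.Sec.smoothOn (E := baseBundle n m W) w _ α)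
      (𝔎.subset i hx)
  have hpos := hw (true, i, JetIdx.sort hk I, α) x hx
  have hneg := hw (false, i, JetIdx.sort hk I, α) x hx
  simp only [signedPd, cond_true, cond_false, one_mul, neg_one_mul] at hpos hneg
  rw [← hsort, abs_le]
  exact ⟨neg_le.1 hneg, hpos⟩

theorem Force.exists_measures [T2Space X] [MeasurableSpace X] [BorelSpace X] {R : Body n X}
    (F : Force m W R r) : ∃ (𝔎 : PrecompactAtlas m W R)
      (μ : Bool × Fin 𝔎.A × JetIdx n r × Fin m → Measure X), (∀ p, IsFiniteMeasure (μ p)) ∧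
      ∀ w, F.toLin w = ∑ p, (cond p.1 1 (-1) : ℝ) * ∫ x in 𝔎.K p.2.1,
        secPd R (𝔎.chart p.2.1) p.2.2.1.2.1 p.2.2.2 w.1 x ∂μ p := by
  obtain ⟨𝔎, C, hC⟩ := F.bounded
  have hr (p : Bool × Fin 𝔎.A × JetIdx n r × Fin m) : (p.2.2.1.1 : ℕ) ≤ r :=
    Nat.lt_succ_iff.1 p.2.2.1.1.2
  obtain ⟨μ, hμ, hFμ⟩ := exists_measures_of_le
    (fun p : Bool × Fin 𝔎.A × JetIdx n r × Fin m => 𝔎.isCompact p.2.1)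
    (fun w p => signedPd 𝔎 p w)
    (fun w p => continuousOn_const.mul
      ((continuousOn_secPd w _ (hr p) _ _).mono (𝔎.subset p.2.1)))
    (fun w w' p x hx => by
      simp only [signedPd]
      rw [secPd_add w w' _ (hr p) _ _ (𝔎.subset p.2.1 hx), mul_add])
    (fun c w p x hx => by
      simp only [signedPd]
      rw [secPd_smul c w _ (hr p) _ _ (𝔎.subset p.2.1 hx), mul_left_comm])
    F.toLin (le_max_right C 0) fun w M hM hw => calc
      F.toLin w ≤ C * 𝔎.crNorm r w := (le_abs_self _).trans (hC w)
      _ ≤ max C 0 * 𝔎.crNorm r w :=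
        mul_le_mul_of_nonneg_right (le_max_left C 0) (𝔎.crNorm_nonneg w)
      _ ≤ max C 0 * M := mul_le_mul_of_nonneg_left (𝔎.crNorm_le_of_signedPd_le w hM hw)
        (le_max_right C 0)
  exact ⟨𝔎, μ, hμ, fun w => (hFμ w).trans
    (Finset.sum_congr rfl fun p _ => integral_const_mul _ _)⟩

end ForceRepresentation

section CoordinateSegments

variable {n m : ℕ} {X : Type u} [TopologicalSpace X] [ChartedSpace (EuclideanQuadrant n) X]
  {W : X → Type u} [∀ x, AddCommGroup (W x)] [∀ x, Module ℝ (W x)]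
  [TopologicalSpace (TotalSpace (EuclideanSpace ℝ (Fin m)) W)] [∀ x, TopologicalSpace (W x)]
  [FiberBundle (EuclideanSpace ℝ (Fin m)) W]

namespace VBChart

/-- The curve in `X` through `x` which in the chart `a` is the line parallel to the `i`-th
coordinate axis. -/
def coordLine (a : VBChart n m W) (x : X) (i : Fin n) (t : ℝ) : X :=
  a.inv (a.ext x + t • EuclideanSpace.single i 1)

theorem exists_segment (a : VBChart n m W) {x : X} (hx : x ∈ a.dom) (i : Fin n) :
    ∃ ε > 0, ∀ t ∈ Icc (0 : ℝ) ε, a.ext x + t • EuclideanSpace.single i 1 ∈ a.img univ := by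
  have himg : a.img univ ∈ 𝓝[range (quadrant n)] a.ext x := by
    rw [VBChart.ext, ← a.chart.map_extend_nhds (I := quadrant n) hx.1, img, inter_univ]
    exact Filter.image_mem_map (a.isOpen_dom.mem_nhds hx)
  have hcont : Continuous fun t : ℝ => a.ext x + t • EuclideanSpace.single i (1 : ℝ) := by
    fun_prop
  have hquadrant (t : ℝ) (ht : 0 ≤ t) :
      a.ext x + t • EuclideanSpace.single i (1 : ℝ) ∈ range (quadrant n) := by
    refine ⟨⟨a.ext x + t • EuclideanSpace.single i 1, fun j => ?_⟩, rfl⟩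
    have hsingle : 0 ≤ (EuclideanSpace.single i (1 : ℝ) : EuclideanSpace ℝ (Fin n)) j := by
      rw [PiLp.single_apply]
      split_ifs <;> simp
    exact add_nonneg ((a.chart x).2 j) (mul_nonneg ht hsingle)
  have htendsto : Filter.Tendsto (fun t : ℝ => a.ext x + t • EuclideanSpace.single i (1 : ℝ))
      (𝓝[≥] 0) (𝓝[range (quadrant n)] a.ext x) :=
    tendsto_nhdsWithin_iff.2 ⟨(hcont.tendsto' 0 _ (by simp)).mono_left nhdsWithin_le_nhds,
      Filter.eventually_of_mem self_mem_nhdsWithin hquadrant⟩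
  obtain ⟨ε, hε, hseg⟩ := mem_nhdsGE_iff_exists_Icc_subset.1 (htendsto himg)
  exact ⟨ε, hε, hseg⟩

variable {a : VBChart n m W} {x : X} {i : Fin n} {ε : ℝ}

theorem mapsTo_coordLine
    (hseg : ∀ t ∈ Icc (0 : ℝ) ε, a.ext x + t • EuclideanSpace.single i 1 ∈ a.img univ) :
    MapsTo (a.coordLine x i) (Icc 0 ε) a.dom :=
  fun t ht => (a.inv_mem (hseg t ht)).1

theorem continuousOn_coordLine
    (hseg : ∀ t ∈ Icc (0 : ℝ) ε, a.ext x + t • EuclideanSpace.single i 1 ∈ a.img univ) :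
    ContinuousOn (a.coordLine x i) (Icc 0 ε) :=
  (a.continuousOn_inv univ).comp (by fun_prop) hseg

theorem injOn_coordLine
    (hseg : ∀ t ∈ Icc (0 : ℝ) ε, a.ext x + t • EuclideanSpace.single i 1 ∈ a.img univ) :
    InjOn (a.coordLine x i) (Icc 0 ε) := by
  intro s hs t ht hst
  have hext := congrArg a.ext hst
  rw [coordLine, coordLine, a.ext_inv (hseg s hs), a.ext_inv (hseg t ht)] at hext
  simpa using congrArg (fun y : EuclideanSpace ℝ (Fin n) => y i) hext

theorem integral_pd_coordLine [CompactSpace X] [IsManifold (quadrant n) ∞ X]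
    (hseg : ∀ t ∈ Icc (0 : ℝ) ε, a.ext x + t • EuclideanSpace.single i 1 ∈ a.img univ)
    (hε : 0 ≤ ε) {f : X → ℝ} (hf : ContDiffOn ℝ 1 (f ∘ a.inv) (a.img univ)) :
    ∫ t in (0 : ℝ)..ε, a.pd univ (fun _ : Fin 1 => i) f (a.coordLine x i t) =
      f (a.coordLine x i ε) - f (a.coordLine x i 0) := by
  have hunique := a.uniqueDiffOn_img (Body.whole n X)
  set γ : ℝ → EuclideanSpace ℝ (Fin n) := fun t => a.ext x + t • EuclideanSpace.single i 1
  have hγ : Continuous γ := by fun_prop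
  have hγ' (t : ℝ) : HasDerivAt γ (EuclideanSpace.single i 1) t := by
    simpa only [id, one_smul] using
      ((hasDerivAt_id t).smul_const (EuclideanSpace.single i (1 : ℝ))).const_add (a.ext x)
  have hpd (t : ℝ) (ht : t ∈ Icc 0 ε) :
      a.pd univ (fun _ : Fin 1 => i) f (a.coordLine x i t) =
        fderivWithin ℝ (f ∘ a.inv) (a.img univ) (γ t) (EuclideanSpace.single i 1) := by
    rw [pd, partialWithin, coordLine, a.ext_inv (hseg t ht)]
    exact iteratedFDerivWithin_one_apply (hunique _ (hseg t ht)) _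
  have hcont : ContinuousOn (fun t => fderivWithin ℝ (f ∘ a.inv) (a.img univ) (γ t)
      (EuclideanSpace.single i 1)) (Icc 0 ε) :=
    ((hf.continuousOn_fderivWithin hunique le_rfl).comp hγ.continuousOn hseg).clm_apply
      continuousOn_const
  rw [intervalIntegral.integral_congr fun t ht => hpd t (by rwa [uIcc_of_le hε] at ht)]
  refine intervalIntegral.integral_eq_sub_of_hasDerivAt_of_le (f := (f ∘ a.inv) ∘ γ) hε
    (hf.continuousOn.comp hγ.continuousOn hseg) (fun t ht => ?_)
    (hcont.intervalIntegrable_of_Icc hε)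
  have hfderiv := (hf.differentiableOn one_ne_zero _
    (hseg t (Ioo_subset_Icc_self ht))).hasFDerivWithinAt
  exact (hfderiv.comp_hasDerivWithinAt t (hγ' t).hasDerivWithinAt hseg).hasDerivAt
    (Icc_mem_nhds ht.1 ht.2)

end VBChart

end CoordinateSegments

section Nonuniqueness

variable {n m r : ℕ} {X : Type u} [TopologicalSpace X] [ChartedSpace (EuclideanQuadrant n) X]
  {W : X → Type u} [∀ x, AddCommGroup (W x)] [∀ x, Module ℝ (W x)]
  [TopologicalSpace (TotalSpace (EuclideanSpace ℝ (Fin m)) W)] [∀ x, TopologicalSpace (W x)]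
  [FiberBundle (EuclideanSpace ℝ (Fin m)) W] [CompactSpace X] [IsManifold (quadrant n) ∞ X]
  {ι : Type} [Fintype ι]

namespace BundleMeasure

theorem exists_add [T2Space X] [MeasurableSpace X] [BorelSpace X] {E₀ : CoordBundle n m W ι}
    (ς τ : BundleMeasure E₀) : ∃ σ : BundleMeasure E₀, ∀ (R : Body n X)
      (E₁ : CoordBundle n m W ι) (χ : E₁.Sec R 0) (u v : ℝ),
      ς.HasIntegral R χ u → τ.HasIntegral R χ v → σ.HasIntegral R χ (u + v) := by
  obtain ⟨σ, hσ⟩ := exists_sum ![ς, τ]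
  refine ⟨σ, fun R E₁ χ u v hu hv => ?_⟩
  have := hσ R E₁ χ ![u, v] (Fin.forall_fin_two.2 ⟨hu, hv⟩)
  rwa [Fin.sum_univ_two] at this

theorem HasIntegral.unique [T2Space X] [VectorBundle ℝ (EuclideanSpace ℝ (Fin m)) W]
    [ContMDiffVectorBundle ∞ (EuclideanSpace ℝ (Fin m)) W (quadrant n)]
    {E₀ E₁ : CoordBundle n m W ι} {ς : BundleMeasure E₀} {R : Body n X} {χ : E₁.Sec R 0}
    {u v : ℝ} (hu : ς.HasIntegral R χ u) (hv : ς.HasIntegral R χ v) : u = v := by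
  obtain ⟨𝔓⟩ := PartitionedAtlas.nonempty (n := n) (m := m) (W := W)
  exact (hu 𝔓).2.symm.trans (hv 𝔓).2

end BundleMeasure

namespace HasSmoothTransitions

variable [T2Space X] {E : Body n X → CoordBundle n m W ι} {a : VBChart n m W}

section

variable [MeasurableSpace X] [BorelSpace X]

theorem exists_bundleMeasure_curve (hE : HasSmoothTransitions E) {γ : ℝ → X} {s t : ℝ}
    (hst : s ≤ t) (hγ : ContinuousOn γ (Icc s t)) (hγa : MapsTo γ (Icc s t) a.dom) (c : ι) :
    ∃ τ : BundleMeasure (E (Body.whole n X)), ∀ (R : Body n X) (χ : (E R).Sec R 0),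
      τ.HasIntegral R χ (∫ l in s..t, (E R).comp a χ.1 c (γ l)) := by
  have hK : IsCompact (γ '' Icc s t) := isCompact_Icc.image_of_continuousOn hγ
  have hγm : AEMeasurable γ (volume.restrict (Icc s t)) := hγ.aemeasurable measurableSet_Icc
  set μ := (volume.restrict (Icc s t)).map γ
  have hμ : μ.restrict (γ '' Icc s t) = μ := Measure.restrict_eq_self_of_ae_mem <|
    (ae_map_iff hγm hK.measurableSet).2 <|
      ae_restrict_of_forall_mem measurableSet_Icc fun l hl => mem_image_of_mem γ hl
  obtain ⟨τ, hτ⟩ := hE.exists_bundleMeasure_of_measure hγa.image_subset hK μ 1 c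
  refine ⟨τ, fun R χ => ?_⟩
  have hmeas : AEStronglyMeasurable ((E R).comp a χ.1 c) μ := by
    simpa only [one_mul, hμ] using (CoordBundle.Sec.integrableOn_mul χ c hK hγa.image_subset
      (continuous_const (y := (1 : ℝ))) μ).aestronglyMeasurable
  have := hτ R χ
  rwa [one_mul, hμ, integral_map hγm hmeas, integral_Icc_eq_integral_Ioc,
    ← intervalIntegral.integral_of_le hst] at this

theorem exists_bundleMeasure_dirac (hE : HasSmoothTransitions E) {x : X} (hx : x ∈ a.dom)
    (z : ℝ) (c : ι) :
    ∃ τ : BundleMeasure (E (Body.whole n X)), ∀ (R : Body n X) (χ : (E R).Sec R 0),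
      τ.HasIntegral R χ (z * (E R).comp a χ.1 c x) := by
  obtain ⟨τ, hτ⟩ := hE.exists_bundleMeasure_of_measure (singleton_subset_iff.2 hx)
    isCompact_singleton (Measure.dirac x) z c
  refine ⟨τ, fun R χ => ?_⟩
  simpa [integral_singleton, measureReal_def] using hτ R χ

theorem exists_bundleMeasure_boundary (hE : HasSmoothTransitions E) {γ : ℝ → X} {s t : ℝ}
    (hst : s ≤ t) (hγ : ContinuousOn γ (Icc s t)) (hγa : MapsTo γ (Icc s t) a.dom) (c₁ c₀ : ι) :
    ∃ τ : BundleMeasure (E (Body.whole n X)), ∀ (R : Body n X) (χ : (E R).Sec R 0),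
      τ.HasIntegral R χ ((∫ l in s..t, (E R).comp a χ.1 c₁ (γ l)) -
        ((E R).comp a χ.1 c₀ (γ t) - (E R).comp a χ.1 c₀ (γ s))) := by
  obtain ⟨τ, hτ⟩ := hE.exists_bundleMeasure_curve hst hγ hγa c₁
  obtain ⟨δt, hδt⟩ := hE.exists_bundleMeasure_dirac (hγa (right_mem_Icc.2 hst)) (-1) c₀
  obtain ⟨δs, hδs⟩ := hE.exists_bundleMeasure_dirac (hγa (left_mem_Icc.2 hst)) 1 c₀
  obtain ⟨δ, hδ⟩ := δt.exists_add δs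
  obtain ⟨σ, hσ⟩ := τ.exists_add δ
  refine ⟨σ, fun R χ => ?_⟩
  convert hσ _ _ χ _ _ (hτ R χ) (hδ _ _ χ _ _ (hδt R χ) (hδs R χ)) using 1
  ring

end

theorem exists_sec_integral_pos (hE : HasSmoothTransitions E) {γ : ℝ → X} {s t : ℝ}
    (hst : s < t) (hγ : ContinuousOn γ (Icc s t)) (hγa : MapsTo γ (Icc s t) a.dom)
    (hγinj : InjOn γ (Icc s t)) :
    ∃ χ : (E (Body.whole n X)).Sec (Body.whole n X) 0, ∀ c,
      (E (Body.whole n X)).comp a χ.1 c (γ s) = 0 ∧ (E (Body.whole n X)).comp a χ.1 c (γ t) = 0 ∧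
      0 < ∫ l in s..t, (E (Body.whole n X)).comp a χ.1 c (γ l) := by
  have hs : s ∈ Icc s t := left_mem_Icc.2 hst.le
  have ht : t ∈ Icc s t := right_mem_Icc.2 hst.le
  obtain ⟨l, hl⟩ := exists_between hst
  have hl' : l ∈ Icc s t := Ioo_subset_Icc_self hl
  have hU : a.dom \ {γ s, γ t} ∈ 𝓝 (γ l) := by
    refine (a.isOpen_dom.sdiff (toFinite _).isClosed).mem_nhds ⟨hγa hl', ?_⟩
    rintro (h | h)
    · exact hl.1.ne' (hγinj hl' hs h)
    · exact hl.2.ne (hγinj hl' ht h)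
  obtain ⟨ρ, C, hC, hCU, hρ, hρ1, hρ0, hρ01⟩ := exists_bump (n := n) hU
  obtain ⟨χ, hχ, hχρ, -⟩ := hE.exists_sec_of_comp (Body.whole n X) a (k := 0) (f := fun _ => ρ) hC
    (hCU.trans sdiff_subset) (fun _ => hρ0)
    fun _ => (hρ.mono (subset_univ _)).of_le (by simp)
  have hcomp (c : ι) (l) (hl : l ∈ Icc s t) :
      (E (Body.whole n X)).comp a χ c (γ l) = ρ (γ l) := hχρ _ ⟨hγa hl, mem_univ _⟩ c
  refine ⟨⟨χ, hχ⟩, fun c => ⟨?_, ?_, ?_⟩⟩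
  · exact (hcomp c s hs).trans (hρ0 _ fun h => (hCU h).2 (by simp))
  · exact (hcomp c t ht).trans (hρ0 _ fun h => (hCU h).2 (by simp))
  · rw [intervalIntegral.integral_congr fun l hl => hcomp c l (by rwa [uIcc_of_le hst.le] at hl)]
    exact intervalIntegral.integral_pos hst (hρ.continuousOn.comp hγ fun _ _ => mem_univ _)
      (fun l _ => (hρ01 _).1) ⟨l, hl', by rw [hρ1.self_of_nhds]; exact one_pos⟩

variable [VectorBundle ℝ (EuclideanSpace ℝ (Fin m)) W]
  [ContMDiffVectorBundle ∞ (EuclideanSpace ℝ (Fin m)) W (quadrant n)]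
  {D : CrSec m W (Body.whole n X) r → (E (Body.whole n X)).Sec (Body.whole n X) 0} {i : Fin n}
  {α : Fin m} {c₁ c₀ : ι} {I₀ : Fin 0 → Fin n}

theorem exists_null [MeasurableSpace X] [BorelSpace X] [Nonempty X]
    (hE : HasSmoothTransitions E) (hr : 1 ≤ r)
    (h₁ : IsPartialComponent D c₁ (fun _ : Fin 1 => i) α) (h₀ : IsPartialComponent D c₀ I₀ α) :
    ∃ τ : BundleMeasure (E (Body.whole n X)),
      (∀ w, τ.HasIntegral (Body.whole n X) (D w) 0) ∧
      ∃ (χ : (E (Body.whole n X)).Sec (Body.whole n X) 0) (v : ℝ), v ≠ 0 ∧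
        τ.HasIntegral (Body.whole n X) χ v := by
  obtain ⟨x⟩ := ‹Nonempty X›
  obtain ⟨ε, hε, hseg⟩ := (VBChart.atPoint n m W x).exists_segment (VBChart.mem_dom_atPoint x) i
  have hmaps := VBChart.mapsTo_coordLine hseg
  have hcont := VBChart.continuousOn_coordLine hseg
  have h₀' (w) (t) (ht : t ∈ Icc 0 ε) := (h₀ w _ _ ⟨hmaps ht, mem_univ _⟩).trans
    (VBChart.pd_zero _ _ _ _ (hmaps ht))
  obtain ⟨τ, hτ⟩ := hE.exists_bundleMeasure_boundary hε.le hcont hmaps c₁ c₀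
  obtain ⟨χ, hχ⟩ := hE.exists_sec_integral_pos hε hcont hmaps (VBChart.injOn_coordLine hseg)
  refine ⟨τ, fun w => ?_, χ, _, ?_, hτ _ χ⟩
  · have hw : ContDiffOn ℝ 1 ((baseBundle n m W).comp (VBChart.atPoint n m W x) w.1 α ∘
        (VBChart.atPoint n m W x).inv) ((VBChart.atPoint n m W x).img univ) :=
      (w.2.2 _ α).of_le (by exact_mod_cast hr)
    convert hτ _ (D w) using 1
    rw [intervalIntegral.integral_congr fun t ht =>
        h₁ w _ _ ⟨hmaps (by rwa [uIcc_of_le hε.le] at ht), mem_univ _⟩,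
      h₀' w ε (right_mem_Icc.2 hε.le), h₀' w 0 (left_mem_Icc.2 hε.le)]
    exact (sub_eq_zero.2 (VBChart.integral_pd_coordLine hseg hε.le hw)).symm
  · rw [(hχ c₀).1, (hχ c₀).2.1, sub_self, sub_zero]
    exact (hχ c₁).2.2.ne'

theorem exists_ne_of_hasIntegral [Nonempty X] (hE : HasSmoothTransitions E) (hr : 1 ≤ r)
    (h₁ : IsPartialComponent D c₁ (fun _ : Fin 1 => i) α) (h₀ : IsPartialComponent D c₀ I₀ α)
    (ς : BundleMeasure (E (Body.whole n X))) {F : CrSec m W (Body.whole n X) r → ℝ}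
    (hς : ∀ w, ς.HasIntegral (Body.whole n X) (D w) (F w)) :
    ∃ ς', ς' ≠ ς ∧ ∀ w, ς'.HasIntegral (Body.whole n X) (D w) (F w) := by
  borelize X
  obtain ⟨τ, hτ, χ, v, hv, hχ⟩ := hE.exists_null hr h₁ h₀
  obtain ⟨σ, hσ⟩ := ς.exists_add τ
  obtain ⟨𝔓⟩ := PartitionedAtlas.nonempty (n := n) (m := m) (W := W)
  have hςχ := hE.hasIntegral_glued ς χ 𝔓
  refine ⟨σ, ?_, fun w => by simpa using hσ _ _ _ _ _ (hς w) (hτ w)⟩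
  rintro rfl
  exact hv (add_eq_left.1 ((hσ _ _ χ _ _ hςχ hχ).unique hςχ))

end HasSmoothTransitions

end Nonuniqueness

section Stresses

variable {n m r : ℕ} {X : Type u} [TopologicalSpace X] [ChartedSpace (EuclideanQuadrant n) X]
  {W : X → Type u} [∀ x, AddCommGroup (W x)] [∀ x, Module ℝ (W x)]
  [TopologicalSpace (TotalSpace (EuclideanSpace ℝ (Fin m)) W)] [∀ x, TopologicalSpace (W x)]
  [FiberBundle (EuclideanSpace ℝ (Fin m)) W]

theorem IsPartialComponent.comp_eq {ι ι' : Type} {k : ℕ} {R : Body n X} {E : CoordBundle n m W ι}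
    {E' : CoordBundle n m W ι'} {D : CrSec m W R r → E.Sec R 0} {D' : CrSec m W R r → E'.Sec R 0}
    {c : ι} {c' : ι'} {I : Fin k → Fin n} {α : Fin m} (hD : IsPartialComponent D c I α)
    (hD' : IsPartialComponent D' c' I α) (w : CrSec m W R r) (a : VBChart n m W) {x : X}
    (hx : x ∈ a.dom) : E.comp a (D w).1 c x = E'.comp a (D' w).1 c' x := by
  by_cases hxR : x ∈ R.carrier
  · rw [hD w a x ⟨hx, hxR⟩, hD' w a x ⟨hx, hxR⟩]
  · rw [CoordBundle.Sec.comp_eq_zero _ a c hxR, CoordBundle.Sec.comp_eq_zero _ a c' hxR]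

variable [CompactSpace X] [T2Space X] [IsManifold (quadrant n) ∞ X]
  [VectorBundle ℝ (EuclideanSpace ℝ (Fin m)) W]
  [ContMDiffVectorBundle ∞ (EuclideanSpace ℝ (Fin m)) W (quadrant n)]

theorem Force.exists_stressMeasures (F : Force m W (Body.whole n X) r) :
    ∃ (ς : HyperStressMeasure n m W r) (ςh : NonholonomicStressMeasure n m W r),
      ς.Represents F ∧ ∀ (R : Body n X) (w : CrSec m W R r) (v : ℝ),
        ς.HasIntegral R (jet R r w) v ↔ ςh.HasIntegral R (iterJet R r w) v := by
  borelize X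
  obtain ⟨𝔎, μ, hμ, hF⟩ := F.exists_measures
  choose θ hθ using fun q : JetIdx n r × Fin m => exists_isIterJetPartial_of_multiindex
    (X := X) (W := W) (Nat.lt_succ_iff.1 q.1.1.2) q.1.2.1 q.2
  have hKa (p : Bool × Fin 𝔎.A × JetIdx n r × Fin m) : 𝔎.K p.2.1 ⊆ (𝔎.chart p.2.1).dom :=
    (𝔎.subset p.2.1).trans inter_subset_left
  obtain ⟨ς, hς⟩ := (hasSmoothTransitions_jetB (m := m) (W := W) r).exists_bundleMeasure
    (fun p => 𝔎.chart p.2.1) (fun p => 𝔎.isCompact p.2.1) hKa μ (fun p => cond p.1 1 (-1))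
    fun p => p.2.2
  obtain ⟨ςh, hςh⟩ := (hasSmoothTransitions_iterJetB (m := m) (W := W) r).exists_bundleMeasure
    (fun p => 𝔎.chart p.2.1) (fun p => 𝔎.isCompact p.2.1) hKa μ (fun p => cond p.1 1 (-1))
    fun p => θ p.2.2
  refine ⟨ς, ςh, fun w => ?_, fun R w v => ?_⟩
  · have hFw : F.toLin w = ∑ p, (cond p.1 1 (-1) : ℝ) * ∫ x in 𝔎.K p.2.1,
        (jetB m W (Body.whole n X) r).comp (𝔎.chart p.2.1) (jet _ r w).1 p.2.2 x ∂μ p := by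
      rw [hF w]
      refine Finset.sum_congr rfl fun p _ => congrArg _ ?_
      exact setIntegral_congr_fun (𝔎.isCompact _).measurableSet fun x hx =>
        (isPartialComponent_jet _ r p.2.2 w _ x (𝔎.subset _ hx)).symm
    exact hFw ▸ hς _ (jet _ r w)
  · have hint (p : Bool × Fin 𝔎.A × JetIdx n r × Fin m) :
        ∫ x in 𝔎.K p.2.1, (jetB m W R r).comp (𝔎.chart p.2.1) (jet R r w).1 p.2.2 x ∂μ p =
          ∫ x in 𝔎.K p.2.1,
            (iterJetB m W R r).comp (𝔎.chart p.2.1) (iterJet R r w).1 (θ p.2.2) x ∂μ p :=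
      setIntegral_congr_fun (𝔎.isCompact _).measurableSet fun x hx =>
        (isPartialComponent_jet R r p.2.2).comp_eq ((hθ p.2.2).isPartialComponent R) w _
          (hKa p hx)
    have hςw := hς R (jet R r w)
    simp only [hint] at hςw
    exact ⟨fun hv => hv.unique hςw ▸ hςh R (iterJet R r w),
      fun hv => hv.unique (hςh R (iterJet R r w)) ▸ hςw⟩

theorem HyperStressMeasure.exists_forceSystem (ς : HyperStressMeasure n m W r) :
    ∃ 𝓕 : ∀ R : Body n X, Force m W R r, ∀ (R : Body n X) (w : CrSec m W R r),
      ς.HasIntegral R (jet R r w) ((𝓕 R).toLin w) := by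
  choose 𝓕 h𝓕 using fun R : Body n X =>
    (hasSmoothTransitions_jetB r).exists_force ς (hasPartialComponents_jet R r)
  exact ⟨𝓕, h𝓕⟩

theorem NonholonomicStressMeasure.exists_forceSystem (ς : NonholonomicStressMeasure n m W r) :
    ∃ 𝓕 : ∀ R : Body n X, Force m W R r, ∀ (R : Body n X) (w : CrSec m W R r),
      ς.HasIntegral R (iterJet R r w) ((𝓕 R).toLin w) := by
  choose 𝓕 h𝓕 using fun R : Body n X =>
    (hasSmoothTransitions_iterJetB r).exists_force ς (hasPartialComponents_iterJet R r)
  exact ⟨𝓕, h𝓕⟩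

theorem HasSmoothTransitions.exists_hasIntegral {ι : Type} [Fintype ι]
    {E : Body n X → CoordBundle n m W ι} (hE : HasSmoothTransitions E)
    (ς : BundleMeasure (E (Body.whole n X))) {R : Body n X} (χ : (E R).Sec R 0) :
    ∃ v, ς.HasIntegral R χ v := by
  borelize X
  obtain ⟨𝔓⟩ := PartitionedAtlas.nonempty (n := n) (m := m) (W := W)
  exact ⟨_, hE.hasIntegral_glued ς χ 𝔓⟩

variable {F : Force m W (Body.whole n X) r}

theorem HyperStressMeasure.Represents.exists_ne [Nonempty X] (hr : 1 ≤ r) (hn : 1 ≤ n)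
    (hm : 1 ≤ m) {ς : HyperStressMeasure n m W r} (hς : ς.Represents F) :
    ∃ ς', ς' ≠ ς ∧ ς'.Represents F :=
  (hasSmoothTransitions_jetB r).exists_ne_of_hasIntegral hr
    (isPartialComponent_jet _ r
      (⟨⟨1, Nat.lt_succ_of_le hr⟩, fun _ => ⟨0, hn⟩, monotone_const⟩, ⟨0, hm⟩))
    (isPartialComponent_jet _ r (⟨0, Fin.elim0, fun i => i.elim0⟩, ⟨0, hm⟩)) ς hς

theorem NonholonomicStressMeasure.Represents.exists_ne [Nonempty X] (hr : 1 ≤ r) (hn : 1 ≤ n)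
    (hm : 1 ≤ m) {ς : NonholonomicStressMeasure n m W r} (hς : ς.Represents F) :
    ∃ ς', ς' ≠ ς ∧ ς'.Represents F := by
  obtain ⟨θ₁, hθ₁⟩ := exists_isIterJetPartial_of_multiindex (X := X) (W := W) hr
    (fun _ : Fin 1 => ⟨0, hn⟩) ⟨0, hm⟩
  obtain ⟨θ₀, hθ₀⟩ := exists_isIterJetPartial_of_multiindex (X := X) (W := W) (Nat.zero_le r)
    (Fin.elim0 : Fin 0 → Fin n) ⟨0, hm⟩
  exact (hasSmoothTransitions_iterJetB r).exists_ne_of_hasIntegral hr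
    (hθ₁.isPartialComponent _) (hθ₀.isPartialComponent _) ς hς

end Stresses

end GlobalStress

end

open GlobalStress in
theorem mainTheorem4 {n m r : ℕ} {X : Type u} [TopologicalSpace X]
    [ChartedSpace (EuclideanQuadrant n) X] [IsManifold (quadrant n) ∞ X] [CompactSpace X] [T2Space X]
    {W : X → Type u} [∀ x, AddCommGroup (W x)] [∀ x, Module ℝ (W x)]
    [TopologicalSpace (TotalSpace (EuclideanSpace ℝ (Fin m)) W)] [∀ x, TopologicalSpace (W x)]
    [FiberBundle (EuclideanSpace ℝ (Fin m)) W] [VectorBundle ℝ (EuclideanSpace ℝ (Fin m)) W]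
    [ContMDiffVectorBundle ∞ (EuclideanSpace ℝ (Fin m)) W (quadrant n)] :
    -- every force is represented by a hyper-stress measure and by a non-holonomic stress measure,
    -- which moreover induce the same force system on the sub-bodies
    (∀ F : Force m W (Body.whole n X) r,
      ∃ (ς : HyperStressMeasure n m W r) (ςh : NonholonomicStressMeasure n m W r),
        ς.Represents F ∧ ςh.Represents F ∧
        ∃ 𝓕 : ∀ R : Body n X, Force m W R r, ∀ (R : Body n X) (w : CrSec m W R r),
          ς.HasIntegral R (jet R r w) ((𝓕 R).toLin w) ∧
          ςh.HasIntegral R (iterJet R r w) ((𝓕 R).toLin w)) ∧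
    -- the representing measures are never unique, except in the degenerate cases
    (1 ≤ r → 1 ≤ n → 1 ≤ m → Nonempty X → ∀ F : Force m W (Body.whole n X) r,
      (∀ ς : HyperStressMeasure n m W r, ς.Represents F → ∃ ς', ς' ≠ ς ∧ ς'.Represents F) ∧
      (∀ ςh : NonholonomicStressMeasure n m W r, ςh.Represents F →
        ∃ ςh', ςh' ≠ ςh ∧ ςh'.Represents F)) ∧
    -- the glued integral of continuous sections is well defined, and every hyper-stress measure
    -- and every non-holonomic stress measure induces a system of forces on the sub-bodies
    (∀ ς : HyperStressMeasure n m W r,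
      (∀ (R : Body n X) (χ : (jetB m W R r).Sec R 0), ∃ v, ς.HasIntegral R χ v) ∧
      ∃ 𝓕 : ∀ R : Body n X, Force m W R r, ∀ (R : Body n X) (w : CrSec m W R r),
        ς.HasIntegral R (jet R r w) ((𝓕 R).toLin w)) ∧
    (∀ ςh : NonholonomicStressMeasure n m W r,
      (∀ (R : Body n X) (χ : (iterJetB m W R r).Sec R 0), ∃ v, ςh.HasIntegral R χ v) ∧
      ∃ 𝓕 : ∀ R : Body n X, Force m W R r, ∀ (R : Body n X) (w : CrSec m W R r),
        ςh.HasIntegral R (iterJet R r w) ((𝓕 R).toLin w)) := by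
  refine ⟨fun F => ?_, fun hr hn hm _ F =>
      ⟨fun ς hς => hς.exists_ne hr hn hm, fun ςh hς => hς.exists_ne hr hn hm⟩,
    fun ς => ⟨fun R χ => (hasSmoothTransitions_jetB r).exists_hasIntegral ς χ,
      ς.exists_forceSystem⟩,
    fun ςh => ⟨fun R χ => (hasSmoothTransitions_iterJetB r).exists_hasIntegral ςh χ,
      ςh.exists_forceSystem⟩⟩
  obtain ⟨ς, ςh, hς, hiff⟩ := F.exists_stressMeasures
  obtain ⟨𝓕, h𝓕⟩ := ς.exists_forceSystem
  exact ⟨ς, ςh, hς, fun w => (hiff _ w _).1 (hς w), 𝓕, fun R w =>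
    ⟨h𝓕 R w, (hiff R w _).1 (h𝓕 R w)⟩⟩
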